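/- Conventions. Let $k$ be a commutative ring; DG categories, DG functors and DG monads are over $k$ (structure maps of a DG monad are closed of degree $0$). For a DG category $\mathcal C$, $H^0(\mathcal C)$ has the same objects and morphisms $H^0\mathrm{Hom}_{\mathcal C}$, and $\mathrm{Tw}(\mathcal C)$ is the DG category of one-sided twisted complexes $(\bigoplus_i C_i[r_i], q)$ (finite formal sums, $q$ strictly triangular of degree $1$, $dq+q^2=0$). $\mathcal C$ is *pretriangulated* if $H^0(\mathcal C)\to H^0(\mathrm{Tw}(\mathcal C))$ is an equivalence, and *strongly pretriangulated* if every object of $\mathrm{Tw}(\mathcal C)$ is DG isomorphic to an object of $\mathcal C$. If $\mathcal C$ is pretriangulated, $H^0(\mathcal C)$ carries the canonical triangulated structure of $H^0(\mathrm{Tw}(\mathcal C))$ given by shifts and cones of twisted complexes. An *enhancement* (resp. *strong enhancement*) of a triangulated category $C$ is a pair $(\mathcal C,\epsilon)$ with $\mathcal C$ a pretriangulated (resp. strongly pretriangulated) DG category and $\epsilon:H^0(\mathcal C)\to C$ an equivalence of triangulated categories. A DG monad $\mathcal M$ on $\mathcal C$ together with a natural isomorphism $\epsilon\circ H^0(\mathcal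 M)\cong M\circ\epsilon$ is a *lift* of a monad $M$ on $C$ (the functor $H^0(\mathcal M)$ is automatically exact). The *DG Eilenberg–Moore category* $\mathcal M\text{-}\mathrm{Mod}_{dg}$ has as objects the pairs $(x,\lambda)$ with $\lambda:\mathcal Mx\to x$ closed of degree $0$, associative and unital, and as morphisms of degree $n$ the morphisms $\varphi:x\to x'$ of degree $n$ with $\lambda'\circ\mathcal M\varphi=\varphi\circ\lambda$. Statement. Let $M$ be a monad on a triangulated category $C$ whose underlying functor is exact, let $(\mathcal C,\epsilon)$ be an enhancement of $C$, and let $\mathcal M$ be a DG monad on $\mathcal C$ that lifts $M$. 1. Suppose that $(\mathcal C,\epsilon)$ is a strong enhancement. Then $\mathcal M\text{-}\mathrm{Mod}_{dg}$ is pretriangulated, so that $D^{tr}:=H^0(\mathcal M\text{-}\mathrm{Mod}_{dg})$ with its canonical structure is a triangulated category, and there are exact functors $F^{tr}:C\to D^{tr}$ and $G^{tr}:D^{tr}\to C$, with $F^{tr}$ left adjoint to $G^{tr}$, such that $G^{tr}\circ F^{tr}\cong M$ as functors. If the isomorphism $\epsilon\circ H^0(\mathcal M)\cong M\circ\epsilon$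 is compatible with the units and multiplications of the two monads, then the adjunction can be chosen so that, in addition, its monad is isomorphic to $M$ as a monad. 2. Without the assumption that the enhancement is strong, all conclusions of (1) hold with $\mathcal M\text{-}\mathrm{Mod}_{dg}$ replaced by the DG Eilenberg–Moore category of the DG monad that $\mathcal M$ induces on $\mathrm{Tw}(\mathcal C)$. -/

import Mathlib

open CategoryTheory CategoryTheory.Limits CategoryTheory.Pretriangulated

universe w v u v' u'

/-- A DG category over a commutative ring `k`: graded `k`-modules of morphisms, a differential of
degree `1`, and bilinear composition. `comp h f g` is "`f` followed by `g`", that is `g ∘ f`. -/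
class DGCategory (k : Type w) [CommRing k] (C : Type u) where
  Hom : C → C → ℤ → Type v
  [addCommGroup : ∀ x y n, AddCommGroup (Hom x y n)]
  [module : ∀ x y n, Module k (Hom x y n)]
  d {x y : C} {n m : ℤ} (h : n + 1 = m) : Hom x y n →ₗ[k] Hom x y m
  one (x : C) : Hom x x 0
  comp {x y z : C} {a b c : ℤ} (h : a + b = c) : Hom x y a →ₗ[k] Hom y z b →ₗ[k] Hom x z c
  d_d {x y : C} {n m p : ℤ} (h : n + 1 = m) (h' : m + 1 = p) (f : Hom x y n) :
    d h' (d h f) = 0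
  one_comp {x y : C} {n : ℤ} (h : 0 + n = n) (f : Hom x y n) : comp h (one x) f = f
  comp_one {x y : C} {n : ℤ} (h : n + 0 = n) (f : Hom x y n) : comp h f (one y) = f
  assoc {x y z t : C} {a b c ab bc abc : ℤ} (hab : a + b = ab) (hbc : b + c = bc)
    (h : ab + c = abc) (h' : a + bc = abc) (f : Hom x y a) (g : Hom y z b) (l : Hom z t c) :
    comp h (comp hab f g) l = comp h' f (comp hbc g l)
  /-- `d (g ∘ f) = (d g) ∘ f + (-1) ^ |g| g ∘ (d f)` -/
  leibniz {x y z : C} {a b c a' b' c' : ℤ} (h : a + b = c) (hc : c + 1 = c') (ha : a + 1 = a')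
    (hb : b + 1 = b') (h₁ : a + b' = c') (h₂ : a' + b = c') (f : Hom x y a) (g : Hom y z b) :
    d hc (comp h f g) = comp h₁ f (d hb g) + b.negOnePow • comp h₂ (d ha f) g

attribute [reducible, instance] DGCategory.addCommGroup DGCategory.module

namespace DGCategory

section Basic

variable {k : Type w} [CommRing k] {C : Type u} [DGCategory.{w, v, u} k C]

/-- Transport along an equality of degrees. -/
def castDeg {x y : C} {a b : ℤ} (h : a = b) : Hom k x y a →ₗ[k] Hom k x y b :=
  h ▸ LinearMap.id

@[simp] lemma castDeg_self {x y : C} {a : ℤ} (h : a = a) (f : Hom k x y a) :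
    castDeg h f = f := rfl

@[simp] lemma castDeg_comp {x y z : C} {a a' b c : ℤ} (e : a = a') (h : a' + b = c)
    (f : Hom k x y a) (g : Hom k y z b) :
    comp h (castDeg e f) g = comp (e ▸ h) f g := by subst e; rfl

@[simp] lemma comp_castDeg {x y z : C} {a b b' c : ℤ} (e : b = b') (h : a + b' = c)
    (f : Hom k x y a) (g : Hom k y z b) :
    comp h f (castDeg e g) = comp (e ▸ h) f g := by subst e; rfl

@[simp] lemma castDeg_of_comp {x y z : C} {a b c c' : ℤ} (e : c = c') (h : a + b = c)
    (f : Hom k x y a) (g : Hom k y z b) :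
    castDeg e (comp h f g) = comp (e ▸ h) f g := by subst e; rfl

@[simp] lemma d_castDeg {x y : C} {a b m : ℤ} (e : a = b) (h : b + 1 = m) (f : Hom k x y a) :
    d h (castDeg e f) = d (e ▸ h) f := by subst e; rfl

@[simp] lemma castDeg_d {x y : C} {n m m' : ℤ} (e : m = m') (h : n + 1 = m) (f : Hom k x y n) :
    castDeg e (d h f) = d (e ▸ h) f := by subst e; rfl

@[simp] lemma castDeg_castDeg {x y : C} {a b c : ℤ} (e : a = b) (e' : b = c) (f : Hom k x y a) :
    castDeg e' (castDeg e f) = castDeg (e.trans e') f := by subst e; rfl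

lemma zero_comp {x y z : C} {a b c : ℤ} (h : a + b = c) (g : Hom k y z b) :
    comp h (0 : Hom k x y a) g = 0 := by rw [map_zero, LinearMap.zero_apply]

lemma comp_zero {x y z : C} {a b c : ℤ} (h : a + b = c) (f : Hom k x y a) :
    comp h f (0 : Hom k y z b) = 0 := map_zero _

lemma neg_comp {x y z : C} {a b c : ℤ} (h : a + b = c) (f : Hom k x y a) (g : Hom k y z b) :
    comp h (-f) g = - comp h f g := by rw [map_neg, LinearMap.neg_apply]

lemma smul_d_zero {x y : C} {n m : ℤ} (h : n + 1 = m) (s : ℤˣ) :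
    s • d h (0 : Hom k x y n) = 0 := by rw [map_zero, smul_zero]

lemma smul_comp_unit {x y z : C} {a b c : ℤ} (h : a + b = c) (s : ℤˣ)
    (f : Hom k x y a) (g : Hom k y z b) : comp h (s • f) g = s • comp h f g := by
  rw [Units.smul_def, Units.smul_def, map_zsmul, LinearMap.smul_apply]

lemma comp_smul_unit {x y z : C} {a b c : ℤ} (h : a + b = c) (s : ℤˣ)
    (f : Hom k x y a) (g : Hom k y z b) : comp h f (s • g) = s • comp h f g := by
  rw [Units.smul_def, Units.smul_def, map_zsmul]

lemma comp_one' {x y : C} {a c : ℤ} (h : a + 0 = c) (f : Hom k x y a) :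
    comp h f (one y) = castDeg (by omega) f := by
  obtain rfl : a = c := by omega
  exact comp_one h f

lemma one_comp' {x y : C} {b c : ℤ} (h : 0 + b = c) (f : Hom k x y b) :
    comp h (one x) f = castDeg (by omega) f := by
  obtain rfl : b = c := by omega
  exact one_comp h f

@[simp] lemma d_one {m : ℤ} (h : 0 + 1 = m) (x : C) : d h (one (k := k) x) = 0 := by
  obtain rfl : (1 : ℤ) = m := by omega
  have := leibniz (k := k) (zero_add (0 : ℤ)) h h h (zero_add _) (add_zero _) (one x) (one x)
  simpa [one_comp, comp_one] using this

variable (k) in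
/-- DG isomorphism: a closed isomorphism of degree `0`. -/
def Isomorphic (x y : C) : Prop :=
  ∃ (f : Hom k x y 0) (g : Hom k y x 0),
    d (zero_add 1) f = 0 ∧ d (zero_add 1) g = 0 ∧
      comp (zero_add 0) f g = one x ∧ comp (zero_add 0) g f = one y

end Basic

end DGCategory

open DGCategory

/-! ### The homotopy category -/

/-- The category `H⁰(C)`: same objects, morphisms the zeroth cohomology of the complexes `Hom`. -/
structure HZero (k : Type w) [CommRing k] (C : Type u) [DGCategory.{w, v, u} k C] where
  as : C

namespace HZero

variable {k : Type w} [CommRing k] {C : Type u} [DGCategory.{w, v, u} k C]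

variable (k) in
/-- Closed morphisms of degree `0`. -/
def cycles (x y : C) : Submodule k (Hom k x y 0) :=
  LinearMap.ker (d (zero_add 1))

variable (k) in
/-- Null-homotopic closed morphisms of degree `0`. -/
def boundaries (x y : C) : Submodule k (cycles k x y) :=
  (LinearMap.range (d (k := k) (x := x) (y := y) (neg_add_cancel 1))).comap (cycles k x y).subtype

/-- Composition of closed morphisms of degree `0`. -/
def cyclesComp {x y z : C} (f : cycles k x y) (g : cycles k y z) : cycles k x z :=
  ⟨comp (zero_add 0) f.1 g.1, by
    have hf : d (zero_add 1) f.1 = 0 := f.2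
    have hg : d (zero_add 1) g.1 = 0 := g.2
    change d (zero_add 1) _ = 0
    rw [leibniz (zero_add 0) (zero_add 1) (zero_add 1) (zero_add 1) (zero_add 1) (add_zero 1),
      hf, hg]
    simp⟩

/-- Composition in `H⁰`. -/
def homComp {x y z : C} (f : cycles k x y ⧸ boundaries k x y)
    (g : cycles k y z ⧸ boundaries k y z) : cycles k x z ⧸ boundaries k x z :=
  Quotient.map₂ cyclesComp (by
    intro f f' hf g g' hg
    rw [← Quotient.eq_iff_equiv] at hf hg ⊢
    have hf := (Submodule.Quotient.eq (boundaries k x y)).1 hf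
    have hg := (Submodule.Quotient.eq (boundaries k y z)).1 hg
    refine (Submodule.Quotient.eq (boundaries k x z)).2 ?_
    obtain ⟨s, hs⟩ := hf
    obtain ⟨t, ht⟩ := hg
    have hg1 : d (zero_add 1) g.1 = 0 := g.2
    have hf1 : d (zero_add 1) f'.1 = 0 := f'.2
    refine ⟨comp (add_zero (-1)) s g.1 + comp (zero_add (-1)) f'.1 t, ?_⟩
    rw [map_add, leibniz (add_zero (-1)) (neg_add_cancel 1) (neg_add_cancel 1) (zero_add 1)
        (by omega) (zero_add 0),
      leibniz (zero_add (-1)) (neg_add_cancel 1) (zero_add 1) (neg_add_cancel 1)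
        (zero_add 0) (by omega), hg1, hf1, hs, ht]
    simp [cyclesComp]) f g

instance : Category.{v} (HZero k C) where
  Hom X Y := cycles k X.as Y.as ⧸ boundaries k X.as Y.as
  id X := Submodule.Quotient.mk ⟨one X.as, d_one _ _⟩
  comp f g := homComp f g
  id_comp {X Y} f := by
    obtain ⟨f, rfl⟩ := Submodule.Quotient.mk_surjective _ f
    exact congrArg Submodule.Quotient.mk (Subtype.ext (DGCategory.one_comp _ _))
  comp_id {X Y} f := by
    obtain ⟨f, rfl⟩ := Submodule.Quotient.mk_surjective _ f
    exact congrArg Submodule.Quotient.mk (Subtype.ext (DGCategory.comp_one _ _))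
  assoc {X Y Z T} f g h := by
    obtain ⟨f, rfl⟩ := Submodule.Quotient.mk_surjective _ f
    obtain ⟨g, rfl⟩ := Submodule.Quotient.mk_surjective _ g
    obtain ⟨h, rfl⟩ := Submodule.Quotient.mk_surjective _ h
    exact congrArg Submodule.Quotient.mk (Subtype.ext (DGCategory.assoc _ _ _ _ _ _ _))

variable (k) in
/-- The morphism of `H⁰` represented by a closed morphism of degree `0`. -/
def homMk {x y : C} (f : Hom k x y 0) (hf : d (zero_add 1) f = 0) :
    HZero.mk (k := k) x ⟶ HZero.mk (k := k) y :=
  Submodule.Quotient.mk ⟨f, hf⟩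

instance : Preadditive (HZero k C) where
  homGroup X Y := inferInstanceAs (AddCommGroup (cycles k X.as Y.as ⧸ boundaries k X.as Y.as))
  add_comp X Y Z f f' g := by
    obtain ⟨f, rfl⟩ := Submodule.Quotient.mk_surjective _ f
    obtain ⟨f', rfl⟩ := Submodule.Quotient.mk_surjective _ f'
    obtain ⟨g, rfl⟩ := Submodule.Quotient.mk_surjective _ g
    refine congrArg Submodule.Quotient.mk (Subtype.ext ?_)
    simp [cyclesComp]
  comp_add X Y Z f g g' := by
    obtain ⟨f, rfl⟩ := Submodule.Quotient.mk_surjective _ f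
    obtain ⟨g, rfl⟩ := Submodule.Quotient.mk_surjective _ g
    obtain ⟨g', rfl⟩ := Submodule.Quotient.mk_surjective _ g'
    refine congrArg Submodule.Quotient.mk (Subtype.ext ?_)
    simp [cyclesComp]

/-- The functor between homotopy categories induced by maps on morphisms of degree `0` that
preserve closed morphisms, boundaries, identities and composition. -/
def functorOfMap {D : Type u'} [DGCategory.{w, v', u'} k D] (obj : C → D)
    (map : ∀ {x y : C}, Hom k x y 0 →ₗ[k] Hom k (obj x) (obj y) 0)
    (map_cycles : ∀ {x y : C} (f : Hom k x y 0),
      d (zero_add 1) f = 0 → d (zero_add 1) (map f) = 0)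
    (map_boundaries : ∀ {x y : C} (s : Hom k x y (-1)),
      ∃ t : Hom k (obj x) (obj y) (-1), d (neg_add_cancel 1) t = map (d (neg_add_cancel 1) s))
    (map_one : ∀ x : C, map (one (k := k) x) = one (obj x))
    (map_comp : ∀ {x y z : C} (f : Hom k x y 0) (g : Hom k y z 0),
      map (comp (zero_add 0) f g) = comp (zero_add 0) (map f) (map g)) :
    HZero k C ⥤ HZero k D where
  obj X := ⟨obj X.as⟩
  map {X Y} f := Submodule.mapQ (boundaries k X.as Y.as) (boundaries k (obj X.as) (obj Y.as))
    (map.restrict fun f hf => map_cycles f hf) (by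
      rintro f ⟨s, hs⟩
      obtain ⟨t, ht⟩ := map_boundaries s
      exact ⟨t, ht.trans (congrArg map hs)⟩) f
  map_id X := congrArg Submodule.Quotient.mk (Subtype.ext (map_one _))
  map_comp {X Y Z} f g := by
    obtain ⟨f, rfl⟩ := Submodule.Quotient.mk_surjective _ f
    obtain ⟨g, rfl⟩ := Submodule.Quotient.mk_surjective _ g
    exact congrArg Submodule.Quotient.mk (Subtype.ext (map_comp _ _))

end HZero

/-! ### DG functors, DG natural transformations, DG monads -/

/-- A DG functor. -/
structure DGFunctor (k : Type w) [CommRing k] (C : Type u) [DGCategory.{w, v, u} k C]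
    (D : Type u') [DGCategory.{w, v', u'} k D] where
  obj : C → D
  map {x y : C} {n : ℤ} : Hom k x y n →ₗ[k] Hom k (obj x) (obj y) n
  map_one (x : C) : map (one (k := k) x) = one (obj x)
  map_comp {x y z : C} {a b c : ℤ} (h : a + b = c) (f : Hom k x y a) (g : Hom k y z b) :
    map (comp h f g) = comp h (map f) (map g)
  map_d {x y : C} {n m : ℤ} (h : n + 1 = m) (f : Hom k x y n) : map (d h f) = d h (map f)

namespace DGFunctor

variable {k : Type w} [CommRing k] {C : Type u} [DGCategory.{w, v, u} k C]
  {D : Type u'} [DGCategory.{w, v', u'} k D]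

/-- The functor `H⁰(F) : H⁰(C) ⥤ H⁰(D)`. -/
def hZero (F : DGFunctor k C D) : HZero k C ⥤ HZero k D :=
  HZero.functorOfMap F.obj F.map
    (fun f hf => by rw [← F.map_d, hf, map_zero])
    (fun s => ⟨F.map s, (F.map_d _ s).symm⟩)
    F.map_one (fun f g => F.map_comp _ f g)

lemma map_castDeg (F : DGFunctor k C D) {x y : C} {a b : ℤ} (e : a = b) (f : Hom k x y a) :
    F.map (castDeg e f) = castDeg e (F.map f) := by subst e; rfl

variable (k C) in
/-- The identity DG functor. -/
def idFunctor : DGFunctor k C C where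
  obj x := x
  map := LinearMap.id
  map_one _ := rfl
  map_comp _ _ _ := rfl
  map_d _ _ := rfl

/-- Composition `G ∘ F` of DG functors (`F` first). -/
def compFunctor {E : Type*} [DGCategory k E] (F : DGFunctor k C D) (G : DGFunctor k D E) :
    DGFunctor k C E where
  obj x := G.obj (F.obj x)
  map := G.map ∘ₗ F.map
  map_one x := by simp [F.map_one, G.map_one]
  map_comp h f g := by simp [F.map_comp, G.map_comp]
  map_d h f := by simp [F.map_d, G.map_d]

end DGFunctor

/-- A DG natural transformation: closed components of degree `0`, natural with respect to
morphisms of all degrees. -/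
structure DGNatTrans {k : Type w} [CommRing k] {C : Type u} [DGCategory.{w, v, u} k C]
    {D : Type u'} [DGCategory.{w, v', u'} k D] (F G : DGFunctor k C D) where
  app (x : C) : Hom k (F.obj x) (G.obj x) 0
  d_app (x : C) : d (zero_add 1) (app x) = 0
  naturality {x y : C} {n : ℤ} (f : Hom k x y n) :
    comp (add_zero n) (F.map f) (app y) = comp (zero_add n) (app x) (G.map f)

/-- A DG monad on `C`. -/
structure DGMonad (k : Type w) [CommRing k] (C : Type u) [DGCategory.{w, v, u} k C] where
  functor : DGFunctor k C C
  μ : DGNatTrans (functor.compFunctor functor) functor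
  η : DGNatTrans (DGFunctor.idFunctor k C) functor
  assoc (x : C) : comp (zero_add 0) (functor.map (μ.app x)) (μ.app x) =
    comp (zero_add 0) (μ.app (functor.obj x)) (μ.app x)
  left_unit (x : C) : comp (zero_add 0) (η.app (functor.obj x)) (μ.app x) = one (functor.obj x)
  right_unit (x : C) : comp (zero_add 0) (functor.map (η.app x)) (μ.app x) = one (functor.obj x)

/-! ### The DG Eilenberg–Moore category -/

/-- Modules over a DG monad: an object with a closed action of degree `0`. -/
structure EilenbergMoore {k : Type w} [CommRing k] {C : Type u} [DGCategory.{w, v, u} k C]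
    (N : DGMonad k C) where
  obj : C
  act : Hom k (N.functor.obj obj) obj 0
  d_act : d (zero_add 1) act = 0
  assoc : comp (zero_add 0) (N.functor.map act) act = comp (zero_add 0) (N.μ.app obj) act
  unit : comp (zero_add 0) (N.η.app obj) act = one obj

namespace EilenbergMoore

variable {k : Type w} [CommRing k] {C : Type u} [DGCategory.{w, v, u} k C] {N : DGMonad k C}

/-- Morphisms of degree `n` of modules: the morphisms `f` of degree `n` with `λ' ∘ N f = f ∘ λ`. -/
def hom (X Y : EilenbergMoore N) (n : ℤ) : Submodule k (Hom k X.obj Y.obj n) where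
  carrier := {f | comp (add_zero n) (N.functor.map f) Y.act = comp (zero_add n) X.act f}
  add_mem' {f g} hf hg := by
    change comp _ (N.functor.map (f + g)) Y.act = comp _ X.act (f + g)
    rw [map_add, map_add, map_add, LinearMap.add_apply]
    exact congrArg₂ (· + ·) hf hg
  zero_mem' := by simp
  smul_mem' c f hf := by
    change comp _ (N.functor.map (c • f)) Y.act = comp _ X.act (c • f)
    rw [map_smul, map_smul, map_smul, LinearMap.smul_apply]
    exact congrArg (c • ·) hf

lemma d_mem {X Y : EilenbergMoore N} {n m : ℤ} (h : n + 1 = m) {f : Hom k X.obj Y.obj n}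
    (hf : f ∈ hom X Y n) : d h f ∈ hom X Y m := by
  have hf : comp (add_zero n) (N.functor.map f) Y.act = comp (zero_add n) X.act f := hf
  have := congrArg (d h) hf
  rw [leibniz (add_zero n) h h (zero_add 1) h (add_zero m),
    leibniz (zero_add n) h (zero_add 1) h (zero_add m) (by omega), X.d_act, Y.d_act] at this
  simpa [hom, DGFunctor.map_d] using this

lemma comp_mem {X Y Z : EilenbergMoore N} {a b c : ℤ} (h : a + b = c) {f : Hom k X.obj Y.obj a}
    {g : Hom k Y.obj Z.obj b} (hf : f ∈ hom X Y a) (hg : g ∈ hom Y Z b) :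
    comp h f g ∈ hom X Z c := by
  have hf : comp (add_zero a) (N.functor.map f) Y.act = comp (zero_add a) X.act f := hf
  have hg : comp (add_zero b) (N.functor.map g) Z.act = comp (zero_add b) Y.act g := hg
  change comp _ (N.functor.map (comp h f g)) Z.act = comp _ X.act (comp h f g)
  rw [N.functor.map_comp, DGCategory.assoc h (add_zero b) _ h, hg,
    ← DGCategory.assoc (add_zero a) (zero_add b) h h, hf,
    DGCategory.assoc (zero_add a) h h (zero_add c)]

lemma id_mem (X : EilenbergMoore N) : one X.obj ∈ hom X X 0 := by
  change comp _ (N.functor.map (one X.obj)) X.act = comp _ X.act (one X.obj)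
  rw [N.functor.map_one, DGCategory.one_comp, DGCategory.comp_one]

instance : DGCategory.{w, v, max u v} k (EilenbergMoore N) where
  Hom X Y n := hom X Y n
  d h := (d h).restrict fun _ hf => d_mem h hf
  one X := ⟨one X.obj, id_mem X⟩
  comp h := LinearMap.mk₂ k (fun f g => ⟨comp h f.1 g.1, comp_mem h f.2 g.2⟩)
    (by intros; ext; simp) (by intros; ext; simp) (by intros; ext; simp) (by intros; ext; simp)
  d_d h h' f := Subtype.ext (DGCategory.d_d h h' f.1)
  one_comp h f := Subtype.ext (DGCategory.one_comp h f.1)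
  comp_one h f := Subtype.ext (DGCategory.comp_one h f.1)
  assoc hab hbc h h' f g l := Subtype.ext (DGCategory.assoc hab hbc h h' f.1 g.1 l.1)
  leibniz h hc ha hb h₁ h₂ f g := Subtype.ext (by
    have := DGCategory.leibniz h hc ha hb h₁ h₂ f.1 g.1
    simpa [Units.smul_def] using this)

end EilenbergMoore

/-! ### Twisted complexes -/

/-- A formal finite direct sum `⨁ᵢ Cᵢ[rᵢ]` of shifts of objects of `C`. -/
structure FormalSum (C : Type u) where
  ι : Type
  [fintype : Fintype ι]
  obj : ι → C
  deg : ι → ℤ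

attribute [instance] FormalSum.fintype

namespace FormalSum

section

variable {k : Type w} [CommRing k] {C : Type u} [DGCategory.{w, v, u} k C]

variable (k) in
/-- Matrices of morphisms: a morphism `Cⱼ[sⱼ] ⟶ C'ᵢ[rᵢ]` of degree `n` is a morphism
`Cⱼ ⟶ C'ᵢ` of degree `n + rᵢ - sⱼ`. -/
abbrev hom (X Y : FormalSum C) (n : ℤ) : Type v :=
  ∀ (i : Y.ι) (j : X.ι), Hom k (X.obj j) (Y.obj i) (n + Y.deg i - X.deg j)

open Classical in
variable (k) in
/-- The identity matrix. -/
noncomputable def oneMatrix (X : FormalSum C) : hom k X X 0 := fun i j =>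
  if h : i = j then h ▸ castDeg (by omega) (one (k := k) (X.obj i)) else 0

/-- The matrix product. -/
def matComp {X Y Z : FormalSum C} {a b c : ℤ} (h : a + b = c) (f : hom k X Y a)
    (g : hom k Y Z b) : hom k X Z c := fun i j => ∑ l, comp (by omega) (f l j) (g i l)

/-- The entrywise differential, with the sign `(-1) ^ rᵢ` in the row of `C'ᵢ[rᵢ]`. -/
def matD {X Y : FormalSum C} {n m : ℤ} (h : n + 1 = m) : hom k X Y n →ₗ[k] hom k X Y m where
  toFun f := fun i j => (Y.deg i).negOnePow • d (by omega) (f i j)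
  map_add' f g := by ext i j; simp
  map_smul' c f := by
    funext i j
    rw [RingHom.id_apply, Pi.smul_apply, Pi.smul_apply, Pi.smul_apply, Pi.smul_apply, map_smul, Units.smul_def, Units.smul_def, smul_comm]

lemma matComp_apply {X Y Z : FormalSum C} {a b c : ℤ} (h : a + b = c) (f : hom k X Y a)
    (g : hom k Y Z b) (i : Z.ι) (j : X.ι) :
    matComp h f g i j = ∑ l, comp (by omega) (f l j) (g i l) := rfl

lemma matD_apply {X Y : FormalSum C} {n m : ℤ} (h : n + 1 = m) (f : hom k X Y n) (i : Y.ι)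
    (j : X.ι) : matD h f i j = (Y.deg i).negOnePow • d (by omega) (f i j) := rfl

@[simp] lemma oneMatrix_self (X : FormalSum C) (i : X.ι) :
    oneMatrix k X i i = castDeg (by omega) (one (k := k) (X.obj i)) := by
  simp [oneMatrix]

lemma oneMatrix_of_ne (X : FormalSum C) {i j : X.ι} (h : i ≠ j) :
    oneMatrix k X i j = 0 := by
  simp [oneMatrix, h]

lemma one_matComp {X Y : FormalSum C} {n m : ℤ} (h : 0 + n = m) (f : hom k X Y n) (i : Y.ι)
    (j : X.ι) : matComp h (oneMatrix k X) f i j = castDeg (by omega) (f i j) := by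
  rw [matComp, Finset.sum_eq_single j]
  · rw [oneMatrix_self, castDeg_comp, one_comp']
  · intro l _ hl
    rw [oneMatrix_of_ne X hl, map_zero, LinearMap.zero_apply]
  · simp

lemma matComp_one {X Y : FormalSum C} {n m : ℤ} (h : n + 0 = m) (f : hom k X Y n) (i : Y.ι)
    (j : X.ι) : matComp h f (oneMatrix k Y) i j = castDeg (by omega) (f i j) := by
  rw [matComp, Finset.sum_eq_single i]
  · rw [oneMatrix_self, comp_castDeg, comp_one']
  · intro l _ hl
    rw [oneMatrix_of_ne Y (Ne.symm hl), map_zero]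
  · simp

noncomputable instance : DGCategory.{w, v, max 1 u} k (FormalSum C) where
  Hom X Y n := hom k X Y n
  d h := matD h
  one X := oneMatrix k X
  comp h := LinearMap.mk₂ k (matComp h)
    (by intros; ext; simp [matComp, Finset.sum_add_distrib])
    (by intros; ext; simp [matComp, Finset.smul_sum])
    (by intros; ext; simp [matComp, Finset.sum_add_distrib])
    (by intros; ext; simp [matComp, Finset.smul_sum])
  d_d {X Y n m p} h h' f := by
    funext i j
    change matD h' (matD h f) i j = 0
    rw [matD_apply, matD_apply, map_zsmul_unit, DGCategory.d_d, smul_zero, smul_zero]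
  one_comp h f := by
    funext i j
    exact one_matComp h f i j
  comp_one h f := by
    funext i j
    exact matComp_one h f i j
  assoc {X Y Z T a b c ab bc abc} hab hbc h h' f g l := by
    funext i j
    change ∑ p, comp _ (∑ q, comp _ (f q j) (g p q)) (l i p) =
      ∑ q, comp _ (f q j) (∑ p, comp _ (g p q) (l i p))
    simp only [map_sum, LinearMap.sum_apply]
    rw [Finset.sum_comm]
    exact Finset.sum_congr rfl fun q _ => Finset.sum_congr rfl fun p _ =>
      DGCategory.assoc _ _ _ _ _ _ _
  leibniz {X Y Z a b c a' b' c'} h hc ha hb h₁ h₂ f g := by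
    funext i j
    change matD hc (matComp h f g) i j =
      matComp h₁ f (matD hb g) i j + b.negOnePow • matComp h₂ (matD ha f) g i j
    simp only [matD_apply, matComp_apply]
    rw [map_sum, Finset.smul_sum, Finset.smul_sum, ← Finset.sum_add_distrib]
    refine Finset.sum_congr rfl fun l _ => ?_
    rw [leibniz _ _ (a' := a' + Y.deg l - X.deg j) (b' := b' + Z.deg i - Y.deg l)
      (by omega) (by omega) (by omega) (by omega), smul_add, comp_smul_unit, smul_comp_unit,
      smul_smul, smul_smul, ← Int.negOnePow_add, ← Int.negOnePow_add]
    congr 2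
    rw [Int.negOnePow_eq_iff]
    exact ⟨Z.deg i - Y.deg l, by ring⟩

/-- The shift `⨁ᵢ Cᵢ[rᵢ + 1]`. -/
def shift (X : FormalSum C) : FormalSum C where
  ι := X.ι
  obj := X.obj
  deg i := X.deg i + 1

/-- The action of the shift on morphisms: the entries do not change. -/
def shiftMap {X Y : FormalSum C} {n : ℤ} : Hom k X Y n →ₗ[k] Hom k X.shift Y.shift n where
  toFun f := (fun i j => castDeg (k := k) (x := X.obj j) (y := Y.obj i)
      (show n + Y.deg i - X.deg j = n + (Y.deg i + 1) - (X.deg j + 1) by omega)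
      ((f : hom k X Y n) i j) : hom k X.shift Y.shift n)
  map_add' f g := by
    funext i j
    exact map_add (castDeg (k := k) (x := X.obj j) (y := Y.obj i) _)
      ((f : hom k X Y n) i j) ((g : hom k X Y n) i j)
  map_smul' c f := by
    funext i j
    exact map_smul (castDeg (k := k) (x := X.obj j) (y := Y.obj i) _) c ((f : hom k X Y n) i j)

lemma shiftMap_one (X : FormalSum C) : shiftMap (one (k := k) X) = one X.shift := by
  funext i j
  by_cases h : i = j
  · subst h
    refine (congrArg (castDeg _) (oneMatrix_self (k := k) X i)).trans ?_
    exact (castDeg_castDeg _ _ _).trans (oneMatrix_self (k := k) X.shift i).symm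
  · refine (congrArg (castDeg _) (oneMatrix_of_ne (k := k) X h)).trans ?_
    exact (map_zero _).trans (oneMatrix_of_ne (k := k) X.shift h).symm

lemma shiftMap_comp {X Y Z : FormalSum C} {a b c : ℤ} (h : a + b = c) (f : Hom k X Y a)
    (g : Hom k Y Z b) : shiftMap (comp h f g) = comp h (shiftMap f) (shiftMap g) := by
  funext i j
  refine (map_sum (castDeg (k := k) (x := X.obj j) (y := Z.obj i) _) _ _).trans ?_
  exact Finset.sum_congr rfl fun l _ => (castDeg_of_comp _ _ _ _).trans
    ((comp_castDeg _ _ _ _).trans (castDeg_comp _ _ _ _)).symm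

lemma d_shiftMap {X Y : FormalSum C} {n m : ℤ} (h : n + 1 = m) (f : Hom k X Y n) :
    d h (shiftMap f) = - shiftMap (d h f) := by
  funext i j
  have key : ∀ {x y : C} {p p' q q' : ℤ} (r : ℤ) (e : p = p') (e' : q = q') (h : p + 1 = q)
      (h' : p' + 1 = q') (f : Hom k x y p), (r + 1).negOnePow • d h' (castDeg e f) =
        - castDeg e' (r.negOnePow • d h f) := by
    intro x y p p' q q' r e e' h h' f
    rw [map_zsmul_unit, castDeg_d, d_castDeg, Int.negOnePow_succ, Units.neg_smul]
  exact key (x := X.obj j) (y := Y.obj i) (Y.deg i) _ _ _ _ _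

end

end FormalSum

/-- A (one-sided) twisted complex `(⨁ᵢ Cᵢ[rᵢ], q)`: `q` has degree `1`, satisfies the
Maurer–Cartan equation `d q + q ∘ q = 0`, and is strictly triangular for some order of the
summands (given by a rank function): the entry `Cⱼ[rⱼ] ⟶ Cᵢ[rᵢ]` vanishes unless
`rank i < rank j`. -/
structure TwistedComplex (k : Type w) [CommRing k] (C : Type u) [DGCategory.{w, v, u} k C] where
  sum : FormalSum C
  q : Hom k sum sum 1
  triangular : ∃ rank : sum.ι → ℕ, ∀ i j, rank j ≤ rank i → (q : FormalSum.hom k sum sum 1) i j = 0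
  maurerCartan : d one_add_one_eq_two q + comp one_add_one_eq_two q q = 0

namespace TwistedComplex

section

variable {k : Type w} [CommRing k] {C : Type u} [DGCategory.{w, v, u} k C]

/-- The twisted differential `f ↦ d f + q' ∘ f - (-1) ^ |f| f ∘ q`. -/
noncomputable def twistedD {X Y : TwistedComplex k C} {n m : ℤ} (h : n + 1 = m) :
    Hom k X.sum Y.sum n →ₗ[k] Hom k X.sum Y.sum m where
  toFun f := d h f + comp h f Y.q - n.negOnePow • comp (by omega) X.q f
  map_add' f g := by
    simp only [map_add, LinearMap.add_apply, smul_add]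
    abel
  map_smul' c f := by
    simp only [map_smul, LinearMap.smul_apply, RingHom.id_apply, smul_add, smul_sub,
      Units.smul_def, smul_comm c]

lemma twistedD_apply {X Y : TwistedComplex k C} {n m : ℤ} (h : n + 1 = m)
    (f : Hom k X.sum Y.sum n) :
    twistedD h f = d h f + comp h f Y.q - n.negOnePow • comp (by omega) X.q f := rfl

lemma d_q (X : TwistedComplex k C) {m : ℤ} (h : 1 + 1 = m) :
    d h X.q = - comp h X.q X.q := by
  obtain rfl : (2 : ℤ) = m := by omega
  exact eq_neg_of_add_eq_zero_left X.maurerCartan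

lemma twistedD_twistedD {X Y : TwistedComplex k C} {n m p : ℤ} (h : n + 1 = m) (h' : m + 1 = p)
    (f : Hom k X.sum Y.sum n) : twistedD h' (twistedD h f) = 0 := by
  subst h h'
  simp only [twistedD_apply, map_add, map_sub, map_zsmul_unit, DGCategory.d_d]
  rw [leibniz rfl rfl rfl rfl (by omega) (by omega) f Y.q,
    leibniz (by omega) rfl rfl rfl (by omega) (by omega) X.q f, d_q, d_q,
    DGCategory.assoc rfl rfl _ (by omega) f Y.q Y.q,
    DGCategory.assoc (by omega) rfl rfl (by omega) X.q f Y.q,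
    ← DGCategory.assoc rfl (by omega) (by omega) (by omega) X.q X.q f]
  simp only [map_neg, LinearMap.neg_apply, Int.negOnePow_succ, Int.negOnePow_one, Units.neg_smul,
    one_smul, smul_sub, smul_add, smul_neg, smul_smul, ← Int.negOnePow_add]
  simp only [Int.negOnePow_even (n + n) ⟨n, rfl⟩, one_smul]
  abel

lemma twistedD_leibniz {X Y Z : TwistedComplex k C} {a b c a' b' c' : ℤ} (h : a + b = c)
    (hc : c + 1 = c') (ha : a + 1 = a') (hb : b + 1 = b') (h₁ : a + b' = c') (h₂ : a' + b = c')
    (f : Hom k X.sum Y.sum a) (g : Hom k Y.sum Z.sum b) :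
    twistedD (X := X) (Y := Z) hc (comp h f g) =
      comp h₁ f (twistedD hb g) + b.negOnePow • comp h₂ (twistedD ha f) g := by
  subst h hc ha hb
  simp only [twistedD_apply, map_add, map_sub, LinearMap.add_apply, LinearMap.sub_apply,
    smul_comp_unit, comp_smul_unit]
  rw [leibniz rfl rfl rfl rfl h₁ h₂ f g,
    DGCategory.assoc rfl rfl rfl h₁ f g Z.q,
    DGCategory.assoc (bc := b + 1) rfl (by omega) h₂ h₁ f Y.q g,
    ← DGCategory.assoc (ab := a + 1) (by omega) rfl h₂ (by omega) X.q f g]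
  simp only [smul_sub, smul_add, smul_smul, Int.negOnePow_add, mul_comm]
  abel

noncomputable instance : DGCategory.{w, v, max 1 u v} k (TwistedComplex k C) where
  Hom X Y n := Hom k X.sum Y.sum n
  d h := twistedD h
  one X := one X.sum
  comp h := comp h
  d_d h h' f := twistedD_twistedD h h' f
  one_comp h f := DGCategory.one_comp h f
  comp_one h f := DGCategory.comp_one h f
  assoc := DGCategory.assoc
  leibniz := twistedD_leibniz

/-- The shift `(⨁ᵢ Cᵢ[rᵢ + 1], -q)`. -/
noncomputable def shift (X : TwistedComplex k C) : TwistedComplex k C where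
  sum := X.sum.shift
  q := - FormalSum.shiftMap X.q
  triangular := by
    obtain ⟨rank, hrank⟩ := X.triangular
    refine ⟨rank, fun i j hij => ?_⟩
    change - (castDeg _ ((X.q : FormalSum.hom k X.sum X.sum 1) i j)) = 0
    rw [hrank i j hij]
    exact (congrArg Neg.neg (map_zero _)).trans neg_zero
  maurerCartan := by
    rw [map_neg, FormalSum.d_shiftMap, d_q, map_neg, map_neg, map_neg, LinearMap.neg_apply,
      ← FormalSum.shiftMap_comp]
    simp

/-- The action of the shift on morphisms. -/
def shiftMap {X Y : TwistedComplex k C} {n : ℤ} : Hom k X Y n →ₗ[k] Hom k X.shift Y.shift n :=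
  FormalSum.shiftMap (X := X.sum) (Y := Y.sum)

lemma d_shiftMap {X Y : TwistedComplex k C} {n m : ℤ} (h : n + 1 = m) (f : Hom k X Y n) :
    d h (shiftMap f) = - shiftMap (d h f) := by
  refine (twistedD_apply (X := X.shift) (Y := Y.shift) h (FormalSum.shiftMap f)).trans ?_
  refine Eq.trans ?_ (congrArg (fun z => - FormalSum.shiftMap (X := X.sum) (Y := Y.sum) z)
    (twistedD_apply (X := X) (Y := Y) h f)).symm
  change d h (FormalSum.shiftMap (X := X.sum) (Y := Y.sum) f) +
    comp h (FormalSum.shiftMap (X := X.sum) (Y := Y.sum) f) (- FormalSum.shiftMap Y.q) -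
    n.negOnePow • comp (by omega : 1 + n = m) (- FormalSum.shiftMap X.q)
      (FormalSum.shiftMap (X := X.sum) (Y := Y.sum) f) = _
  simp only [FormalSum.d_shiftMap, map_sub, map_add, map_zsmul_unit, FormalSum.shiftMap_comp,
    map_neg, LinearMap.neg_apply, smul_neg]
  abel

lemma shiftMap_one (X : TwistedComplex k C) : shiftMap (one (k := k) X) = one X.shift :=
  FormalSum.shiftMap_one X.sum

lemma shiftMap_comp {X Y Z : TwistedComplex k C} {a b c : ℤ} (h : a + b = c) (f : Hom k X Y a)
    (g : Hom k Y Z b) : shiftMap (comp h f g) = comp h (shiftMap f) (shiftMap g) :=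
  FormalSum.shiftMap_comp (X := X.sum) (Y := Y.sum) (Z := Z.sum) h f g

/-- The shift functor `[1]` on `H⁰` of the category of twisted complexes. -/
noncomputable def shiftFunctor (k : Type w) [CommRing k] (C : Type u) [DGCategory.{w, v, u} k C] :
    HZero k (TwistedComplex k C) ⥤ HZero k (TwistedComplex k C) :=
  HZero.functorOfMap shift shiftMap
    (fun f hf => by rw [d_shiftMap, hf, map_zero, neg_zero])
    (fun s => ⟨- shiftMap s, by rw [map_neg, d_shiftMap, neg_neg]⟩)
    shiftMap_one (fun f g => shiftMap_comp _ f g)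

end

end TwistedComplex

namespace FormalSum

section

variable {k : Type w} [CommRing k] {C : Type u} [DGCategory.{w, v, u} k C]

/-- The direct sum of two formal sums. -/
def directSum (Y X : FormalSum C) : FormalSum C where
  ι := Y.ι ⊕ X.ι
  obj := Sum.elim Y.obj X.obj
  deg := Sum.elim Y.deg X.deg

/-- The morphism `X[1] ⟶ Y` of degree `n + 1` given by a morphism `X ⟶ Y` of degree `n`. -/
def unshift {X Y : FormalSum C} {n m : ℤ} (h : n + 1 = m) :
    Hom k X Y n →ₗ[k] Hom k X.shift Y m where
  toFun f := (fun i j => castDeg (k := k) (x := X.obj j) (y := Y.obj i)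
      (show n + Y.deg i - X.deg j = m + Y.deg i - (X.deg j + 1) by omega)
      ((f : hom k X Y n) i j) : hom k X.shift Y m)
  map_add' f g := by
    funext i j
    exact map_add (castDeg (k := k) (x := X.obj j) (y := Y.obj i) _)
      ((f : hom k X Y n) i j) ((g : hom k X Y n) i j)
  map_smul' c f := by
    funext i j
    exact map_smul (castDeg (k := k) (x := X.obj j) (y := Y.obj i) _) c ((f : hom k X Y n) i j)

lemma d_unshift {X Y : FormalSum C} {n m p : ℤ} (h : n + 1 = m) (h' : m + 1 = p)
    (f : Hom k X Y n) : d h' (unshift h f) = unshift h' (d h f) := by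
  funext i j
  have key : ∀ {x y : C} {p p' q q' : ℤ} (s : ℤˣ) (e : p = p') (e' : q = q') (h : p + 1 = q)
      (h' : p' + 1 = q') (f : Hom k x y p), s • d h' (castDeg e f) =
        castDeg e' (s • d h f) := by
    intro x y p p' q q' r e e' h h' f
    rw [map_zsmul_unit, castDeg_d, d_castDeg]
  exact key (x := X.obj j) (y := Y.obj i) _ _ _ _ _ _

lemma unshift_comp {X Y Z : FormalSum C} {a b c a' c' : ℤ} (h : a + b = c) (ha : a + 1 = a')
    (hc : c + 1 = c') (h' : a' + b = c') (f : Hom k X Y a) (g : Hom k Y Z b) :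
    unshift hc (comp h f g) = comp h' (unshift ha f) g := by
  funext i j
  refine (map_sum (castDeg (k := k) (x := X.obj j) (y := Z.obj i) _) _ _).trans ?_
  exact Finset.sum_congr rfl fun l _ => (castDeg_of_comp _ _ _ _).trans
    (castDeg_comp _ _ _ _).symm

lemma unshift_comp' {X Y Z : FormalSum C} {a b c b' c' : ℤ} (h : a + b = c) (hb : b + 1 = b')
    (hc : c + 1 = c') (h' : a + b' = c') (f : Hom k X Y a) (g : Hom k Y Z b) :
    unshift hc (comp h f g) = comp h' (shiftMap f) (unshift hb g) := by
  funext i j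
  refine (map_sum (castDeg (k := k) (x := X.obj j) (y := Z.obj i) _) _ _).trans ?_
  exact Finset.sum_congr rfl fun l _ => (castDeg_of_comp _ _ _ _).trans
    ((comp_castDeg _ _ _ _).trans (castDeg_comp _ _ _ _)).symm

/-- The upper triangular block matrix with diagonal blocks `a`, `e` and with the block
`b : X ⟶ Y`. -/
def blocks {X Y : FormalSum C} {n : ℤ} (a : hom k Y Y n) (b : hom k X Y n) (e : hom k X X n) :
    hom k (directSum Y X) (directSum Y X) n
  | Sum.inl i, Sum.inl j => a i j
  | Sum.inl i, Sum.inr j => b i j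
  | Sum.inr _, Sum.inl _ => 0
  | Sum.inr i, Sum.inr j => e i j

lemma blocks_add {X Y : FormalSum C} {n : ℤ} (a a' : hom k Y Y n) (b b' : hom k X Y n)
    (e e' : hom k X X n) :
    blocks a b e + blocks a' b' e' = blocks (a + a') (b + b') (e + e') := by
  funext i j
  rcases i with i | i <;> rcases j with j | j
  · rfl
  · rfl
  · exact add_zero _
  · rfl

lemma blocks_zero {X Y : FormalSum C} {n : ℤ} :
    blocks (0 : hom k Y Y n) (0 : hom k X Y n) 0 = 0 := by
  funext i j
  rcases i with i | i <;> rcases j with j | j <;> rfl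

lemma matD_blocks {X Y : FormalSum C} {n m : ℤ} (h : n + 1 = m) (a : hom k Y Y n)
    (b : hom k X Y n) (e : hom k X X n) :
    matD h (blocks a b e) = blocks (matD h a) (matD h b) (matD h e) := by
  funext i j
  rcases i with i | i <;> rcases j with j | j
  · rfl
  · rfl
  · exact smul_d_zero _ _
  · rfl

lemma matComp_blocks {X Y : FormalSum C} {n m p : ℤ} (h : n + m = p) (a : hom k Y Y n)
    (b : hom k X Y n) (e : hom k X X n) (a' : hom k Y Y m) (b' : hom k X Y m)
    (e' : hom k X X m) :
    matComp h (blocks a b e) (blocks a' b' e') =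
      blocks (matComp h a a') (matComp h b a' + matComp h e b') (matComp h e e') := by
  funext i j
  refine (Fintype.sum_sum_type _).trans ?_
  rcases i with i | i <;> rcases j with j | j
  · refine (congrArg₂ (· + ·) rfl (Finset.sum_eq_zero fun l _ => ?_)).trans (add_zero _)
    exact DGCategory.zero_comp _ _
  · rfl
  · refine (congrArg₂ (· + ·) (Finset.sum_eq_zero fun l _ => ?_)
      (Finset.sum_eq_zero fun l _ => ?_)).trans (add_zero _)
    · exact DGCategory.comp_zero _ _
    · exact DGCategory.zero_comp _ _
  · refine (congrArg₂ (· + ·) (Finset.sum_eq_zero fun l _ => ?_) rfl).trans (zero_add _)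
    exact DGCategory.comp_zero _ _

/-- The inclusion of the first summand. -/
noncomputable def inclusion (Y X : FormalSum C) : hom k Y (directSum Y X) 0
  | Sum.inl i, j => oneMatrix k Y i j
  | Sum.inr _, _ => 0

/-- The projection to the second summand. -/
noncomputable def projection (Y X : FormalSum C) : hom k (directSum Y X) X 0
  | _, Sum.inl _ => 0
  | i, Sum.inr j => oneMatrix k X i j

lemma matD_one (X : FormalSum C) : matD (zero_add 1) (oneMatrix k X) = 0 :=
  DGCategory.d_one (k := k) (zero_add 1) X

lemma matD_inclusion (Y X : FormalSum C) : matD (zero_add 1) (inclusion (k := k) Y X) = 0 := by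
  funext i j
  rcases i with i | i
  · exact congrFun (congrFun (matD_one (k := k) Y) i) j
  · exact smul_d_zero _ _

lemma matD_projection (Y X : FormalSum C) : matD (zero_add 1) (projection (k := k) Y X) = 0 := by
  funext i j
  rcases j with j | j
  · exact smul_d_zero _ _
  · exact congrFun (congrFun (matD_one (k := k) X) i) j

lemma inclusion_blocks {X Y : FormalSum C} {n : ℤ} (a : hom k Y Y n) (b : hom k X Y n)
    (e : hom k X X n) :
    matComp (zero_add n) (inclusion Y X) (blocks a b e) =
      matComp (add_zero n) a (inclusion Y X) := by
  funext i j
  refine (Fintype.sum_sum_type _).trans ?_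
  rcases i with i | i
  · refine (congrArg₂ (· + ·) rfl (Finset.sum_eq_zero fun l _ => ?_)).trans ((add_zero _).trans ?_)
    · exact DGCategory.zero_comp _ _
    · exact (one_matComp (zero_add n) a i j).trans (matComp_one (add_zero n) a i j).symm
  · refine (congrArg₂ (· + ·) (Finset.sum_eq_zero fun l _ => ?_)
      (Finset.sum_eq_zero fun l _ => ?_)).trans ((add_zero _).trans ?_)
    · exact DGCategory.comp_zero _ _
    · exact DGCategory.zero_comp _ _
    · exact (Finset.sum_eq_zero fun l _ => DGCategory.comp_zero _ _).symm

lemma blocks_projection {X Y : FormalSum C} {n : ℤ} (a : hom k Y Y n) (b : hom k X Y n)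
    (e : hom k X X n) :
    matComp (add_zero n) (blocks a b e) (projection Y X) =
      matComp (zero_add n) (projection Y X) e := by
  funext i j
  refine (Fintype.sum_sum_type _).trans ?_
  rcases j with j | j
  · refine (congrArg₂ (· + ·) (Finset.sum_eq_zero fun l _ => ?_)
      (Finset.sum_eq_zero fun l _ => ?_)).trans ((add_zero _).trans ?_)
    · exact DGCategory.comp_zero _ _
    · exact DGCategory.zero_comp _ _
    · exact (Finset.sum_eq_zero fun l _ =>
        DGCategory.zero_comp _ _).symm
  · refine (congrArg₂ (· + ·) (Finset.sum_eq_zero fun l _ => ?_) rfl).trans ((zero_add _).trans ?_)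
    · exact DGCategory.comp_zero _ _
    · exact (matComp_one (add_zero n) e i j).trans (one_matComp (zero_add n) e i j).symm

end

end FormalSum

namespace TwistedComplex

section

variable {k : Type w} [CommRing k] {C : Type u} [DGCategory.{w, v, u} k C]

/-- The cone of a closed morphism `f : X ⟶ Y` of degree `0`: the formal sum `Y ⊕ X[1]` with
`q = (q_Y, f; 0, -q_X)`. -/
noncomputable def cone {X Y : TwistedComplex k C} (f : Hom k X Y 0) (hf : d (zero_add 1) f = 0) :
    TwistedComplex k C where
  sum := FormalSum.directSum Y.sum X.sum.shift
  q := FormalSum.blocks Y.q (FormalSum.unshift (X := X.sum) (Y := Y.sum) (zero_add 1) f) X.shift.q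
  triangular := by
    obtain ⟨rY, hY⟩ := Y.triangular
    obtain ⟨rX, hX⟩ := X.shift.triangular
    refine ⟨Sum.elim rY (fun j => (∑ i, rY i) + 1 + rX j), ?_⟩
    have hle : ∀ i, rY i ≤ ∑ i, rY i := fun i =>
      Finset.single_le_sum (fun _ _ => Nat.zero_le _) (Finset.mem_univ i)
    rintro (i | i) (j | j) hij
    · exact hY i j hij
    · have := hle i
      simp only [Sum.elim_inl, Sum.elim_inr] at hij
      omega
    · rfl
    · refine hX i j ?_
      simp only [Sum.elim_inr] at hij
      omega
  maurerCartan := by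
    have hf' : d (x := X.sum) (y := Y.sum) (zero_add 1) f +
        comp (x := X.sum) (y := Y.sum) (zero_add 1) f Y.q -
        comp (y := X.sum) (z := Y.sum) (add_zero 1) X.q f = 0 := by
      have := (twistedD_apply (zero_add 1) f).symm.trans hf
      rwa [Int.negOnePow_zero, one_smul] at this
    have h1 := congrArg (FormalSum.unshift (one_add_one_eq_two)) hf'
    rw [map_zero, map_sub, map_add, ← FormalSum.d_unshift,
      FormalSum.unshift_comp (zero_add 1) (zero_add 1) one_add_one_eq_two one_add_one_eq_two,
      FormalSum.unshift_comp' (add_zero 1) (zero_add 1) one_add_one_eq_two one_add_one_eq_two]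
      at h1
    refine (congrArg₂ (· + ·) (FormalSum.matD_blocks _ _ _ _)
      (FormalSum.matComp_blocks one_add_one_eq_two _ _ _ _ _ _)).trans ?_
    refine (FormalSum.blocks_add _ _ _ _ _ _).trans ?_
    refine Eq.trans ?_ FormalSum.blocks_zero
    congr 1
    · exact Y.maurerCartan
    · refine Eq.trans ?_ h1
      rw [sub_eq_add_neg, add_assoc]
      refine congrArg₂ (· + ·) rfl (congrArg₂ (· + ·) rfl ?_)
      exact neg_comp one_add_one_eq_two (FormalSum.shiftMap X.q)
        (FormalSum.unshift (X := X.sum) (Y := Y.sum) (zero_add 1) f)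
    · exact X.shift.maurerCartan

/-- The inclusion `Y ⟶ cone f`. -/
noncomputable def coneInclusion {X Y : TwistedComplex k C} (f : Hom k X Y 0)
    (hf : d (zero_add 1) f = 0) : Hom k Y (cone f hf) 0 :=
  FormalSum.inclusion Y.sum X.sum.shift

/-- The projection `cone f ⟶ X[1]`. -/
noncomputable def coneProjection {X Y : TwistedComplex k C} (f : Hom k X Y 0)
    (hf : d (zero_add 1) f = 0) : Hom k (cone f hf) X.shift 0 :=
  FormalSum.projection Y.sum X.sum.shift

lemma d_coneInclusion {X Y : TwistedComplex k C} (f : Hom k X Y 0)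
    (hf : d (zero_add 1) f = 0) : d (zero_add 1) (coneInclusion f hf) = 0 := by
  refine (twistedD_apply _ _).trans ?_
  rw [Int.negOnePow_zero, one_smul, sub_eq_zero]
  refine (congrArg₂ (· + ·) (FormalSum.matD_inclusion _ _)
    (FormalSum.inclusion_blocks _ _ _)).trans (zero_add _)

lemma d_coneProjection {X Y : TwistedComplex k C} (f : Hom k X Y 0)
    (hf : d (zero_add 1) f = 0) : d (zero_add 1) (coneProjection f hf) = 0 := by
  refine (twistedD_apply _ _).trans ?_
  rw [Int.negOnePow_zero, one_smul, sub_eq_zero]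
  refine (congrArg₂ (· + ·) (FormalSum.matD_projection _ _)
    (FormalSum.blocks_projection _ _ _).symm).trans (zero_add _)

variable (k) in
/-- An object as a twisted complex with a single summand. -/
noncomputable def single (x : C) : TwistedComplex k C where
  sum := { ι := Unit, obj := fun _ => x, deg := fun _ => 0 }
  q := 0
  triangular := ⟨fun _ => 0, fun _ _ _ => rfl⟩
  maurerCartan := by rw [map_zero, DGCategory.comp_zero, add_zero]

/-- A morphism of `C` as a `1 × 1` matrix. -/
noncomputable def singleMap {x y : C} {n : ℤ} :
    Hom k x y n →ₗ[k] Hom k (single k x) (single k y) n where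
  toFun f := (fun _ _ => castDeg (k := k) (x := x) (y := y) (show n = n + 0 - 0 by omega) f :
    FormalSum.hom k (single k x).sum (single k y).sum n)
  map_add' f g := by
    funext i j
    exact map_add (castDeg (k := k) (x := x) (y := y) _) f g
  map_smul' c f := by
    funext i j
    exact map_smul (castDeg (k := k) (x := x) (y := y) _) c f

end

/-- The embedding of `C` into its category of twisted complexes. -/
noncomputable def embedding (k : Type w) [CommRing k] (C : Type u) [DGCategory.{w, v, u} k C] :
    DGFunctor k C (TwistedComplex k C) where
  obj x := single k x
  map := singleMap
  map_one x := by
    funext i j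
    exact (FormalSum.oneMatrix_self (k := k) (single k x).sum i).symm
  map_comp {x y z a b c} h f g := by
    funext i j
    refine Eq.trans ?_ (Finset.sum_singleton (fun _ : Unit =>
      comp (k := k) (show a + 0 - 0 + (b + 0 - 0) = c + 0 - 0 by omega)
        (castDeg (show a = a + 0 - 0 by omega) f) (castDeg (show b = b + 0 - 0 by omega) g))
      ()).symm
    exact (castDeg_of_comp _ _ _ _).trans
      ((comp_castDeg _ _ _ _).trans (castDeg_comp _ _ _ _)).symm
  map_d {x y n m} h f := by
    refine Eq.trans ?_ (twistedD_apply (X := single k x) (Y := single k y) h (singleMap f)).symm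
    have h1 : comp h (singleMap f : Hom k (single k x).sum (single k y).sum n)
      (single k y).q = 0 := DGCategory.comp_zero h _
    have h2 : comp (by omega : 1 + n = m) (single k x).q
      (singleMap f : Hom k (single k x).sum (single k y).sum n) = 0 := DGCategory.zero_comp _ _
    have key : ∀ (D E F : Hom k (single k x).sum (single k y).sum m), E = 0 → F = 0 →
        D + E - n.negOnePow • F = D := by
      rintro D _ _ rfl rfl
      rw [smul_zero, sub_zero, add_zero]
    refine Eq.trans ?_ (key _ _ _ h1 h2).symm
    funext i j
    refine (castDeg_d _ _ _).trans ?_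
    refine Eq.trans ?_ (one_smul ℤˣ _).symm
    exact (d_castDeg _ _ _).symm

end TwistedComplex

/-! ### Functoriality of twisted complexes -/

namespace FormalSum

section

variable {k : Type w} [CommRing k] {C : Type u} [DGCategory.{w, v, u} k C]

/-- The diagonal matrix with entries `ν i`. -/
noncomputable def diag (X : FormalSum C) (obj' : X.ι → C) (ν : ∀ i, Hom k (X.obj i) (obj' i) 0) :
    hom k X ⟨X.ι, obj', X.deg⟩ 0 := fun i j =>
  comp (x := X.obj j) (add_zero _) (oneMatrix k X i j) (ν i)

lemma matComp_diag {Y : FormalSum C} (X : FormalSum C) (obj' : X.ι → C) (ν : ∀ i, Hom k (X.obj i) (obj' i) 0)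
    {n : ℤ} (f : hom k Y X n) (i : X.ι) (j : Y.ι) :
    matComp (add_zero n) f (diag X obj' ν) i j =
      comp (x := Y.obj j) (z := obj' i) (add_zero _) (f i j) (ν i) := by
  have h := congrArg (fun z => comp (x := Y.obj j) (z := obj' i) (add_zero _) z (ν i))
    (matComp_one (add_zero n) f i j)
  simp only [castDeg_self] at h
  refine Eq.trans ?_ h
  rw [matComp_apply, matComp_apply, map_sum, LinearMap.sum_apply]
  exact Finset.sum_congr rfl fun l _ =>
    (DGCategory.assoc (k := k) (z := X.obj i) (t := obj' i) _ _ _ _ _ _ _).symm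

lemma diag_apply (X : FormalSum C) (obj' : X.ι → C) (ν : ∀ i, Hom k (X.obj i) (obj' i) 0)
    (i j : X.ι) : diag X obj' ν i j =
      comp (x := X.obj j) (z := obj' i) (add_zero _) (oneMatrix k X i j) (ν i) := rfl

lemma matD_diag (X : FormalSum C) (obj' : X.ι → C) (ν : ∀ i, Hom k (X.obj i) (obj' i) 0)
    (hν : ∀ i, d (zero_add 1) (ν i) = 0) : matD (zero_add 1) (diag X obj' ν) = 0 := by
  funext i j
  have h0 := congrFun (congrFun (matD_one (k := k) X) i) j
  rw [matD_apply] at h0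
  have h1 : d (by omega : 0 + X.deg i - X.deg j + 1 = 1 + X.deg i - X.deg j)
      (oneMatrix k X i j) = 0 := (smul_eq_zero_iff_eq (α := ℤˣ) _).1 h0
  have h2 := leibniz (k := k) (add_zero (0 + X.deg i - X.deg j))
    (by omega : 0 + X.deg i - X.deg j + 1 = 1 + X.deg i - X.deg j)
    (by omega : 0 + X.deg i - X.deg j + 1 = 1 + X.deg i - X.deg j) (zero_add 1)
    (by omega) (by omega) (oneMatrix k X i j) (ν i)
  rw [hν, h1, DGCategory.comp_zero, DGCategory.zero_comp, smul_zero, add_zero] at h2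
  exact (congrArg ((X.deg i).negOnePow • ·) h2).trans (smul_zero _)

lemma diag_matComp (X : FormalSum C) (obj' : X.ι → C) (ν : ∀ i, Hom k (X.obj i) (obj' i) 0)
    {Z : FormalSum C} {n : ℤ} (f : hom k ⟨X.ι, obj', X.deg⟩ Z n) (i : Z.ι) (j : X.ι) :
    matComp (zero_add n) (diag X obj' ν) f i j =
      comp (x := X.obj j) (z := Z.obj i) (zero_add _) (ν j) (f i j) := by
  rw [matComp, Finset.sum_eq_single j]
  · have h1 : diag X obj' ν j j = castDeg (by simp) (ν j) := by
      rw [diag, oneMatrix_self, castDeg_comp, one_comp']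
    rw [h1]
    exact castDeg_comp _ _ _ _
  · intro l _ hl
    have h1 : diag X obj' ν l j = 0 := by
      rw [diag, oneMatrix_of_ne X hl]
      exact DGCategory.zero_comp _ _
    rw [h1]
    exact DGCategory.zero_comp _ _
  · simp

end

end FormalSum

namespace DGFunctor

variable {k : Type w} [CommRing k] {C : Type u} [DGCategory.{w, v, u} k C]
  {D : Type u'} [DGCategory.{w, v', u'} k D]

lemma map_smul_unit (F : DGFunctor k C D) {x y : C} {n : ℤ} (s : ℤˣ) (f : Hom k x y n) :
    F.map (s • f) = s • F.map f := map_zsmul_unit _ _ _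

/-- The entrywise extension of a DG functor to formal sums. -/
noncomputable def formalSum (F : DGFunctor k C D) :
    DGFunctor k (FormalSum C) (FormalSum D) where
  obj X := ⟨X.ι, fun i => F.obj (X.obj i), X.deg⟩
  map {X Y n} :=
    { toFun := fun f i j => F.map ((f : FormalSum.hom k X Y n) i j)
      map_add' := fun f g => by
        funext i j
        exact map_add F.map ((f : FormalSum.hom k X Y n) i j) ((g : FormalSum.hom k X Y n) i j)
      map_smul' := fun c f => by
        funext i j
        exact map_smul F.map c ((f : FormalSum.hom k X Y n) i j) }
  map_one X := by
    funext i j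
    change F.map (FormalSum.oneMatrix k X i j) =
      FormalSum.oneMatrix k (⟨X.ι, fun i => F.obj (X.obj i), X.deg⟩ : FormalSum D) i j
    by_cases h : i = j
    · subst h
      rw [FormalSum.oneMatrix_self, FormalSum.oneMatrix_self, map_castDeg, F.map_one]
    · rw [FormalSum.oneMatrix_of_ne X h, map_zero]
      exact (FormalSum.oneMatrix_of_ne _ h).symm
  map_comp h f g := by
    funext i j
    refine (map_sum F.map _ _).trans (Finset.sum_congr rfl fun l _ => F.map_comp _ _ _)
  map_d h f := by
    funext i j
    exact (F.map_smul_unit _ _).trans (congrArg _ (F.map_d _ _))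

/-- The twisted complex `(⨁ᵢ F Cᵢ[rᵢ], F q)`. -/
noncomputable def twistedObj (F : DGFunctor k C D) (X : TwistedComplex k C) :
    TwistedComplex k D where
  sum := F.formalSum.obj X.sum
  q := F.formalSum.map X.q
  triangular := by
    obtain ⟨rank, hrank⟩ := X.triangular
    exact ⟨rank, fun i j hij => (congrArg F.map (hrank i j hij)).trans (map_zero _)⟩
  maurerCartan := by
    rw [← F.formalSum.map_d, ← F.formalSum.map_comp, ← map_add, X.maurerCartan, map_zero]

/-- The extension of a DG functor to twisted complexes. -/
noncomputable def twisted (F : DGFunctor k C D) :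
    DGFunctor k (TwistedComplex k C) (TwistedComplex k D) where
  obj := F.twistedObj
  map {X Y _} := F.formalSum.map (x := X.sum) (y := Y.sum)
  map_one X := F.formalSum.map_one X.sum
  map_comp {X Y Z _ _ _} h f g :=
    F.formalSum.map_comp (x := X.sum) (y := Y.sum) (z := Z.sum) h f g
  map_d {X Y n m} h f := by
    have h0 := congrArg (F.formalSum.map (x := X.sum) (y := Y.sum))
      (TwistedComplex.twistedD_apply (X := X) (Y := Y) h f)
    rw [map_sub, map_add, map_smul_unit, F.formalSum.map_comp, F.formalSum.map_comp,
      F.formalSum.map_d] at h0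
    exact h0.trans (TwistedComplex.twistedD_apply (X := F.twistedObj X) (Y := F.twistedObj Y) h
      (F.formalSum.map (x := X.sum) (y := Y.sum) f)).symm

end DGFunctor

namespace DGNatTrans

variable {k : Type w} [CommRing k] {C : Type u} [DGCategory.{w, v, u} k C]
  {D : Type u'} [DGCategory.{w, v', u'} k D] {F G : DGFunctor k C D}

/-- The extension of a DG natural transformation to formal sums, by diagonal matrices. -/
noncomputable def formalSum (ν : DGNatTrans F G) : DGNatTrans F.formalSum G.formalSum where
  app X := FormalSum.diag (F.formalSum.obj X) (fun i => G.obj (X.obj i))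
    (fun i => ν.app (X.obj i))
  d_app X := FormalSum.matD_diag (F.formalSum.obj X) (fun i => G.obj (X.obj i))
    (fun i => ν.app (X.obj i)) (fun i => ν.d_app (X.obj i))
  naturality {X Y n} f := by
    funext i j
    exact (FormalSum.matComp_diag (F.formalSum.obj Y) (fun i => G.obj (Y.obj i))
      (fun i => ν.app (Y.obj i)) (F.formalSum.map f) i j).trans
      ((ν.naturality _).trans (FormalSum.diag_matComp (F.formalSum.obj X)
        (fun i => G.obj (X.obj i)) (fun i => ν.app (X.obj i)) (G.formalSum.map f) i j).symm)

/-- The extension of a DG natural transformation to twisted complexes. -/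
noncomputable def twisted (ν : DGNatTrans F G) : DGNatTrans F.twisted G.twisted where
  app X := ν.formalSum.app X.sum
  d_app X := by
    refine (TwistedComplex.twistedD_apply (X := F.twistedObj X) (Y := G.twistedObj X) _
      (ν.formalSum.app X.sum)).trans ?_
    rw [Int.negOnePow_zero, one_smul]
    have h := ν.formalSum.d_app X.sum
    have h' := ν.formalSum.naturality X.q
    have key : ∀ a b c : Hom k (F.formalSum.obj X.sum) (G.formalSum.obj X.sum) 1,
        a = 0 → b = c → a + b - c = 0 := by
      rintro a b _ rfl rfl
      rw [zero_add, sub_self]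
    exact key _ _ _ h h'.symm
  naturality {X Y n} f := ν.formalSum.naturality (x := X.sum) (y := Y.sum) f

end DGNatTrans

namespace DGMonad

variable {k : Type w} [CommRing k] {C : Type u} [DGCategory.{w, v, u} k C]

/-- The DG monad induced on formal sums. -/
noncomputable def formalSum (N : DGMonad k C) : DGMonad k (FormalSum C) where
  functor := N.functor.formalSum
  μ := N.μ.formalSum
  η := N.η.formalSum
  assoc X := by
    funext i j
    have h1 := FormalSum.matComp_diag (n := 0)
      (Y := N.functor.formalSum.obj (N.functor.formalSum.obj (N.functor.formalSum.obj X)))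
      (N.functor.formalSum.obj (N.functor.formalSum.obj X))
      (fun i => N.functor.obj (X.obj i)) (fun i => N.μ.app (X.obj i))
    have h2 := N.functor.formalSum.map_one (N.functor.formalSum.obj (N.functor.formalSum.obj X))
    refine (h1 (N.functor.formalSum.map (N.μ.formalSum.app X)) i j).trans ?_
    refine Eq.trans ?_ (h1 (N.μ.formalSum.app (N.functor.formalSum.obj X)) i j).symm
    refine (congrArg (fun z => comp (add_zero _) z (N.μ.app (X.obj i)))
      (N.functor.map_comp (add_zero _) _ _)).trans ?_
    refine (DGCategory.assoc _ (zero_add 0) _ (add_zero _) _ _ _).trans ?_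
    refine (congrArg₂ (fun z z' => comp (add_zero _) z z')
      (congrFun (congrFun h2 i) j) (N.assoc (X.obj i))).trans ?_
    exact (DGCategory.assoc _ _ _ _ _ _ _).symm
  left_unit X := by
    funext i j
    refine (FormalSum.matComp_diag (N.functor.formalSum.obj (N.functor.formalSum.obj X))
      (fun i => N.functor.obj (X.obj i)) (fun i => N.μ.app (X.obj i))
      (N.η.formalSum.app (N.functor.formalSum.obj X)) i j).trans ?_
    refine (DGCategory.assoc _ (zero_add 0) _ (add_zero _) _ _ _).trans ?_
    refine (congrArg (fun z => comp (add_zero _) _ z) (N.left_unit (X.obj i))).trans ?_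
    exact DGCategory.comp_one _ _
  right_unit X := by
    funext i j
    refine (FormalSum.matComp_diag (N.functor.formalSum.obj (N.functor.formalSum.obj X))
      (fun i => N.functor.obj (X.obj i)) (fun i => N.μ.app (X.obj i))
      (N.functor.formalSum.map (N.η.formalSum.app X)) i j).trans ?_
    refine (congrArg (fun z => comp (add_zero _) z (N.μ.app (X.obj i)))
      (N.functor.map_comp (add_zero _) _ _)).trans ?_
    refine (DGCategory.assoc _ (zero_add 0) _ (add_zero _) _ _ _).trans ?_
    refine (congrArg₂ (fun z z' => comp (add_zero _) z z')
      (congrFun (congrFun (N.functor.formalSum.map_one X) i) j) (N.right_unit (X.obj i))).trans ?_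
    exact DGCategory.comp_one _ _

/-- The DG monad induced on twisted complexes. -/
noncomputable def twisted (N : DGMonad k C) : DGMonad k (TwistedComplex k C) where
  functor := N.functor.twisted
  μ := N.μ.twisted
  η := N.η.twisted
  assoc X := N.formalSum.assoc X.sum
  left_unit X := N.formalSum.left_unit X.sum
  right_unit X := N.formalSum.right_unit X.sum

end DGMonad

/-! ### Pretriangulated DG categories and enhancements -/

/-- `C` is pretriangulated: `H⁰(C) ⥤ H⁰(Tw C)` is an equivalence, where `Tw C` is the DG category
of twisted complexes. -/
def IsPretriangulatedDG (k : Type w) [CommRing k] (C : Type u) [DGCategory.{w, v, u} k C] : Prop :=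
  (TwistedComplex.embedding k C).hZero.IsEquivalence

/-- `C` is strongly pretriangulated: every twisted complex over `C` (in particular every shift of
an object and every cone of a closed morphism of degree `0`) is DG isomorphic to an object
of `C`. -/
def IsStronglyPretriangulatedDG (k : Type w) [CommRing k] (C : Type u)
    [DGCategory.{w, v, u} k C] : Prop :=
  ∀ X : TwistedComplex k C, ∃ x : C,
    DGCategory.Isomorphic k ((TwistedComplex.embedding k C).obj x) X

/-- For `C` pretriangulated, the extension of a functor on `H⁰(C)` along the equivalence
`H⁰(C) ⥤ H⁰(Tw C)`. -/
noncomputable def IsPretriangulatedDG.extend {k : Type w} [CommRing k] {C : Type u}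
    [DGCategory.{w, v, u} k C] (hC : IsPretriangulatedDG k C) {T : Type u'} [Category.{v'} T]
    (F : HZero k C ⥤ T) : HZero k (TwistedComplex k C) ⥤ T :=
  haveI : (TwistedComplex.embedding k C).hZero.IsEquivalence := hC
  (TwistedComplex.embedding k C).hZero.inv ⋙ F

/-- The DG category `C` together with an equivalence of triangulated categories
`ε : H⁰(C) ⥤ T` is an enhancement of the triangulated category `T`.

The triangulated structure of `H⁰(C)` is that of `H⁰(Tw C)`, whose shift is the shift of twisted
complexes and whose distinguished triangles are those isomorphic to `X ⟶ Y ⟶ cone f ⟶ X[1]`. -/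
structure Enhancement (k : Type w) [CommRing k] (C : Type u) [DGCategory.{w, v, u} k C]
    (T : Type u') [Category.{v'} T] [Preadditive T] [HasZeroObject T] [HasShift T ℤ]
    [∀ n : ℤ, (CategoryTheory.shiftFunctor T n).Additive] [Pretriangulated T] where
  pretriangulated : IsPretriangulatedDG k C
  ε : HZero k C ⥤ T
  isEquivalence : ε.IsEquivalence
  /-- compatibility of `ε` with the shifts -/
  shiftIso : TwistedComplex.shiftFunctor k C ⋙ pretriangulated.extend ε ≅
    pretriangulated.extend ε ⋙ CategoryTheory.shiftFunctor T (1 : ℤ)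
  /-- `ε` sends distinguished triangles to distinguished triangles -/
  distinguished {X Y : TwistedComplex k C} (f : Hom k X Y 0) (hf : d (zero_add 1) f = 0) :
    Triangle.mk ((pretriangulated.extend ε).map (HZero.homMk k f hf))
      ((pretriangulated.extend ε).map (HZero.homMk k (TwistedComplex.coneInclusion f hf)
        (TwistedComplex.d_coneInclusion f hf)))
      ((pretriangulated.extend ε).map (HZero.homMk k (TwistedComplex.coneProjection f hf)
        (TwistedComplex.d_coneProjection f hf)) ≫ shiftIso.hom.app ⟨X⟩) ∈ distTriang T

/-- A lift to an enhancement `(C, ε)` of an endofunctor `M` of `T`: a DG monad `N` on `C` with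
`H⁰(N) ⋙ ε ≅ ε ⋙ M`. -/
structure DGLift {k : Type w} [CommRing k] {C : Type u} [DGCategory.{w, v, u} k C]
    {T : Type u'} [Category.{v'} T] (ε : HZero k C ⥤ T) (M : CategoryTheory.Monad T) where
  monad : DGMonad k C
  iso : monad.functor.hZero ⋙ ε ≅ ε ⋙ M.toFunctor

/-- The lift respects the multiplications and units of the two monads. -/
structure DGLift.IsMonadLift {k : Type w} [CommRing k] {C : Type u} [DGCategory.{w, v, u} k C]
    {T : Type u'} [Category.{v'} T] {ε : HZero k C ⥤ T} {M : CategoryTheory.Monad T}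
    (L : DGLift ε M) : Prop where
  unit (x : C) : ε.map (HZero.homMk k (L.monad.η.app x) (L.monad.η.d_app x)) ≫ L.iso.hom.app ⟨x⟩ =
    M.η.app (ε.obj ⟨x⟩)
  mul (x : C) : ε.map (HZero.homMk k (L.monad.μ.app x) (L.monad.μ.d_app x)) ≫ L.iso.hom.app ⟨x⟩ =
    L.iso.hom.app ⟨L.monad.functor.obj x⟩ ≫ M.map (L.iso.hom.app ⟨x⟩) ≫ M.μ.app (ε.obj ⟨x⟩)

/-!
The DG Eilenberg–Moore category of a DG monad inherits shifts and cones from the DG category on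
which the monad acts, and a DG category with shifts and cones of its own has a triangulated homotopy
category. This avoids computing twisted complexes of modules.

A shift `x[n]` and a cone of a closed morphism `f` of degree `0` are characterized by equations:
`DGShift` is a closed isomorphism of degree `-n`, and `DGCone` is a graded direct sum decomposition
in which the differential of the inclusion of `x[1]` is `f`. Equations are preserved by every DG
functor (`DGFunctor.mapShift`, `DGFunctor.mapCone`). If `C` has a zero object, shifts and cones
(`HasDGCones`), then

* `H⁰(C)` is triangulated, with the triangles isomorphic to `x ⟶ y ⟶ cone f ⟶ x[1]` as
  distinguished ones, and DG functors induce triangulated functors;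
* `C` is strongly pretriangulated (`HasDGCones.isStronglyPretriangulatedDG`): by induction on the
  number of summands, a twisted complex is the cone of a morphism from a shift of the summand of
  maximal rank to the twisted complex of the other summands. Hence `C` enhances `H⁰(C)`
  (`HZero.exists_enhancement`).

The category `Tw C` always has shifts and cones, and so does `C` itself if it is strongly
pretriangulated. For a module `(x, λ)` over a DG monad, the conjugate of `λ` is an action on `x[n]`,
and for a morphism of modules, the diagonal matrix of the two actions is an action on the cone. This
is where strictness matters: the cone of `f` has to be an object of `C` up to DG isomorphism, not
only up to homotopy. So the modules over a DG monad on `C`, or over its extension to `Tw C`, have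
shifts and cones, and the forgetful DG functor induces a triangulated functor on `H⁰`.

The free modules give a left adjoint of the forgetful functor on `H⁰`, with monad `H⁰` of the DG
monad (`EilenbergMoore.adjunction`, `EilenbergMoore.toMonadIso`). It remains to transport this
adjunction along the equivalence `ε`, and for `Tw C` also along `H⁰(C) ⥤ H⁰(Tw C)`. The right
adjoint stays triangulated because the extension of `ε` to `H⁰(Tw C)` is triangulated by the
definition of an enhancement, and a left adjoint of a triangulated functor is triangulated. That the
monads correspond to each other is `CategoryTheory.Monad.IsLift`.
-/

/-! ### Calculus with morphisms of several degrees -/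

namespace DGCategory

variable {k : Type w} [CommRing k] {C : Type u} [DGCategory.{w, v, u} k C]

variable (k) in
/-- The generalized elements of `x`: a morphism `t ⟶ x` of degree `m` for all `t` and `m`.
Morphisms of any degree act on them, so that identities between composites of morphisms of several
degrees become identities between composites of additive maps, where degrees are not visible. -/
abbrev Elements (x : C) : Type max u v := ∀ (t : C) (m : ℤ), Hom k t x m

/-- The action of a morphism on generalized elements. -/
def opr {x y : C} {n : ℤ} (f : Hom k x y n) : Elements k x →+ Elements k y where
  toFun φ t m := comp (sub_add_cancel m n) (φ t (m - n)) f
  map_zero' := by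
    funext t m
    exact zero_comp _ _
  map_add' φ ψ := by
    funext t m
    simp

/-- The action of the differential on generalized elements. -/
def dOp {x : C} : Elements k x →+ Elements k x where
  toFun φ t m := d (sub_add_cancel m 1) (φ t (m - 1))
  map_zero' := by
    funext t m
    simp
  map_add' φ ψ := by
    funext t m
    simp

lemma castDeg_elements {x : C} (φ : Elements k x) (t : C) {a b : ℤ} (h : a = b) :
    castDeg h (φ t a) = φ t b := by subst h; rfl

@[simp] lemma opr_comp {x y z : C} {a b c : ℤ} (h : a + b = c) (f : Hom k x y a) (g : Hom k y z b)
    (φ : Elements k x) : opr (comp h f g) φ = opr g (opr f φ) := by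
  subst h
  funext t m
  change comp _ (φ t (m - (a + b))) (comp rfl f g) = comp _ (comp _ (φ t (m - b - a)) f) g
  rw [← castDeg_elements φ t (show m - (a + b) = m - b - a by omega), castDeg_comp,
    DGCategory.assoc _ rfl _ (by omega)]

@[simp] lemma opr_one {x : C} (φ : Elements k x) : opr (one (k := k) x) φ = φ := by
  funext t m
  change comp _ (φ t (m - 0)) (one x) = _
  rw [comp_one', castDeg_elements]

@[simp] lemma opr_zero {x y : C} {n : ℤ} (φ : Elements k x) : opr (0 : Hom k x y n) φ = 0 := by
  funext t m
  exact comp_zero _ _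

@[simp] lemma opr_add {x y : C} {n : ℤ} (f g : Hom k x y n) (φ : Elements k x) :
    opr (f + g) φ = opr f φ + opr g φ := by
  funext t m
  exact map_add (comp (sub_add_cancel m n) (φ t (m - n))) f g

@[simp] lemma opr_neg {x y : C} {n : ℤ} (f : Hom k x y n) (φ : Elements k x) :
    opr (-f) φ = - opr f φ := by
  funext t m
  exact map_neg (comp (sub_add_cancel m n) (φ t (m - n))) f

@[simp] lemma opr_sub {x y : C} {n : ℤ} (f g : Hom k x y n) (φ : Elements k x) :
    opr (f - g) φ = opr f φ - opr g φ := by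
  funext t m
  exact map_sub (comp (sub_add_cancel m n) (φ t (m - n))) f g

@[simp] lemma opr_unit_smul {x y : C} {n : ℤ} (s : ℤˣ) (f : Hom k x y n) (φ : Elements k x) :
    opr (s • f) φ = s • opr f φ := by
  funext t m
  exact comp_smul_unit (sub_add_cancel m n) s (φ t (m - n)) f

@[simp] lemma opr_d {x y : C} {n m : ℤ} (h : n + 1 = m) (f : Hom k x y n) (φ : Elements k x) :
    opr (d h f) φ = dOp (opr f φ) - n.negOnePow • opr f (dOp φ) := by
  subst h
  funext t m
  change comp _ (φ t (m - (n + 1))) (d rfl f) =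
    d (sub_add_cancel m 1) (comp (sub_add_cancel (m - 1) n) (φ t (m - 1 - n)) f) -
      n.negOnePow • comp (sub_add_cancel m n) (d (sub_add_cancel (m - n) 1) (φ t (m - n - 1))) f
  rw [leibniz _ (sub_add_cancel m 1) (a' := m - n) (by omega) rfl (by omega) (by omega),
    add_sub_assoc, ← castDeg_elements φ t (show m - (n + 1) = m - 1 - n by omega),
    ← castDeg_elements φ t (show m - (n + 1) = m - n - 1 by omega)]
  simp

/-- A morphism is determined by its action on the generalized element given by the identity. -/
lemma opr_injective {x y : C} {n : ℤ} {f g : Hom k x y n} (h : ∀ φ, opr f φ = opr g φ) : f = g := by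
  classical
  let φ : Elements k x := fun t m =>
    if e : x = t ∧ 0 = m then e.1 ▸ castDeg e.2 (one (k := k) x) else 0
  have hφ : φ x 0 = one x := by simp [φ]
  have key : ∀ f : Hom k x y n, castDeg (by omega) (opr f φ x (0 + n)) = f := by
    intro f
    change castDeg _ (comp _ (φ x (0 + n - n)) f) = f
    rw [← castDeg_elements φ x (show 0 = 0 + n - n by omega), hφ, castDeg_comp, one_comp']
    simp
  rw [← key f, h, key g]

/-- The Leibniz rule for the action of a morphism. -/
lemma dOp_opr {x y : C} {n m : ℤ} (h : n + 1 = m) (f : Hom k x y n) (φ : Elements k x) :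
    dOp (opr f φ) = opr (d h f) φ + n.negOnePow • opr f (dOp φ) := by
  rw [opr_d, sub_add_cancel]

lemma dOp_opr_closed {x y : C} {n m : ℤ} {h : n + 1 = m} {f : Hom k x y n} (hf : d h f = 0)
    (φ : Elements k x) : dOp (opr f φ) = n.negOnePow • opr f (dOp φ) := by
  rw [dOp_opr h, hf, opr_zero, zero_add]

lemma dOp_opr_closed₀ {x y : C} {m : ℤ} {h : 0 + 1 = m} {f : Hom k x y 0} (hf : d h f = 0)
    (φ : Elements k x) : dOp (opr f φ) = opr f (dOp φ) := by
  rw [dOp_opr_closed hf, Int.negOnePow_zero, one_smul]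

lemma opr_opr_of_comp_eq {x y z : C} {a b c : ℤ} {h : a + b = c} {f : Hom k x y a} {g : Hom k y z b}
    {l : Hom k x z c} (e : comp h f g = l) (φ : Elements k x) : opr g (opr f φ) = opr l φ := by
  rw [← e, opr_comp]

end DGCategory

namespace HZero

variable {k : Type w} [CommRing k] {C : Type u} [DGCategory.{w, v, u} k C]

lemma exists_homMk {X Y : HZero k C} (f : X ⟶ Y) :
    ∃ (g : Hom k X.as Y.as 0) (hg : d (zero_add 1) g = 0), f = homMk k g hg := by
  obtain ⟨⟨g, hg⟩, rfl⟩ := Submodule.Quotient.mk_surjective _ f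
  exact ⟨g, hg, rfl⟩

lemma d_comp_closed {x y z : C} {f : Hom k x y 0} {g : Hom k y z 0} (hf : d (zero_add 1) f = 0)
    (hg : d (zero_add 1) g = 0) : d (zero_add 1) (comp (zero_add 0) f g) = 0 :=
  (cyclesComp ⟨f, hf⟩ ⟨g, hg⟩).2

lemma homMk_neg {x y : C} (f : Hom k x y 0) (hf : d (zero_add 1) f = 0) :
    - homMk k f hf = homMk k (-f) (by rw [map_neg, hf, neg_zero]) := rfl

lemma unit_smul_homMk (s : ℤˣ) {x y : C} (f : Hom k x y 0) (hf : d (zero_add 1) f = 0) :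
    s • homMk k f hf = homMk k (s • f) (by rw [map_zsmul_unit, hf, smul_zero]) := by
  rcases Int.units_eq_one_or s with rfl | rfl
  · simp
  · simp [homMk_neg]

lemma homMk_congr {x y : C} {f g : Hom k x y 0} (h : f = g) (hf : d (zero_add 1) f = 0)
    (hg : d (zero_add 1) g = 0) : homMk k f hf = homMk k g hg := by
  subst h
  rfl

lemma homMk_eq_iff {x y : C} {f g : Hom k x y 0} (hf : d (zero_add 1) f = 0)
    (hg : d (zero_add 1) g = 0) :
    homMk k f hf = homMk k g hg ↔ ∃ s : Hom k x y (-1), d (neg_add_cancel 1) s = f - g :=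
  (Submodule.Quotient.eq (boundaries k x y)).trans Iff.rfl

/-- Homotopic closed morphisms are equal in `H⁰`. -/
lemma homMk_eq {x y : C} {f g : Hom k x y 0} (hf : d (zero_add 1) f = 0)
    (hg : d (zero_add 1) g = 0) (s : Hom k x y (-1)) (hs : d (neg_add_cancel 1) s = f - g) :
    homMk k f hf = homMk k g hg :=
  (homMk_eq_iff hf hg).2 ⟨s, hs⟩

/-- A closed isomorphism of degree `0` gives an isomorphism of `H⁰`. -/
def isoMk {x y : C} (f : Hom k x y 0) (g : Hom k y x 0) (hf : d (zero_add 1) f = 0)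
    (hg : d (zero_add 1) g = 0) (hfg : comp (zero_add 0) f g = one x)
    (hgf : comp (zero_add 0) g f = one y) : HZero.mk (k := k) x ≅ HZero.mk y where
  hom := homMk k f hf
  inv := homMk k g hg
  hom_inv_id := homMk_congr hfg _ (d_one _ _)
  inv_hom_id := homMk_congr hgf _ (d_one _ _)

end HZero

/-! ### Shifts and cones in a DG category -/

/-- A shift `x[n]` in a DG category: a closed isomorphism of degree `-n` from `x`. -/
structure DGShift (k : Type w) [CommRing k] {C : Type u} [DGCategory.{w, v, u} k C] (x : C)
    (n : ℤ) where
  obj : C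
  hom : Hom k x obj (-n)
  inv : Hom k obj x n
  d_hom : d rfl hom = 0
  hom_inv : comp (neg_add_cancel n) hom inv = one x
  inv_hom : comp (add_neg_cancel n) inv hom = one obj

namespace DGShift

variable {k : Type w} [CommRing k] {C : Type u} [DGCategory.{w, v, u} k C] {x : C} {n : ℤ}
  (s : DGShift k x n)

@[simp] lemma opr_hom_inv (φ : Elements k x) : opr s.inv (opr s.hom φ) = φ := by
  rw [opr_opr_of_comp_eq s.hom_inv, opr_one]

@[simp] lemma opr_inv_hom (φ : Elements k s.obj) : opr s.hom (opr s.inv φ) = φ := by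
  rw [opr_opr_of_comp_eq s.inv_hom, opr_one]

@[simp] lemma dOp_hom (φ : Elements k x) :
    dOp (opr s.hom φ) = n.negOnePow • opr s.hom (dOp φ) := by
  rw [dOp_opr_closed s.d_hom, Int.negOnePow_neg]

@[simp] lemma dOp_inv (φ : Elements k s.obj) :
    dOp (opr s.inv φ) = n.negOnePow • opr s.inv (dOp φ) := by
  have h := congrArg (opr s.inv) (s.dOp_hom (opr s.inv φ))
  rw [opr_inv_hom, map_zsmul_unit, opr_hom_inv] at h
  rw [h, smul_smul, ← Int.negOnePow_add, Int.negOnePow_even _ ⟨n, rfl⟩, one_smul]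

end DGShift

/-- A cone of `f : x ⟶ y` in a DG category: an object `z` that is, for the graded structure, the
direct sum of `x[1]` and `y`, with `d` of the inclusion of `x[1]` given by `f`. -/
structure DGCone {k : Type w} [CommRing k] {C : Type u} [DGCategory.{w, v, u} k C] {x y : C}
    (f : Hom k x y 0) where
  obj : C
  inl : Hom k x obj (-1)
  inr : Hom k y obj 0
  fst : Hom k obj x 1
  snd : Hom k obj y 0
  inl_fst : comp (neg_add_cancel 1) inl fst = one x
  inr_snd : comp (zero_add 0) inr snd = one y
  inl_snd : comp (add_zero (-1)) inl snd = 0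
  inr_fst : comp (zero_add 1) inr fst = 0
  total : comp (add_neg_cancel 1) fst inl + comp (zero_add 0) snd inr = one obj
  d_inl : d (neg_add_cancel 1) inl = comp (zero_add 0) f inr
  d_inr : d (zero_add 1) inr = 0

namespace DGCone

variable {k : Type w} [CommRing k] {C : Type u} [DGCategory.{w, v, u} k C] {x y : C}
  {f : Hom k x y 0} (c : DGCone f)

@[simp] lemma opr_inl_fst (φ : Elements k x) : opr c.fst (opr c.inl φ) = φ := by
  rw [opr_opr_of_comp_eq c.inl_fst, opr_one]

@[simp] lemma opr_inr_snd (φ : Elements k y) : opr c.snd (opr c.inr φ) = φ := by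
  rw [opr_opr_of_comp_eq c.inr_snd, opr_one]

@[simp] lemma opr_inl_snd (φ : Elements k x) : opr c.snd (opr c.inl φ) = 0 := by
  rw [opr_opr_of_comp_eq c.inl_snd, opr_zero]

@[simp] lemma opr_inr_fst (φ : Elements k y) : opr c.fst (opr c.inr φ) = 0 := by
  rw [opr_opr_of_comp_eq c.inr_fst, opr_zero]

lemma opr_total (φ : Elements k c.obj) : opr c.inl (opr c.fst φ) + opr c.inr (opr c.snd φ) = φ := by
  have h := congrArg (fun g => opr g φ) c.total
  simpa using h

lemma elements_cases (φ : Elements k c.obj) : ∃ (α : Elements k x) (β : Elements k y),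
    φ = opr c.inl α + opr c.inr β :=
  ⟨_, _, (c.opr_total φ).symm⟩

@[simp] lemma dOp_inl (φ : Elements k x) :
    dOp (opr c.inl φ) = opr c.inr (opr f φ) - opr c.inl (dOp φ) := by
  rw [dOp_opr (neg_add_cancel 1), c.d_inl, opr_comp, Int.negOnePow_neg, Int.negOnePow_one,
    Units.neg_smul, one_smul, sub_eq_add_neg]

@[simp] lemma dOp_inr (φ : Elements k y) : dOp (opr c.inr φ) = opr c.inr (dOp φ) :=
  dOp_opr_closed₀ c.d_inr φ

@[simp] lemma dOp_fst (φ : Elements k c.obj) : dOp (opr c.fst φ) = - opr c.fst (dOp φ) := by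
  obtain ⟨α, β, rfl⟩ := c.elements_cases φ
  simp

@[simp] lemma dOp_snd (φ : Elements k c.obj) :
    dOp (opr c.snd φ) = opr c.snd (dOp φ) - opr f (opr c.fst φ) := by
  obtain ⟨α, β, rfl⟩ := c.elements_cases φ
  simp

/-- A morphism with a cone is closed: apply `d` twice to the inclusion of `x[1]`. -/
lemma closed (c : DGCone f) : d (zero_add 1) f = 0 := by
  refine opr_injective fun φ => ?_
  have h := congrArg (opr c.snd) (congrArg dOp (c.dOp_inl φ))
  have h2 : ∀ {x : C} (ψ : Elements k x), dOp (dOp ψ) = 0 := fun ψ => by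
    funext t m
    exact d_d _ _ _
  rw [h2] at h
  simp [h2] at h
  simpa [sub_eq_zero] using h.symm

end DGCone

/-- The DG category `C` has a zero object, shifts of objects, and cones of closed morphisms of
degree `0`. -/
class HasDGCones (k : Type w) [CommRing k] (C : Type u) [DGCategory.{w, v, u} k C] : Prop where
  exists_zero : ∃ z : C, one (k := k) z = 0
  shift (x : C) (n : ℤ) : Nonempty (DGShift k x n)
  cone {x y : C} (f : Hom k x y 0) (hf : d (zero_add 1) f = 0) : Nonempty (DGCone f)

namespace DGFunctor

variable {k : Type w} [CommRing k] {C : Type u} [DGCategory.{w, v, u} k C]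
  {D : Type u'} [DGCategory.{w, v', u'} k D] (F : DGFunctor k C D)

/-- DG functors preserve shifts. -/
@[reducible] def mapShift {x : C} {n : ℤ} (s : DGShift k x n) : DGShift k (F.obj x) n where
  obj := F.obj s.obj
  hom := F.map s.hom
  inv := F.map s.inv
  d_hom := by rw [← F.map_d, s.d_hom, map_zero]
  hom_inv := by rw [← F.map_comp, s.hom_inv, F.map_one]
  inv_hom := by rw [← F.map_comp, s.inv_hom, F.map_one]

/-- DG functors preserve cones. -/
@[reducible] def mapCone {x y : C} {f : Hom k x y 0} (c : DGCone f) : DGCone (F.map f) where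
  obj := F.obj c.obj
  inl := F.map c.inl
  inr := F.map c.inr
  fst := F.map c.fst
  snd := F.map c.snd
  inl_fst := by rw [← F.map_comp, c.inl_fst, F.map_one]
  inr_snd := by rw [← F.map_comp, c.inr_snd, F.map_one]
  inl_snd := by rw [← F.map_comp, c.inl_snd, map_zero]
  inr_fst := by rw [← F.map_comp, c.inr_fst, map_zero]
  total := by rw [← F.map_comp, ← F.map_comp, ← map_add, c.total, F.map_one]
  d_inl := by rw [← F.map_d, c.d_inl, F.map_comp]
  d_inr := by rw [← F.map_d, c.d_inr, map_zero]

end DGFunctor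

/-! ### The shift on the homotopy category -/

namespace DGCategory

variable {k : Type w} [CommRing k] {C : Type u} [DGCategory.{w, v, u} k C]

lemma d_eq_zero {x y : C} {n m : ℤ} {h : n + 1 = m} {f : Hom k x y n}
    (hf : ∀ φ, dOp (opr f φ) = n.negOnePow • opr f (dOp φ)) : d h f = 0 :=
  opr_injective fun φ => by rw [opr_d, hf, sub_self, opr_zero]

end DGCategory

namespace DGShift

variable {k : Type w} [CommRing k] {C : Type u} [DGCategory.{w, v, u} k C]

/-- An object is its own shift by `0`. -/
@[reducible] def refl (x : C) : DGShift k x 0 where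
  obj := x
  hom := castDeg neg_zero.symm (one x)
  inv := one x
  d_hom := by simp
  hom_inv := opr_injective fun φ => by simp
  inv_hom := opr_injective fun φ => by simp

/-- A shift of a shift. -/
@[reducible] def trans {x : C} {n m : ℤ} (s : DGShift k x n) (t : DGShift k s.obj m) :
    DGShift k x (n + m) where
  obj := t.obj
  hom := comp (neg_add n m).symm s.hom t.hom
  inv := comp (add_comm m n) t.inv s.inv
  d_hom := d_eq_zero fun φ => by
    simp [map_zsmul_unit, Int.negOnePow_neg, Int.negOnePow_add, smul_smul]
  hom_inv := opr_injective fun φ => by simp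
  inv_hom := opr_injective fun φ => by simp

/-- The morphism between shifts of `x` and `y` that corresponds to a morphism `x ⟶ y`. -/
def conj {x y : C} {n p : ℤ} (s : DGShift k x n) (t : DGShift k y n) :
    Hom k x y p →ₗ[k] Hom k s.obj t.obj p :=
  (comp (z := t.obj) (add_neg_cancel_comm n p)).flip t.hom ∘ₗ comp (z := y) rfl s.inv

@[simp] lemma opr_conj {x y : C} {n p : ℤ} (s : DGShift k x n) (t : DGShift k y n) (f : Hom k x y p)
    (φ : Elements k s.obj) : opr (s.conj t f) φ = opr t.hom (opr f (opr s.inv φ)) := by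
  change opr (comp _ (comp _ s.inv f) t.hom) φ = _
  simp

lemma d_conj {x y : C} {n p q : ℤ} (h : p + 1 = q) (s : DGShift k x n) (t : DGShift k y n)
    (f : Hom k x y p) : d h (s.conj t f) = n.negOnePow • s.conj t (d h f) :=
  opr_injective fun φ => by
    have h1 : n.negOnePow * n.negOnePow = 1 := Int.units_mul_self _
    simp [map_zsmul_unit, smul_smul, smul_sub, mul_left_comm n.negOnePow, h1]

lemma d_conj_eq_zero {x y : C} {n p q : ℤ} {h : p + 1 = q} (s : DGShift k x n) (t : DGShift k y n)
    {f : Hom k x y p} (hf : d h f = 0) : d h (s.conj t f) = 0 := by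
  rw [d_conj, hf, map_zero, smul_zero]

/-- Shifts of an object are unique up to isomorphism. -/
def uniqueIso {x : C} {n : ℤ} (s t : DGShift k x n) : HZero.mk (k := k) s.obj ≅ HZero.mk t.obj :=
  HZero.isoMk (s.conj t (one x)) (t.conj s (one x)) (s.d_conj_eq_zero t (d_one _ _))
    (t.d_conj_eq_zero s (d_one _ _)) (opr_injective fun φ => by simp)
    (opr_injective fun φ => by simp)

lemma comp_uniqueIso {x y : C} {n : ℤ} (s s' : DGShift k x n) (t t' : DGShift k y n)
    (f : Hom k x y 0) : comp (zero_add 0) (s.conj t f) (t.conj t' (one y)) =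
      comp (zero_add 0) (s.conj s' (one x)) (s'.conj t' f) :=
  opr_injective fun φ => by simp

lemma refl_conj_refl {x y : C} {p : ℤ} (f : Hom k x y p) : (refl x).conj (refl y) f = f :=
  opr_injective fun φ => by simp [opr_conj (refl x) (refl y)]

lemma trans_conj_trans {x y : C} {n m p : ℤ} (s : DGShift k x n) (s' : DGShift k s.obj m)
    (t : DGShift k y n) (t' : DGShift k t.obj m) (f : Hom k x y p) :
    (s.trans s').conj (t.trans t') f = s'.conj t' (s.conj t f) :=
  opr_injective fun φ => by simp

lemma uniqueIso_assoc {x : C} {m₁ m₂ m₃ : ℤ} (a : DGShift k x (m₁ + m₂ + m₃))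
    (s₁₂ : DGShift k x (m₁ + m₂)) (s₃ : DGShift k s₁₂.obj m₃) (s₁ : DGShift k x m₁)
    (s₂ : DGShift k s₁.obj m₂) (s₃' : DGShift k s₂.obj m₃) (b : DGShift k x (m₁ + (m₂ + m₃)))
    (s₂₃ : DGShift k s₁.obj (m₂ + m₃)) :
    comp (zero_add 0) (a.conj (s₁₂.trans s₃) (one x))
        (s₃.conj s₃' (s₁₂.conj (s₁.trans s₂) (one x))) =
      comp (zero_add 0) (comp (by omega) a.inv b.hom) (comp (zero_add 0)
        (b.conj (s₁.trans s₂₃) (one x)) (s₂₃.conj (s₂.trans s₃') (one s₁.obj))) :=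
  opr_injective fun φ => by simp

lemma uniqueIso_zero_add {x : C} {n : ℤ} (a : DGShift k x (0 + n)) (s : DGShift k x 0)
    (t : DGShift k s.obj n) (b : DGShift k x n) :
    a.conj (s.trans t) (one x) = comp (zero_add 0) (comp (by omega) a.inv b.hom)
      (b.conj t ((refl x).conj s (one x))) :=
  opr_injective fun φ => by simp [opr_conj (refl x)]

lemma uniqueIso_add_zero {x : C} {n : ℤ} (a : DGShift k x (n + 0)) (s : DGShift k x n)
    (t : DGShift k s.obj 0) :
    a.conj (s.trans t) (one x) = comp (zero_add 0) (comp (by omega) a.inv s.hom)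
      ((refl s.obj).conj t (one s.obj)) :=
  opr_injective fun φ => by simp [opr_conj (refl s.obj)]

end DGShift

namespace HZero

variable (k : Type w) [CommRing k] {C : Type u} [DGCategory.{w, v, u} k C] [HasDGCones k C]

/-- A choice of shifts. -/
noncomputable def sh (x : C) (n : ℤ) : DGShift k x n := Classical.choice (HasDGCones.shift x n)

variable (C) in
/-- The shift functors of `H⁰`. -/
noncomputable def shiftBy (n : ℤ) : HZero k C ⥤ HZero k C :=
  functorOfMap (fun x => (sh k x n).obj) (fun {x y} => (sh k x n).conj (sh k y n))
    (fun {x y} f hf => (sh k x n).d_conj_eq_zero (sh k y n) hf)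
    (fun {x y} s => ⟨n.negOnePow • (sh k x n).conj (sh k y n) s, by
      rw [map_zsmul_unit, DGShift.d_conj, smul_smul, ← Int.negOnePow_add,
        Int.negOnePow_even _ ⟨n, rfl⟩, one_smul]⟩)
    (fun x => opr_injective fun φ => by simp)
    (fun f g => opr_injective fun φ => by simp)

lemma eqToHom_shiftBy {n m : ℤ} (h : n = m) (X : HZero k C)
    (e : (shiftBy k C n).obj X = (shiftBy k C m).obj X) :
    eqToHom e = homMk k (comp (by omega) (sh k X.as n).inv (sh k X.as m).hom)
      (d_eq_zero fun φ => by
        subst h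
        simp) := by
  subst h
  exact homMk_congr (sh k X.as n).inv_hom.symm _ _

variable (C) in
/-- The coherent family of shift functors of `H⁰`. All isomorphisms are represented by composites
of the structure isomorphisms of the chosen shifts, so that the coherences hold on the nose. -/
noncomputable def shiftMkCore : ShiftMkCore (HZero k C) ℤ where
  F := shiftBy k C
  zero := NatIso.ofComponents
    (fun X => (sh k X.as 0).uniqueIso (DGShift.refl X.as)) (fun {X Y} f => by
      obtain ⟨f, hf, rfl⟩ := exists_homMk f
      exact homMk_congr ((DGShift.comp_uniqueIso _ _ _ _ _).trans
        (congrArg _ (DGShift.refl_conj_refl f))) _ _)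
  add n m := NatIso.ofComponents
    (fun X => (sh k X.as (n + m)).uniqueIso ((sh k X.as n).trans (sh k _ m))) (fun {X Y} f => by
      obtain ⟨f, hf, rfl⟩ := exists_homMk f
      exact homMk_congr ((DGShift.comp_uniqueIso _ _ _ _ _).trans
        (congrArg _ (DGShift.trans_conj_trans _ _ _ _ f))) _ _)
  assoc_hom_app m₁ m₂ m₃ X := by
    rw [eqToHom_shiftBy k (add_assoc m₁ m₂ m₃)]
    exact homMk_congr (DGShift.uniqueIso_assoc _ _ _ _ _ _ _ _) _ _
  zero_add_hom_app n X := by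
    rw [eqToHom_shiftBy k (zero_add n)]
    exact homMk_congr (DGShift.uniqueIso_zero_add _ _ _ _) _ _
  add_zero_hom_app n X := by
    rw [eqToHom_shiftBy k (add_zero n)]
    exact homMk_congr (DGShift.uniqueIso_add_zero _ _ _) _ _

noncomputable instance : HasShift (HZero k C) ℤ := hasShiftMk _ _ (shiftMkCore k C)

instance (n : ℤ) : (CategoryTheory.shiftFunctor (HZero k C) n).Additive where
  map_add {X Y f g} := by
    obtain ⟨f, hf, rfl⟩ := exists_homMk f
    obtain ⟨g, hg, rfl⟩ := exists_homMk g
    exact homMk_congr (map_add ((sh k X.as n).conj (sh k Y.as n)) f g) _ _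

instance : HasZeroObject (HZero k C) := by
  obtain ⟨z, hz⟩ := HasDGCones.exists_zero (k := k) (C := C)
  exact ⟨⟨z⟩, (IsZero.iff_id_eq_zero _).2 (homMk_congr hz _ _)⟩

lemma shiftFunctorZero_hom_app (X : HZero k C) :
    (CategoryTheory.shiftFunctorZero (HZero k C) ℤ).hom.app X =
      ((sh k X.as 0).uniqueIso (DGShift.refl X.as)).hom := by
  rw [ShiftMkCore.shiftFunctorZero_eq (shiftMkCore k C)]
  rfl

lemma shiftFunctorZero_inv_app (X : HZero k C) :
    (CategoryTheory.shiftFunctorZero (HZero k C) ℤ).inv.app X =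
      ((sh k X.as 0).uniqueIso (DGShift.refl X.as)).inv := by
  rw [ShiftMkCore.shiftFunctorZero_eq (shiftMkCore k C)]
  rfl

lemma shiftFunctorAdd_hom_app (n m : ℤ) (X : HZero k C) :
    (CategoryTheory.shiftFunctorAdd (HZero k C) n m).hom.app X =
      ((sh k X.as (n + m)).uniqueIso ((sh k X.as n).trans (sh k _ m))).hom := by
  rw [ShiftMkCore.shiftFunctorAdd_eq (shiftMkCore k C)]
  rfl

lemma shiftFunctorAdd_inv_app (n m : ℤ) (X : HZero k C) :
    (CategoryTheory.shiftFunctorAdd (HZero k C) n m).inv.app X =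
      ((sh k X.as (n + m)).uniqueIso ((sh k X.as n).trans (sh k _ m))).inv := by
  rw [ShiftMkCore.shiftFunctorAdd_eq (shiftMkCore k C)]
  rfl

end HZero

namespace DGFunctor

variable {k : Type w} [CommRing k] {C : Type u} [DGCategory.{w, v, u} k C]
  {D : Type u'} [DGCategory.{w, v', u'} k D] (F : DGFunctor k C D)

@[simp] lemma opr_map_hom_inv {x : C} {n : ℤ} (s : DGShift k x n) (φ : Elements k (F.obj x)) :
    opr (F.map s.inv) (opr (F.map s.hom) φ) = φ :=
  (F.mapShift s).opr_hom_inv φ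

@[simp] lemma opr_map_conj {x y : C} {n p : ℤ} (s : DGShift k x n) (t : DGShift k y n)
    (f : Hom k x y p) (φ : Elements k (F.obj s.obj)) :
    opr (F.map (s.conj t f)) φ = opr (F.map t.hom) (opr (F.map f) (opr (F.map s.inv) φ)) := by
  change opr (F.map (comp _ (comp _ s.inv f) t.hom)) φ = _
  simp [F.map_comp]

lemma comp_map_uniqueIso {x y : C} {n : ℤ} (s : DGShift k x n) (s' : DGShift k (F.obj x) n)
    (t : DGShift k y n) (t' : DGShift k (F.obj y) n) (f : Hom k x y 0) :
    comp (zero_add 0) (F.map (s.conj t f)) ((F.mapShift t).conj t' (one (F.obj y))) =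
      comp (zero_add 0) ((F.mapShift s).conj s' (one (F.obj x))) (s'.conj t' (F.map f)) :=
  opr_injective fun φ => by
    simp [DGShift.opr_conj (F.mapShift s), DGShift.opr_conj (F.mapShift t)]

lemma map_uniqueIso_zero {x : C} (s : DGShift k x 0) (t : DGShift k (F.obj x) 0) :
    (F.mapShift s).conj t (one (F.obj x)) =
      comp (zero_add 0) (F.map (s.conj (DGShift.refl x) (one x)))
        ((DGShift.refl (F.obj x)).conj t (one (F.obj x))) :=
  opr_injective fun φ => by
    simp [F.map_one, DGShift.opr_conj (F.mapShift s), DGShift.opr_conj (DGShift.refl (F.obj x)),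
      opr_map_conj F s (DGShift.refl x)]

lemma map_uniqueIso_add {x : C} {n m : ℤ} (s : DGShift k x n) (t : DGShift k s.obj m)
    (a : DGShift k x (n + m)) (s' : DGShift k (F.obj x) n) (t' : DGShift k s'.obj m)
    (a' : DGShift k (F.obj x) (n + m)) (r : DGShift k (F.obj s.obj) m) :
    (F.mapShift a).conj a' (one (F.obj x)) =
      comp (zero_add 0) (F.map (a.conj (s.trans t) (one x))) (comp (zero_add 0)
        ((F.mapShift t).conj r (one (F.obj s.obj))) (comp (zero_add 0)
          (r.conj t' ((F.mapShift s).conj s' (one (F.obj x))))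
          ((s'.trans t').conj a' (one (F.obj x))))) :=
  opr_injective fun φ => by
    simp [F.map_one, F.map_comp, DGShift.opr_conj (F.mapShift a), DGShift.opr_conj (F.mapShift s),
      DGShift.opr_conj (F.mapShift t), opr_map_conj F a (s.trans t)]

variable [HasDGCones k C] [HasDGCones k D]

/-- The functor induced on `H⁰` by a DG functor commutes with the shift. -/
noncomputable instance : F.hZero.CommShift ℤ where
  commShiftIso n := NatIso.ofComponents
    (fun X => (F.mapShift (HZero.sh k X.as n)).uniqueIso (HZero.sh k (F.obj X.as) n))
    (fun {X Y} f => by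
      obtain ⟨f, hf, rfl⟩ := HZero.exists_homMk f
      exact HZero.homMk_congr (F.comp_map_uniqueIso _ _ _ _ f) _ _)
  commShiftIso_zero := by
    ext X
    rw [Functor.CommShift.isoZero_hom_app, HZero.shiftFunctorZero_hom_app,
      HZero.shiftFunctorZero_inv_app]
    exact HZero.homMk_congr (F.map_uniqueIso_zero _ _) _ _
  commShiftIso_add n m := by
    ext X
    rw [Functor.CommShift.isoAdd_hom_app, HZero.shiftFunctorAdd_hom_app,
      HZero.shiftFunctorAdd_inv_app]
    exact HZero.homMk_congr (F.map_uniqueIso_add _ _ _ _ _ _ _) _ _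

end DGFunctor

/-! ### The triangulated structure of the homotopy category -/

namespace DGCone

variable {k : Type w} [CommRing k] {C : Type u} [DGCategory.{w, v, u} k C]

section Map

variable {x y x' y' : C} {f : Hom k x y 0} {f' : Hom k x' y' 0}

/-- The morphism of cones induced by a square that commutes up to the homotopy `h`. -/
def map (c : DGCone f) (c' : DGCone f') (a : Hom k x x' 0) (b : Hom k y y' 0)
    (h : Hom k x y' (-1)) : Hom k c.obj c'.obj 0 :=
  comp (by omega) (comp (add_zero 1) c.fst a) c'.inl +
    comp (add_zero 0) (comp (zero_add 0) c.snd b) c'.inr +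
    comp (add_zero 0) (comp (add_neg_cancel 1) c.fst h) c'.inr

@[simp] lemma opr_map (c : DGCone f) (c' : DGCone f') (a : Hom k x x' 0) (b : Hom k y y' 0)
    (h : Hom k x y' (-1)) (φ : Elements k c.obj) :
    opr (c.map c' a b h) φ = opr c'.inl (opr a (opr c.fst φ)) +
      opr c'.inr (opr b (opr c.snd φ)) + opr c'.inr (opr h (opr c.fst φ)) := by
  simp [map]

lemma d_map (c : DGCone f) (c' : DGCone f') {a : Hom k x x' 0} {b : Hom k y y' 0}
    {h : Hom k x y' (-1)} (ha : d (zero_add 1) a = 0) (hb : d (zero_add 1) b = 0)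
    (hh : d (neg_add_cancel 1) h = comp (zero_add 0) f b - comp (zero_add 0) a f') :
    d (zero_add 1) (c.map c' a b h) = 0 :=
  d_eq_zero fun φ => by
    have h1 : dOp (opr h (opr c.fst φ)) = _ := dOp_opr (neg_add_cancel 1) h _
    simp [dOp_opr_closed₀ ha, dOp_opr_closed₀ hb, h1, hh]
    abel

end Map

/-- The cone of an identity is contractible. -/
lemma isZero_of_one {x : C} (c : DGCone (one (k := k) x)) : IsZero (HZero.mk (k := k) c.obj) := by
  refine (IsZero.iff_id_eq_zero _).2 ?_
  refine HZero.homMk_eq (f := one c.obj) (g := 0) (d_one _ _) (map_zero _)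
    (comp (zero_add (-1)) c.snd c.inl) (opr_injective fun φ => ?_)
  obtain ⟨α, β, rfl⟩ := c.elements_cases φ
  simp
  abel

section Rotate

variable {x y : C} {f : Hom k x y 0} (c : DGCone f) (r : DGCone c.inr) (s : DGShift k x 1)

/-- The homotopy equivalence between `x[1]` and the cone of the inclusion `y ⟶ cone f`. -/
def rotateHom : Hom k s.obj r.obj 0 :=
  comp (add_neg_cancel 1) s.inv (comp (add_zero (-1)) c.inl r.inr - comp (zero_add (-1)) f r.inl)

/-- The homotopy inverse of `rotateHom`. -/
def rotateInv : Hom k r.obj s.obj 0 :=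
  comp (zero_add 0) r.snd (comp (add_neg_cancel 1) c.fst s.hom)

lemma d_rotateHom : d (zero_add 1) (c.rotateHom r s) = 0 :=
  d_eq_zero fun φ => by
    simp [rotateHom, dOp_opr_closed₀ c.closed]

lemma d_rotateInv : d (zero_add 1) (c.rotateInv r s) = 0 :=
  d_eq_zero fun φ => by
    simp [rotateInv]

/-- `x[1]` is homotopy equivalent to the cone of the inclusion `y ⟶ cone f`. -/
def rotateIso : HZero.mk (k := k) r.obj ≅ HZero.mk s.obj where
  hom := HZero.homMk k (c.rotateInv r s) (c.d_rotateInv r s)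
  inv := HZero.homMk k (c.rotateHom r s) (c.d_rotateHom r s)
  hom_inv_id := by
    refine HZero.homMk_eq (f := comp (zero_add 0) (c.rotateInv r s) (c.rotateHom r s))
      (g := one r.obj) _ (d_one _ _)
      (- comp (zero_add (-1)) r.snd (comp (zero_add (-1)) c.snd r.inl))
      (opr_injective fun φ => ?_)
    obtain ⟨α, β, rfl⟩ := r.elements_cases φ
    obtain ⟨γ, δ, rfl⟩ := c.elements_cases β
    simp [rotateHom, rotateInv]
    abel
  inv_hom_id := HZero.homMk_congr (opr_injective fun φ => by simp [rotateHom, rotateInv]) _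
    (d_one _ _)

end Rotate

section Shift

variable {x y : C} {f : Hom k x y 0}

/-- A shift of a cone is a cone of the shifted morphism. The inclusion and the projection of
nonzero degree change by the sign `(-1) ^ n`. -/
@[reducible] def shift (c : DGCone f) {n : ℤ} (s : DGShift k x n) (t : DGShift k y n)
    (r : DGShift k c.obj n) : DGCone (s.conj t f) where
  obj := r.obj
  inl := n.negOnePow • s.conj r c.inl
  inr := t.conj r c.inr
  fst := n.negOnePow • r.conj s c.fst
  snd := r.conj t c.snd
  inl_fst := opr_injective fun φ => by simp [map_zsmul_unit, smul_smul]
  inr_snd := opr_injective fun φ => by simp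
  inl_snd := opr_injective fun φ => by simp [map_zsmul_unit]
  inr_fst := opr_injective fun φ => by simp
  total := opr_injective fun φ => by
    simp [map_zsmul_unit, smul_smul, ← map_add, c.opr_total]
  d_inl := opr_injective fun φ => by
    simp [map_zsmul_unit, smul_smul, smul_sub]
  d_inr := opr_injective fun φ => by
    simp [map_zsmul_unit, smul_smul]

end Shift

section Octahedron

variable {x y z : C} {f : Hom k x y 0} {g : Hom k y z 0} (c₁₂ : DGCone f) (c₂₃ : DGCone g)
  (c₁₃ : DGCone (comp (zero_add 0) f g)) (r : DGCone (c₁₂.map c₁₃ (one x) g 0))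

/-- The homotopy equivalence from the cone of `g` to the cone of `cone f ⟶ cone (g ∘ f)`. -/
def octahedronHom : Hom k c₂₃.obj r.obj 0 :=
  comp (add_neg_cancel 1) (comp (add_zero 1) c₂₃.fst c₁₂.inr) r.inl +
    comp (add_zero 0) (comp (zero_add 0) c₂₃.snd c₁₃.inr) r.inr

/-- The homotopy inverse of `octahedronHom`. -/
def octahedronInv : Hom k r.obj c₂₃.obj 0 :=
  comp (add_neg_cancel 1) (comp (add_zero 1) r.fst c₁₂.snd) c₂₃.inl +
    comp (zero_add 0) r.snd (c₁₃.map c₂₃ f (one z) 0)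

lemma d_octahedronHom : d (zero_add 1) (octahedronHom c₁₂ c₂₃ c₁₃ r) = 0 :=
  d_eq_zero fun φ => by
    simp [octahedronHom]
    abel

lemma d_octahedronInv : d (zero_add 1) (octahedronInv c₁₂ c₂₃ c₁₃ r) = 0 :=
  d_eq_zero fun φ => by
    simp [octahedronInv, dOp_opr_closed₀ c₁₂.closed]
    abel

/-- The cone of `g` is homotopy equivalent to the cone of `cone f ⟶ cone (g ∘ f)`. -/
def octahedronIso : HZero.mk (k := k) c₂₃.obj ≅ HZero.mk r.obj where
  hom := HZero.homMk k (octahedronHom c₁₂ c₂₃ c₁₃ r) (d_octahedronHom c₁₂ c₂₃ c₁₃ r)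
  inv := HZero.homMk k (octahedronInv c₁₂ c₂₃ c₁₃ r) (d_octahedronInv c₁₂ c₂₃ c₁₃ r)
  hom_inv_id := HZero.homMk_congr (opr_injective fun φ => by
    simp [octahedronHom, octahedronInv, c₂₃.opr_total]) _ (d_one _ _)
  inv_hom_id := by
    refine HZero.homMk_eq
      (f := comp (zero_add 0) (octahedronInv c₁₂ c₂₃ c₁₃ r) (octahedronHom c₁₂ c₂₃ c₁₃ r))
      (g := one r.obj) _ (d_one _ _)
      (- comp (show 1 + (-1 + -1) = (-1 : ℤ) by norm_num) (comp (zero_add 1) r.snd c₁₃.fst)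
        (comp rfl c₁₂.inl r.inl))
      (opr_injective fun φ => ?_)
    obtain ⟨α, β, rfl⟩ := r.elements_cases φ
    obtain ⟨γ, δ, rfl⟩ := c₁₂.elements_cases α
    obtain ⟨γ', δ', rfl⟩ := c₁₃.elements_cases β
    simp [octahedronHom, octahedronInv]
    abel

end Octahedron

end DGCone

namespace DGShift

variable {k : Type w} [CommRing k] {C : Type u} [DGCategory.{w, v, u} k C]

lemma uniqueIso_comm {x : C} {n m : ℤ} (s : DGShift k x n) (s' : DGShift k s.obj m)
    (t : DGShift k x m) (t' : DGShift k t.obj n) (a : DGShift k x (n + m))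
    (b : DGShift k x (m + n)) :
    comp (zero_add 0) ((s.trans s').conj a (one x)) (comp (zero_add 0)
      (comp (by omega) a.inv b.hom) (b.conj (t.trans t') (one x))) =
      comp (by omega) (s.trans s').inv (t.trans t').hom :=
  opr_injective fun φ => by simp

end DGShift

namespace HZero

variable {k : Type w} [CommRing k] {C : Type u} [DGCategory.{w, v, u} k C] [HasDGCones k C]

/-- The triangle `x ⟶ y ⟶ cone f ⟶ x[1]`. -/
noncomputable def coneTriangle {x y : C} {f : Hom k x y 0} (c : DGCone f) :
    Triangle (HZero k C) :=
  Triangle.mk (X := ⟨x⟩) (Y := ⟨y⟩) (Z := ⟨c.obj⟩) (homMk k f c.closed) (homMk k c.inr c.d_inr)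
    (homMk k (comp (add_neg_cancel 1) c.fst (sh k x 1).hom) (d_eq_zero fun φ => by simp))

/-- A morphism of cone triangles. -/
noncomputable def coneTriangleMap {x y x' y' : C} {f : Hom k x y 0} {f' : Hom k x' y' 0}
    (c : DGCone f) (c' : DGCone f') (a : Hom k x x' 0) (b : Hom k y y' 0) (h : Hom k x y' (-1))
    (ha : d (zero_add 1) a = 0) (hb : d (zero_add 1) b = 0)
    (hh : d (neg_add_cancel 1) h = comp (zero_add 0) f b - comp (zero_add 0) a f') :
    coneTriangle c ⟶ coneTriangle c' where
  hom₁ := homMk k a ha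
  hom₂ := homMk k b hb
  hom₃ := homMk k (c.map c' a b h) (c.d_map c' ha hb hh)
  comm₁ := homMk_eq _ _ h hh
  comm₂ := homMk_congr (f := comp (zero_add 0) c.inr (c.map c' a b h))
    (g := comp (zero_add 0) b c'.inr) (opr_injective fun φ => by simp) _ _
  comm₃ := homMk_congr
    (f := comp (zero_add 0) (comp (add_neg_cancel 1) c.fst (sh k x 1).hom)
      ((sh k x 1).conj (sh k x' 1) a))
    (g := comp (zero_add 0) (c.map c' a b h) (comp (add_neg_cancel 1) c'.fst (sh k x' 1).hom))
    (opr_injective fun φ => by simp) _ _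

lemma exists_coneTriangleMap {x y x' y' : C} {f : Hom k x y 0} {f' : Hom k x' y' 0}
    (c : DGCone f) (c' : DGCone f') (a : (coneTriangle c).obj₁ ⟶ (coneTriangle c').obj₁)
    (b : (coneTriangle c).obj₂ ⟶ (coneTriangle c').obj₂)
    (fac : (coneTriangle c).mor₁ ≫ b = a ≫ (coneTriangle c').mor₁) :
    ∃ φ : coneTriangle c ⟶ coneTriangle c', φ.hom₁ = a ∧ φ.hom₂ = b := by
  obtain ⟨a, ha, rfl⟩ := exists_homMk a
  obtain ⟨b, hb, rfl⟩ := exists_homMk b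
  obtain ⟨h, hh⟩ := (homMk_eq_iff _ _).1 fac
  exact ⟨coneTriangleMap c c' a b h ha hb hh, rfl, rfl⟩

variable (k C) in
/-- The triangles isomorphic to cone triangles. -/
def distinguishedTriangles : Set (Triangle (HZero k C)) :=
  {T | ∃ (x y : C) (f : Hom k x y 0) (c : DGCone f), Nonempty (T ≅ coneTriangle c)}

lemma coneTriangle_mem {x y : C} {f : Hom k x y 0} (c : DGCone f) :
    coneTriangle c ∈ distinguishedTriangles k C :=
  ⟨x, y, f, c, ⟨Iso.refl _⟩⟩

lemma distinguished_of_iso {T T' : Triangle (HZero k C)} (e : T' ≅ T)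
    (hT : T ∈ distinguishedTriangles k C) : T' ∈ distinguishedTriangles k C := by
  obtain ⟨x, y, f, c, ⟨e'⟩⟩ := hT
  exact ⟨x, y, f, c, ⟨e ≪≫ e'⟩⟩

lemma contractible_mem (X : HZero k C) :
    contractibleTriangle X ∈ distinguishedTriangles k C := by
  obtain ⟨c⟩ := HasDGCones.cone (one (k := k) X.as) (d_one _ _)
  have hc := c.isZero_of_one
  exact ⟨_, _, _, c, ⟨Triangle.isoMk _ _ (Iso.refl _) (Iso.refl _)
    ((isZero_zero _).iso hc) (by rfl) (hc.eq_of_tgt _ _) ((isZero_zero _).eq_of_src _ _)⟩⟩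

lemma rotate_coneTriangle_mem {x y : C} {f : Hom k x y 0} (c : DGCone f) :
    (coneTriangle c).rotate ∈ distinguishedTriangles k C := by
  obtain ⟨r⟩ := HasDGCones.cone c.inr c.d_inr
  let e := c.rotateIso r (sh k x 1)
  refine distinguished_of_iso ?_ (coneTriangle_mem r)
  refine (Triangle.isoMk (coneTriangle r) (coneTriangle c).rotate (Iso.refl _) (Iso.refl _) e
    ?_ ?_ ?_).symm
  · exact (Category.comp_id _).trans (Category.id_comp _).symm
  · refine Eq.trans ?_ (Category.id_comp _).symm
    exact homMk_congr (f := comp (zero_add 0) r.inr (c.rotateInv r (sh k x 1)))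
      (g := comp (add_neg_cancel 1) c.fst (sh k x 1).hom)
      (opr_injective fun φ => by simp [DGCone.rotateInv]) _ _
  · refine (Iso.inv_comp_eq e).1 ?_
    refine (congrArg (fun g => e.inv ≫ (coneTriangle r).mor₃ ≫ g)
      ((CategoryTheory.shiftFunctor (HZero k C) (1 : ℤ)).map_id _)).trans ?_
    exact homMk_congr (f := comp (zero_add 0) (c.rotateHom r (sh k x 1)) (comp (zero_add 0)
        (comp (add_neg_cancel 1) r.fst (sh k y 1).hom) (one _)))
      (g := - (sh k x 1).conj (sh k y 1) f)
      (opr_injective fun φ => by simp [DGCone.rotateHom]) _ _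

lemma rotate_mem {T : Triangle (HZero k C)} (hT : T ∈ distinguishedTriangles k C) :
    T.rotate ∈ distinguishedTriangles k C := by
  obtain ⟨x, y, f, c, ⟨e⟩⟩ := hT
  exact distinguished_of_iso ((rotate _).mapIso e) (rotate_coneTriangle_mem c)

lemma shiftFunctorComm_hom_app (n m : ℤ) (x : C) :
    (shiftFunctorComm (HZero k C) n m).hom.app ⟨x⟩ = homMk k
      (comp (by omega) ((sh k x n).trans (sh k _ m)).inv ((sh k x m).trans (sh k _ n)).hom)
      (d_eq_zero fun φ => by
        have h : n.negOnePow * (m.negOnePow * (n.negOnePow * m.negOnePow)) = 1 := by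
          rw [← mul_assoc, Int.units_mul_self]
        simp [map_zsmul_unit, smul_smul, h]) := by
  rw [shiftFunctorComm, shiftFunctorAdd', Iso.trans_hom, Iso.trans_hom, NatTrans.comp_app,
    NatTrans.comp_app, eqToIso.hom, eqToHom_app, Iso.symm_hom, shiftFunctorAdd_inv_app,
    shiftFunctorAdd_hom_app]
  refine (congrArg (fun g => _ ≫ g ≫ _) (eqToHom_shiftBy k (add_comm n m) ⟨x⟩ _)).trans ?_
  exact homMk_congr (DGShift.uniqueIso_comm _ _ _ _ _ _) _ _

lemma shift_coneTriangle_mem {x y : C} {f : Hom k x y 0} (c : DGCone f) (n : ℤ) :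
    (Triangle.shiftFunctor (HZero k C) n).obj (coneTriangle c) ∈ distinguishedTriangles k C := by
  let c' := c.shift (sh k x n) (sh k y n) (sh k c.obj n)
  refine distinguished_of_iso (T := coneTriangle c') ?_ (coneTriangle_mem _)
  -- All three morphisms of the shifted triangle carry the sign `(-1) ^ n`. The sign of the
  -- isomorphism of the second objects cancels those of the first two, and the sign of the third
  -- is that in `DGCone.shift`.
  let ε : HZero.mk (k := k) (sh k y n).obj ≅ HZero.mk (sh k y n).obj :=
    { hom := homMk k (n.negOnePow • one _) (by rw [map_zsmul_unit, d_one, smul_zero])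
      inv := homMk k (n.negOnePow • one _) (by rw [map_zsmul_unit, d_one, smul_zero])
      hom_inv_id := homMk_congr (opr_injective fun φ => by simp [smul_smul]) _ (d_one _ _)
      inv_hom_id := homMk_congr (opr_injective fun φ => by simp [smul_smul]) _ (d_one _ _) }
  refine Triangle.isoMk _ _ (Iso.refl _) ε (Iso.refl _) ?_ ?_ ?_
  · refine Eq.trans ?_ (Category.id_comp _).symm
    refine (congrArg (fun g => g ≫ ε.hom)
      (unit_smul_homMk n.negOnePow ((sh k x n).conj (sh k y n) f) _)).trans ?_
    exact homMk_congr (f := comp (zero_add 0) (n.negOnePow • (sh k x n).conj (sh k y n) f)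
      (n.negOnePow • one _)) (opr_injective fun φ => by simp [map_zsmul_unit, smul_smul]) _ _
  · refine (Category.comp_id _).trans ?_
    refine (unit_smul_homMk n.negOnePow ((sh k y n).conj (sh k c.obj n) c.inr) _).trans ?_
    exact homMk_congr (g := comp (zero_add 0) (n.negOnePow • one _)
      ((sh k y n).conj (sh k c.obj n) c.inr))
      (opr_injective fun φ => by simp [map_zsmul_unit]) _ _
  · refine (congrArg (fun g => _ ≫ g)
        ((CategoryTheory.shiftFunctor (HZero k C) (1 : ℤ)).map_id _)).trans ?_
    refine (Category.comp_id _).trans (Eq.trans ?_ (Category.id_comp _).symm)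
    refine (congrArg (fun g => n.negOnePow • (_ ≫ g)) (shiftFunctorComm_hom_app 1 n x)).trans ?_
    refine (unit_smul_homMk n.negOnePow (comp (zero_add 0) ((sh k c.obj n).conj (sh k _ n)
      (comp (add_neg_cancel 1) c.fst (sh k x 1).hom)) (comp (by omega)
        ((sh k x 1).trans (sh k _ n)).inv ((sh k x n).trans (sh k _ 1)).hom)) _).trans ?_
    exact homMk_congr (g := comp (add_neg_cancel 1) (n.negOnePow • (sh k c.obj n).conj
      (sh k x n) c.fst) (sh k (sh k x n).obj 1).hom)
      (opr_injective fun φ => by simp [map_zsmul_unit]) _ _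

lemma shift_mem {T : Triangle (HZero k C)} (hT : T ∈ distinguishedTriangles k C) (n : ℤ) :
    (Triangle.shiftFunctor (HZero k C) n).obj T ∈ distinguishedTriangles k C := by
  obtain ⟨x, y, f, c, ⟨e⟩⟩ := hT
  exact distinguished_of_iso ((Triangle.shiftFunctor _ n).mapIso e) (shift_coneTriangle_mem c n)

/-- The rotation can be inverted by rotating two more times and shifting by `-1`. -/
lemma mem_of_rotate_mem {T : Triangle (HZero k C)} (hT : T.rotate ∈ distinguishedTriangles k C) :
    T ∈ distinguishedTriangles k C :=
  distinguished_of_iso ((triangleRotation (HZero k C)).unitIso.app T ≪≫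
    (invRotateIsoRotateRotateShiftFunctorNegOne (HZero k C)).app T.rotate)
    (shift_mem (rotate_mem (rotate_mem hT)) (-1))

noncomputable instance : Pretriangulated (HZero k C) where
  distinguishedTriangles := distinguishedTriangles k C
  isomorphic_distinguished _ hT _ e := distinguished_of_iso e hT
  contractible_distinguished := contractible_mem
  distinguished_cocone_triangle {X Y} f := by
    obtain ⟨f, hf, rfl⟩ := exists_homMk f
    obtain ⟨c⟩ := HasDGCones.cone f hf
    exact ⟨_, _, _, coneTriangle_mem c⟩
  rotate_distinguished_triangle T := ⟨rotate_mem, mem_of_rotate_mem⟩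
  complete_distinguished_triangle_morphism := by
    rintro T₁ T₂ ⟨x, y, f, c, ⟨e⟩⟩ ⟨x', y', f', c', ⟨e'⟩⟩ a b fac
    obtain ⟨φ, h₁, h₂⟩ := exists_coneTriangleMap c c' (e.inv.hom₁ ≫ a ≫ e'.hom.hom₁)
      (e.inv.hom₂ ≫ b ≫ e'.hom.hom₂) (by
        have h₁ := e.inv.comm₁
        have h₂ := e'.hom.comm₁
        rw [reassoc_of% h₁, reassoc_of% fac, h₂, Category.assoc, Category.assoc])
    have h₃ := (e.hom ≫ φ ≫ e'.inv).comm₂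
    have h₄ := (e.hom ≫ φ ≫ e'.inv).comm₃
    have h₅ : (e.hom ≫ φ ≫ e'.inv).hom₁ = a := by
      simp [h₁]
    have h₆ : (e.hom ≫ φ ≫ e'.inv).hom₂ = b := by
      simp [h₂]
    rw [h₆] at h₃
    rw [h₅] at h₄
    exact ⟨_, h₃, h₄⟩

lemma coneTriangle_distinguished {x y : C} {f : Hom k x y 0} (c : DGCone f) :
    coneTriangle c ∈ distTriang (HZero k C) := coneTriangle_mem c

instance : IsTriangulated (HZero k C) := IsTriangulated.mk' (by
  rintro ⟨x⟩ ⟨y⟩ ⟨z⟩ f g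
  obtain ⟨f, hf, rfl⟩ := exists_homMk f
  obtain ⟨g, hg, rfl⟩ := exists_homMk g
  obtain ⟨c₁₂⟩ := HasDGCones.cone f hf
  obtain ⟨c₂₃⟩ := HasDGCones.cone g hg
  obtain ⟨c₁₃⟩ := HasDGCones.cone (comp (zero_add 0) f g) (d_comp_closed hf hg)
  have h₁ : d (neg_add_cancel 1) (0 : Hom k x z (-1)) = comp (zero_add 0) f g -
      comp (zero_add 0) (one x) (comp (zero_add 0) f g) :=
    opr_injective fun φ => by simp
  have h₃ : d (neg_add_cancel 1) (0 : Hom k x z (-1)) = comp (zero_add 0)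
      (comp (zero_add 0) f g) (one z) - comp (zero_add 0) f g :=
    opr_injective fun φ => by simp
  let α := coneTriangleMap c₁₂ c₁₃ (one x) g 0 (d_one _ _) hg h₁
  let β := coneTriangleMap c₁₃ c₂₃ f (one z) 0 hf (d_one _ _) h₃
  obtain ⟨r⟩ := HasDGCones.cone (c₁₂.map c₁₃ (one x) g 0) (c₁₂.d_map c₁₃ (d_one _ _) hg h₁)
  let e := DGCone.octahedronIso c₁₂ c₂₃ c₁₃ r
  refine ⟨_, _, _, _, _, _, _, _, Iso.refl _, Iso.refl _, Iso.refl _,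
    (Category.comp_id _).trans (Category.id_comp _).symm,
    (Category.comp_id _).trans (Category.id_comp _).symm,
    _, _, coneTriangle_mem c₁₂, _, _, coneTriangle_mem c₂₃, _, _, coneTriangle_mem c₁₃,
    ⟨{  m₁ := α.hom₃
        m₃ := β.hom₃
        comm₁ := α.comm₂
        comm₂ := α.comm₃.symm.trans ?_
        comm₃ := β.comm₂.trans (Category.id_comp _)
        comm₄ := β.comm₃
        mem := ?_ }⟩⟩
  · exact (congrArg (fun g => _ ≫ g)
      ((CategoryTheory.shiftFunctor (HZero k C) (1 : ℤ)).map_id _)).trans (Category.comp_id _)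
  · refine distinguished_of_iso ?_ (coneTriangle_mem r)
    refine Triangle.isoMk _ (coneTriangle r) (Iso.refl _) (Iso.refl _) e ?_ ?_ ?_
    · exact (Category.comp_id _).trans (Category.id_comp _).symm
    · refine Eq.trans ((Iso.eq_comp_inv e).1 ?_) (Category.id_comp _).symm
      exact homMk_congr (f := c₁₃.map c₂₃ f (one z) 0)
        (g := comp (zero_add 0) r.inr (DGCone.octahedronInv c₁₂ c₂₃ c₁₃ r))
        (opr_injective fun φ => by simp [DGCone.octahedronInv]) _ _
    · refine (congrArg (fun g => _ ≫ g)
        ((CategoryTheory.shiftFunctor (HZero k C) (1 : ℤ)).map_id _)).trans ?_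
      refine (Category.comp_id _).trans ?_
      exact homMk_congr
        (f := comp (zero_add 0) (comp (add_neg_cancel 1) c₂₃.fst (sh k y 1).hom)
          ((sh k y 1).conj (sh k c₁₂.obj 1) c₁₂.inr))
        (g := comp (zero_add 0) (DGCone.octahedronHom c₁₂ c₂₃ c₁₃ r)
          (comp (add_neg_cancel 1) r.fst (sh k c₁₂.obj 1).hom))
        (opr_injective fun φ => by simp [DGCone.octahedronHom]) _ _)

end HZero

namespace DGFunctor

variable {k : Type w} [CommRing k] {C : Type u} [DGCategory.{w, v, u} k C] [HasDGCones k C]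
  {D : Type u'} [DGCategory.{w, v', u'} k D] [HasDGCones k D] (F : DGFunctor k C D)

/-- The image of a cone triangle is a cone triangle. -/
noncomputable def mapConeTriangleIso {x y : C} {f : Hom k x y 0} (c : DGCone f) :
    F.hZero.mapTriangle.obj (HZero.coneTriangle c) ≅ HZero.coneTriangle (F.mapCone c) :=
  Triangle.isoMk _ _ (Iso.refl _) (Iso.refl _) (Iso.refl _)
    ((Category.comp_id _).trans (Category.id_comp _).symm)
    ((Category.comp_id _).trans (Category.id_comp _).symm) (by
      refine (congrArg (fun g => _ ≫ g)
        ((CategoryTheory.shiftFunctor (HZero k D) (1 : ℤ)).map_id _)).trans ?_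
      refine (Category.comp_id _).trans (Eq.trans ?_ (Category.id_comp _).symm)
      exact HZero.homMk_congr
        (f := comp (zero_add 0) (F.map (comp (add_neg_cancel 1) c.fst (HZero.sh k x 1).hom))
          ((F.mapShift (HZero.sh k x 1)).conj (HZero.sh k (F.obj x) 1) (one (F.obj x))))
        (g := comp (add_neg_cancel 1) (F.map c.fst) (HZero.sh k (F.obj x) 1).hom)
        (opr_injective fun φ => by
          simp [F.map_comp, DGShift.opr_conj (F.mapShift (HZero.sh k x 1))]) _ _)

instance : F.hZero.IsTriangulated where
  map_distinguished T hT := by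
    obtain ⟨x, y, f, c, ⟨e⟩⟩ := hT
    exact HZero.distinguished_of_iso (F.hZero.mapTriangle.mapIso e ≪≫ F.mapConeTriangleIso c)
      (HZero.coneTriangle_mem _)

end DGFunctor

/-! ### Functors that commute with the shift by one -/

namespace CategoryTheory.Functor

variable {C : Type*} [Category* C] [HasShift C ℤ] {D : Type*} [Category* D] [HasShift D ℤ]
  (F : C ⥤ D)

/-- The isomorphisms that express that `F` commutes with the shift by some integer. They form a
group, of which a section over `ℤ` is a `CommShift` structure. -/
def ShiftIsos : Type _ :=
  Σ n : ℤ, CategoryTheory.shiftFunctor C n ⋙ F ≅ F ⋙ CategoryTheory.shiftFunctor D n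

namespace ShiftIsos

variable {F}

lemma mk_isoAdd' {a b c : ℤ} (h : a + b = c)
    (e₁ : CategoryTheory.shiftFunctor C a ⋙ F ≅ F ⋙ CategoryTheory.shiftFunctor D a)
    (e₂ : CategoryTheory.shiftFunctor C b ⋙ F ≅ F ⋙ CategoryTheory.shiftFunctor D b) :
    (⟨c, CommShift.isoAdd' h e₁ e₂⟩ : F.ShiftIsos) = ⟨a + b, CommShift.isoAdd e₁ e₂⟩ := by
  subst h
  rfl

noncomputable instance : Mul F.ShiftIsos := ⟨fun x y => ⟨x.1 + y.1, CommShift.isoAdd x.2 y.2⟩⟩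

noncomputable instance : One F.ShiftIsos := ⟨⟨0, CommShift.isoZero F ℤ⟩⟩

lemma mul_assoc (x y z : F.ShiftIsos) : x * y * z = x * (y * z) := by
  refine Eq.trans ?_ (mk_isoAdd' (by omega : x.1 + (y.1 + z.1) = x.1 + y.1 + z.1) x.2
    (CommShift.isoAdd y.2 z.2))
  exact congrArg (Sigma.mk _) (CommShift.isoAdd'_assoc x.2 y.2 z.2 rfl rfl rfl)

lemma one_mul (x : F.ShiftIsos) : 1 * x = x := by
  refine (mk_isoAdd' (zero_add x.1) (CommShift.isoZero F ℤ) x.2).symm.trans ?_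
  exact congrArg (Sigma.mk _) (CommShift.isoZero_isoAdd'_ x.2)

/-- The inverse of `n` and `e` is the isomorphism `e'` for which the composite of `e'` and `e` is
the canonical isomorphism for the shift by zero. It exists since the shift by `n` is an
equivalence. -/
lemma exists_mul_eq_one (x : F.ShiftIsos) : ∃ y : F.ShiftIsos, y * x = 1 := by
  obtain ⟨n, e⟩ := x
  have h : -n + n = 0 := neg_add_cancel n
  let i : (CategoryTheory.shiftFunctor C (-n) ⋙ F) ⋙ CategoryTheory.shiftFunctor D n ≅
      (F ⋙ CategoryTheory.shiftFunctor D (-n)) ⋙ CategoryTheory.shiftFunctor D n :=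
    Functor.associator _ _ _ ≪≫ isoWhiskerLeft _ e.symm ≪≫ (Functor.associator _ _ _).symm ≪≫
      isoWhiskerRight (CategoryTheory.shiftFunctorAdd' C (-n) n 0 h).symm F ≪≫
      CommShift.isoZero F ℤ ≪≫ isoWhiskerLeft F (CategoryTheory.shiftFunctorAdd' D (-n) n 0 h) ≪≫
      (Functor.associator _ _ _).symm
  let e' := Functor.fullyFaithfulCancelRight (CategoryTheory.shiftFunctor D n) i
  have he' : ∀ X, (CategoryTheory.shiftFunctor D n).map (e'.hom.app X) = i.hom.app X := fun X => by
    simp [e']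
  refine ⟨⟨-n, e'⟩, (mk_isoAdd' h e' e).symm.trans (congrArg (Sigma.mk _) ?_)⟩
  ext X
  rw [CommShift.isoAdd'_hom_app, he']
  simp [i]

noncomputable instance : Group F.ShiftIsos :=
  letI : Inv F.ShiftIsos := ⟨fun x => (exists_mul_eq_one x).choose⟩
  Group.ofLeftAxioms mul_assoc one_mul fun x => (exists_mul_eq_one x).choose_spec

lemma fst_zpow (x : F.ShiftIsos) (hx : x.1 = 1) (n : ℤ) : (x ^ n).1 = n := by
  let φ : F.ShiftIsos →* Multiplicative ℤ :=
    { toFun := fun x => Multiplicative.ofAdd x.1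
      map_one' := rfl
      map_mul' := fun _ _ => rfl }
  have h := congrArg Multiplicative.toAdd (map_zpow φ x n)
  refine h.trans ?_
  change n • x.1 = n
  simp [hx]

end ShiftIsos

/-- An isomorphism that expresses that `F` commutes with the shift by `1` extends to a `CommShift`
structure. -/
lemma exists_commShift
    (e : CategoryTheory.shiftFunctor C (1 : ℤ) ⋙ F ≅ F ⋙ CategoryTheory.shiftFunctor D (1 : ℤ)) :
    ∃ h : F.CommShift ℤ, h.commShiftIso 1 = e := by
  let x : F.ShiftIsos := ⟨1, e⟩
  have hx : ∀ n : ℤ, ∃ i : CategoryTheory.shiftFunctor C n ⋙ F ≅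
      F ⋙ CategoryTheory.shiftFunctor D n, (⟨n, i⟩ : F.ShiftIsos) = x ^ n := fun n => by
    rcases hm : x ^ n with ⟨m, i⟩
    obtain rfl : m = n := by
      rw [← x.fst_zpow rfl n, hm]
    exact ⟨i, rfl⟩
  choose i hi using hx
  refine ⟨⟨i, ?_, fun a b => ?_⟩, ?_⟩
  · exact eq_of_heq (Sigma.mk.inj ((hi 0).trans (zpow_zero x))).2
  · refine eq_of_heq (Sigma.mk.inj ((hi (a + b)).trans ((zpow_add x a b).trans ?_))).2
    rw [← hi, ← hi]
    rfl
  · exact eq_of_heq (Sigma.mk.inj ((hi 1).trans (zpow_one x))).2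

end CategoryTheory.Functor

/-! ### Shifts and cones of twisted complexes -/

namespace FormalSum

variable {k : Type w} [CommRing k] {C : Type u} [DGCategory.{w, v, u} k C]

/-- The formal sum `⨁ᵢ Cᵢ[r'ᵢ]` with the objects of `⨁ᵢ Cᵢ[rᵢ]` and other shifts. -/
@[reducible] def withDeg (X : FormalSum C) (deg' : X.ι → ℤ) : FormalSum C := ⟨X.ι, X.obj, deg'⟩

variable (k) in
/-- The isomorphism `⨁ᵢ Cᵢ[rᵢ] ⟶ ⨁ᵢ Cᵢ[rᵢ - a]` of degree `a` with identity entries. -/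
noncomputable def reDeg (X : FormalSum C) (deg' : X.ι → ℤ) {a : ℤ}
    (ha : ∀ i, X.deg i = a + deg' i) : Hom k X (X.withDeg deg') a :=
  (fun i j => castDeg (k := k) (x := X.obj j) (y := X.obj i)
    (show 0 + X.deg i - X.deg j = a + deg' i - X.deg j by rw [ha, zero_add]) (oneMatrix k X i j) :
      hom k X (X.withDeg deg') a)

lemma comp_reDeg_apply (X : FormalSum C) (deg' : X.ι → ℤ) {a : ℤ}
    (ha : ∀ i, X.deg i = a + deg' i) {Y : FormalSum C} {b c : ℤ} (h : b + a = c)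
    (f : Hom k Y X b) (i : X.ι) (j : Y.ι) :
    (comp h f (reDeg k X deg' ha) : hom k Y (X.withDeg deg') c) i j =
      castDeg (by have := ha i; change _ = c + deg' i - _; omega) ((f : hom k Y X b) i j) := by
  refine Eq.trans ?_ (congrArg (castDeg _)
    (matComp_one (k := k) (add_zero b) (f : hom k Y X b) i j))
  refine Eq.trans ?_ (map_sum (castDeg (k := k) (x := Y.obj j) (y := X.obj i) _) _ _).symm
  exact Finset.sum_congr rfl fun l _ => (comp_castDeg _ _ _ _).trans (castDeg_of_comp _ _ _ _).symm

lemma reDeg_comp_apply (X : FormalSum C) (deg' : X.ι → ℤ) {a : ℤ}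
    (ha : ∀ i, X.deg i = a + deg' i) {Y : FormalSum C} {b c : ℤ} (h : a + b = c)
    (f : Hom k (X.withDeg deg') Y b) (i : Y.ι) (j : X.ι) :
    (comp h (reDeg k X deg' ha) f : hom k X Y c) i j =
      castDeg (by have := ha j; change b + _ - deg' j = _; omega)
        ((f : hom k (X.withDeg deg') Y b) i j) := by
  refine (Finset.sum_eq_single j ?_ ?_).trans ?_
  · intro l _ hl
    refine (congrArg (fun z => comp _ z _) ((congrArg (castDeg _)
      (oneMatrix_of_ne X hl)).trans (map_zero _))).trans (DGCategory.zero_comp _ _)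
  · simp
  · refine (congrArg (fun z => comp _ z _) ((congrArg (castDeg _)
      (oneMatrix_self X j)).trans (castDeg_castDeg _ _ _))).trans ?_
    exact (castDeg_comp _ _ _ _).trans (one_comp' _ _)

lemma d_reDeg (X : FormalSum C) (deg' : X.ι → ℤ) {a b : ℤ}
    (ha : ∀ i, X.deg i = a + deg' i) (h : a + 1 = b) : d h (reDeg k X deg' ha) = 0 := by
  funext i j
  have h0 := congrFun (congrFun (matD_one (k := k) X) i) j
  rw [matD_apply] at h0
  have h1 : d (by omega : 0 + X.deg i - X.deg j + 1 = 1 + X.deg i - X.deg j)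
      (oneMatrix k X i j) = 0 := (smul_eq_zero_iff_eq (α := ℤˣ) _).1 h0
  refine (congrArg (_ • ·) ((d_castDeg _ _ _).trans ?_)).trans (smul_zero _)
  rw [← castDeg_d (show 1 + X.deg i - X.deg j = b + deg' i - X.deg j by
    have := ha i; omega) (by omega), h1, map_zero]

lemma reDeg_comp_reDeg (X : FormalSum C) (deg' deg'' : X.ι → ℤ) {a b c : ℤ}
    (ha : ∀ i, X.deg i = a + deg' i) (hb : ∀ i, deg' i = b + deg'' i) (h : a + b = c) :
    comp h (reDeg k X deg' ha) (reDeg k (X.withDeg deg') deg'' hb) =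
      reDeg k X deg'' fun i => by rw [ha, hb, ← h, add_assoc] := by
  funext i j
  exact (comp_reDeg_apply (X.withDeg deg') deg'' hb h _ i j).trans
    (castDeg_castDeg (x := X.obj j) (y := X.obj i) _ _ (oneMatrix k X i j))

variable (k) in
/-- The shift of a formal sum. -/
noncomputable def dgShift (X : FormalSum C) (n : ℤ) : DGShift k X n where
  obj := X.withDeg fun i => X.deg i + n
  hom := reDeg k X (fun i => X.deg i + n) fun i => by ring
  inv := reDeg k (X.withDeg fun i => X.deg i + n) X.deg fun i => add_comm _ _
  d_hom := d_reDeg _ _ _ _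
  hom_inv := reDeg_comp_reDeg X (fun i => X.deg i + n) X.deg _ _ _
  inv_hom := reDeg_comp_reDeg (X.withDeg fun i => X.deg i + n) X.deg (fun i => X.deg i + n) _ _ _

variable (k) in
/-- The isomorphism `X ⟶ X[1]` of degree `-1`. -/
noncomputable def toShift (X : FormalSum C) : Hom k X X.shift (-1) :=
  reDeg k X X.shift.deg fun i => by change _ = -1 + (X.deg i + 1); ring

variable (k) in
/-- The isomorphism `X[1] ⟶ X` of degree `1`. -/
noncomputable def ofShift (X : FormalSum C) : Hom k X.shift X 1 :=
  reDeg k X.shift X.deg fun _ => add_comm _ _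

lemma d_toShift (X : FormalSum C) : d (neg_add_cancel 1) (toShift k X) = 0 := d_reDeg _ _ _ _

lemma toShift_comp_ofShift (X : FormalSum C) :
    comp (neg_add_cancel 1) (toShift k X) (ofShift k X) = one X :=
  reDeg_comp_reDeg X X.shift.deg X.deg _ _ _

lemma ofShift_comp_toShift (X : FormalSum C) :
    comp (add_neg_cancel 1) (ofShift k X) (toShift k X) = one X.shift :=
  reDeg_comp_reDeg X.shift X.deg X.shift.deg _ _ _

@[simp] lemma opr_ofShift_toShift {X : FormalSum C} (φ : Elements k X) :
    opr (ofShift k X) (opr (toShift k X) φ) = φ := by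
  rw [opr_opr_of_comp_eq (toShift_comp_ofShift X), opr_one]

@[simp] lemma opr_toShift_ofShift {X : FormalSum C} (φ : Elements k X.shift) :
    opr (toShift k X) (opr (ofShift k X) φ) = φ := by
  rw [opr_opr_of_comp_eq (ofShift_comp_toShift X), opr_one]

lemma toShift_comp_shiftMap {X Y : FormalSum C} {n m : ℤ} (h : -1 + n = m)
    (f : Hom k X Y n) : comp h (toShift k X) (shiftMap f) =
      comp (by omega : n + -1 = m) f (toShift k Y) := by
  funext i j
  refine (reDeg_comp_apply X X.shift.deg _ h (shiftMap f) i j).trans ?_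
  refine Eq.trans ?_ (comp_reDeg_apply Y Y.shift.deg _ _ f i j).symm
  exact castDeg_castDeg (x := X.obj j) (y := Y.obj i) _ _ (f i j)

@[simp] lemma opr_shiftMap {X Y : FormalSum C} {n : ℤ} (f : Hom k X Y n)
    (φ : Elements k X.shift) :
    opr (shiftMap f) φ = opr (toShift k Y) (opr f (opr (ofShift k X) φ)) := by
  have h := opr_opr_of_comp_eq (toShift_comp_shiftMap rfl f) (opr (ofShift k X) φ)
  rwa [opr_toShift_ofShift, opr_comp] at h

@[simp] lemma opr_unshift {X Y : FormalSum C} {n m : ℤ} (h : n + 1 = m) (f : Hom k X Y n)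
    (φ : Elements k X.shift) : opr (unshift h f) φ = opr f (opr (ofShift k X) φ) := by
  have e : unshift h f = comp (by omega : 1 + n = m) (ofShift k X) f := by
    funext i j
    exact (reDeg_comp_apply X.shift X.deg _ _ f i j).symm
  rw [e, opr_comp]

end FormalSum

namespace TwistedComplex

variable {k : Type w} [CommRing k] {C : Type u} [DGCategory.{w, v, u} k C]

lemma opr_q_q (X : TwistedComplex k C) (φ : Elements k X.sum) :
    opr X.q (opr X.q φ) = - dOp (opr X.q φ) - opr X.q (dOp φ) := by
  have h := congrArg (fun g => opr g φ) X.maurerCartan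
  simp only [opr_add, opr_d, opr_comp, opr_zero, Int.negOnePow_one, Units.neg_smul, one_smul] at h
  rw [← sub_eq_zero, ← h]
  abel

/-- A shift of the underlying formal sum is a shift of twisted complexes if its differential is
that of the shift; the sign makes the morphism `X ⟶ X[n]` closed. -/
@[reducible] noncomputable def dgShiftOfSum (X Y : TwistedComplex k C) {n : ℤ}
    (hom : Hom k X.sum Y.sum (-n)) (inv : Hom k Y.sum X.sum n) (d_hom : d rfl hom = 0)
    (hom_inv : comp (neg_add_cancel n) hom inv = one X.sum)
    (inv_hom : comp (add_neg_cancel n) inv hom = one Y.sum)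
    (hq : ∀ φ, opr Y.q (opr hom φ) = n.negOnePow • opr hom (opr X.q φ)) :
    DGShift k X n where
  obj := Y
  hom := hom
  inv := inv
  d_hom := by
    refine (twistedD_apply (X := X) (Y := Y) rfl hom).trans (opr_injective fun φ => ?_)
    simp [d_hom, hq]
  hom_inv := hom_inv
  inv_hom := inv_hom

/-- The shift by `n` in terms of the shift of formal sums. The sign makes the morphism
`X ⟶ X[n]` closed. -/
noncomputable def shiftBy (X : TwistedComplex k C) (n : ℤ) : TwistedComplex k C where
  sum := (FormalSum.dgShift k X.sum n).obj
  q := n.negOnePow • (FormalSum.dgShift k X.sum n).conj (FormalSum.dgShift k X.sum n) X.q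
  triangular := by
    obtain ⟨rank, hrank⟩ := X.triangular
    refine ⟨rank, fun i j hij => ?_⟩
    refine (congrArg (n.negOnePow • ·) ?_).trans (smul_zero _)
    refine (FormalSum.comp_reDeg_apply X.sum (fun i => X.sum.deg i + n)
      (fun i => by ring) (by ring : n + 1 + -n = 1) _ i j).trans ?_
    refine (congrArg (castDeg _) (FormalSum.reDeg_comp_apply
      (X.sum.withDeg fun i => X.sum.deg i + n) X.sum.deg (fun i => add_comm _ _) rfl X.q
        i j)).trans ?_
    rw [hrank i j hij, map_zero]
    exact map_zero _
  maurerCartan := opr_injective fun φ => by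
    simp [map_zsmul_unit, smul_smul, opr_q_q]

variable (k) in
/-- The shift of twisted complexes is a shift in the DG category of twisted complexes. -/
noncomputable def dgShiftOne (X : TwistedComplex k C) : DGShift k X 1 :=
  dgShiftOfSum X X.shift (FormalSum.toShift k X.sum) (FormalSum.ofShift k X.sum)
    (FormalSum.d_toShift X.sum) (FormalSum.toShift_comp_ofShift X.sum)
    (FormalSum.ofShift_comp_toShift X.sum) fun φ => by
    refine (opr_neg (x := X.sum.shift) (y := X.sum.shift) (FormalSum.shiftMap X.q) _).trans ?_
    rw [Int.negOnePow_one, Units.neg_smul, one_smul]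
    exact congrArg Neg.neg ((FormalSum.opr_shiftMap X.q _).trans
      (congrArg _ (congrArg _ (FormalSum.opr_ofShift_toShift φ))))

lemma nonempty_dgShift (X : TwistedComplex k C) (n : ℤ) : Nonempty (DGShift k X n) :=
  ⟨dgShiftOfSum X (X.shiftBy n) (FormalSum.dgShift k X.sum n).hom
    (FormalSum.dgShift k X.sum n).inv (FormalSum.dgShift k X.sum n).d_hom
    (FormalSum.dgShift k X.sum n).hom_inv (FormalSum.dgShift k X.sum n).inv_hom fun φ => by
    refine (opr_unit_smul (x := (FormalSum.dgShift k X.sum n).obj)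
      (y := (FormalSum.dgShift k X.sum n).obj) _ _ _).trans (congrArg _ ?_)
    exact (DGShift.opr_conj _ _ _ _).trans
      (congrArg _ (congrArg _ ((FormalSum.dgShift k X.sum n).opr_hom_inv φ)))⟩

end TwistedComplex

namespace FormalSum

section

variable {k : Type w} [CommRing k] {C : Type u} [DGCategory.{w, v, u} k C]

variable (k) in
/-- The inclusion of the first summand, as a morphism of the DG category of formal sums. -/
noncomputable def inl (Y X : FormalSum C) : Hom k Y (directSum Y X) 0 :=
  inclusion (k := k) Y X

variable (k) in
/-- The projection to the second summand, as a morphism of the DG category of formal sums. -/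
noncomputable def snd (Y X : FormalSum C) : Hom k (directSum Y X) X 0 :=
  projection (k := k) Y X

variable (k) in
/-- The inclusion of the second summand. -/
noncomputable def inr (Y X : FormalSum C) : Hom k X (directSum Y X) 0 :=
  (fun i j => match i with
    | Sum.inl _ => 0
    | Sum.inr i => oneMatrix k X i j : hom k X (directSum Y X) 0)

variable (k) in
/-- The projection to the first summand. -/
noncomputable def fst (Y X : FormalSum C) : Hom k (directSum Y X) Y 0 :=
  (fun i j => match j with
    | Sum.inl j => oneMatrix k Y i j
    | Sum.inr _ => 0 : hom k (directSum Y X) Y 0)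

variable (Y X : FormalSum C)

lemma comp_inl_apply {Z : FormalSum C} {n m : ℤ} (h : n + 0 = m) (f : Hom k Z Y n) :
    comp h f (inl k Y X) = (fun i j => match i with
      | Sum.inl i => castDeg (k := k) (x := Z.obj j) (y := Y.obj i) (by rw [← h, add_zero]; rfl)
          ((f : hom k Z Y n) i j)
      | Sum.inr _ => 0 : hom k Z (directSum Y X) m) := by
  funext i j
  rcases i with i | i
  · exact matComp_one h f i j
  · exact Finset.sum_eq_zero fun l _ => DGCategory.comp_zero _ _

lemma comp_inr_apply {Z : FormalSum C} {n m : ℤ} (h : n + 0 = m) (f : Hom k Z X n) :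
    comp h f (inr k Y X) = (fun i j => match i with
      | Sum.inl _ => 0
      | Sum.inr i => castDeg (k := k) (x := Z.obj j) (y := X.obj i) (by rw [← h, add_zero]; rfl)
          ((f : hom k Z X n) i j) : hom k Z (directSum Y X) m) := by
  funext i j
  rcases i with i | i
  · exact Finset.sum_eq_zero fun l _ => DGCategory.comp_zero _ _
  · exact matComp_one h f i j

lemma inl_comp_apply {Z : FormalSum C} {n m : ℤ} (h : 0 + n = m)
    (f : Hom k (directSum Y X) Z n) (i : Z.ι) (j : Y.ι) :
    (comp h (inl k Y X) f : hom k Y Z m) i j = castDeg (k := k) (x := Y.obj j) (y := Z.obj i)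
      (show n + Z.deg i - Y.deg j = m + Z.deg i - Y.deg j by rw [← h, zero_add])
      ((f : hom k (directSum Y X) Z n) i (Sum.inl j)) := by
  refine (Fintype.sum_sum_type _).trans ?_
  refine (congrArg₂ (· + ·) ?_ (Finset.sum_eq_zero fun l _ =>
    DGCategory.zero_comp _ _)).trans (add_zero _)
  exact one_matComp (X := Y) (Y := Z) h (fun i j => f i (Sum.inl j)) i j

lemma inr_comp_apply {Z : FormalSum C} {n m : ℤ} (h : 0 + n = m)
    (f : Hom k (directSum Y X) Z n) (i : Z.ι) (j : X.ι) :
    (comp h (inr k Y X) f : hom k X Z m) i j = castDeg (k := k) (x := X.obj j) (y := Z.obj i)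
      (show n + Z.deg i - X.deg j = m + Z.deg i - X.deg j by rw [← h, zero_add])
      ((f : hom k (directSum Y X) Z n) i (Sum.inr j)) := by
  refine (Fintype.sum_sum_type _).trans ?_
  refine (congrArg₂ (· + ·) (Finset.sum_eq_zero fun l _ =>
    DGCategory.zero_comp _ _) ?_).trans (zero_add _)
  exact one_matComp (X := X) (Y := Z) h (fun i j => f i (Sum.inr j)) i j

lemma inl_comp_fst : comp (zero_add 0) (inl k Y X) (fst k Y X) = one Y := by
  funext i j
  exact inl_comp_apply Y X (zero_add 0) (fst k Y X) i j

lemma inl_comp_snd : comp (zero_add 0) (inl k Y X) (snd k Y X) = 0 := by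
  funext i j
  exact inl_comp_apply Y X (zero_add 0) (snd k Y X) i j

lemma inr_comp_fst : comp (zero_add 0) (inr k Y X) (fst k Y X) = 0 := by
  funext i j
  exact inr_comp_apply Y X (zero_add 0) (fst k Y X) i j

lemma inr_comp_snd : comp (zero_add 0) (inr k Y X) (snd k Y X) = one X := by
  funext i j
  exact inr_comp_apply Y X (zero_add 0) (snd k Y X) i j

lemma fst_inl_add_snd_inr : comp (zero_add 0) (fst k Y X) (inl k Y X) +
    comp (zero_add 0) (snd k Y X) (inr k Y X) = one (directSum Y X) := by
  refine (congrArg₂ (· + ·) (comp_inl_apply Y X (zero_add 0) (fst k Y X))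
    (comp_inr_apply Y X (zero_add 0) (snd k Y X))).trans ?_
  funext i j
  rcases i with i | i <;> rcases j with j | j
  · refine (add_zero _).trans ?_
    by_cases h : i = j
    · subst h
      exact (oneMatrix_self Y i).trans (oneMatrix_self (directSum Y X) (Sum.inl i)).symm
    · exact (oneMatrix_of_ne Y h).trans
        (oneMatrix_of_ne (directSum Y X) (fun h' => h (Sum.inl.inj h'))).symm
  · exact (add_zero _).trans (oneMatrix_of_ne (directSum Y X) Sum.inl_ne_inr).symm
  · exact (add_zero _).trans (oneMatrix_of_ne (directSum Y X) Sum.inr_ne_inl).symm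
  · refine (zero_add _).trans ?_
    by_cases h : i = j
    · subst h
      exact (oneMatrix_self X i).trans (oneMatrix_self (directSum Y X) (Sum.inr i)).symm
    · exact (oneMatrix_of_ne X h).trans
        (oneMatrix_of_ne (directSum Y X) (fun h' => h (Sum.inr.inj h'))).symm

lemma d_inr : d (zero_add 1) (inr k Y X) = 0 := by
  funext i j
  rcases i with i | i
  · exact smul_d_zero _ _
  · exact congrFun (congrFun (matD_one (k := k) X) i) j

lemma inr_comp_blocks {n : ℤ} (a : Hom k Y Y n) (b : Hom k X Y n) (e : Hom k X X n) :
    comp (zero_add n) (inr k Y X) (blocks a b e : Hom k (directSum Y X) (directSum Y X) n) =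
      comp (add_zero n) b (inl k Y X) + comp (add_zero n) e (inr k Y X) := by
  refine Eq.trans ?_ (congrArg₂ (· + ·) (comp_inl_apply Y X (add_zero n) b)
    (comp_inr_apply Y X (add_zero n) e)).symm
  funext i j
  refine (inr_comp_apply Y X (zero_add n) _ i j).trans ?_
  rcases i with i | i
  · exact (add_zero _).symm
  · exact (zero_add _).symm

variable {Y X}

/-- The cone of a zero morphism of formal sums. -/
noncomputable def dgCone (X Y : FormalSum C) : DGCone (0 : Hom k X Y 0) where
  obj := directSum Y X.shift
  inl := comp (add_zero (-1)) (toShift k X) (inr k Y X.shift)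
  inr := inl k Y X.shift
  fst := comp (zero_add 1) (snd k Y X.shift) (ofShift k X)
  snd := fst k Y X.shift
  inl_fst := opr_injective fun φ => by
    simp [opr_opr_of_comp_eq (inr_comp_snd Y X.shift)]
  inr_snd := inl_comp_fst _ _
  inl_snd := opr_injective fun φ => by
    simp [opr_opr_of_comp_eq (inr_comp_fst Y X.shift)]
  inr_fst := opr_injective fun φ => by
    simp [opr_opr_of_comp_eq (inl_comp_snd Y X.shift)]
  total := by
    refine Eq.trans ?_ (fst_inl_add_snd_inr Y X.shift)
    refine (add_comm _ _).trans (congrArg₂ (· + ·) rfl (opr_injective fun φ => ?_))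
    simp
  d_inl := opr_injective fun φ => by
    simp [dOp_opr_closed₀ (d_inr Y X.shift), dOp_opr_closed (d_toShift X)]
  d_inr := matD_inclusion _ _

lemma opr_blocks_inl {X Y : FormalSum C} (q : Hom k Y Y 1) (f : Hom k X Y 0) (q' : Hom k X X 1)
    (φ : Elements k X) :
    opr (x := directSum Y X.shift) (y := directSum Y X.shift)
      (blocks q (unshift (zero_add 1) f) (- shiftMap q'))
      (opr (dgCone X Y).inl φ) =
      opr (dgCone X Y).inr (opr f φ) - opr (dgCone X Y).inl (opr q' φ) := by
  have h := congrArg (fun g => opr g (opr (toShift k X) φ))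
    (inr_comp_blocks Y X.shift q (unshift (zero_add 1) f) (- shiftMap q'))
  simp only [opr_comp, opr_add, opr_neg, opr_unshift, opr_shiftMap, opr_ofShift_toShift] at h
  refine (congrArg _ (opr_comp _ _ _ _)).trans (h.trans ?_)
  rw [sub_eq_add_neg, map_neg]
  exact congrArg₂ (· + ·) rfl (congrArg Neg.neg (opr_comp _ _ _ _).symm)

end

end FormalSum

namespace TwistedComplex

variable {k : Type w} [CommRing k] {C : Type u} [DGCategory.{w, v, u} k C]

/-- A cone of zero for the underlying formal sums is a cone of `f` if its differential is the
triangular one with entry `f`. -/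
@[reducible] noncomputable def dgConeOfSum {X Y Z : TwistedComplex k C} (f : Hom k X.sum Y.sum 0)
    (inl : Hom k X.sum Z.sum (-1)) (inr : Hom k Y.sum Z.sum 0) (fst : Hom k Z.sum X.sum 1)
    (snd : Hom k Z.sum Y.sum 0) (inl_fst : comp (neg_add_cancel 1) inl fst = one X.sum)
    (inr_snd : comp (zero_add 0) inr snd = one Y.sum)
    (inl_snd : comp (add_zero (-1)) inl snd = 0) (inr_fst : comp (zero_add 1) inr fst = 0)
    (total : comp (add_neg_cancel 1) fst inl + comp (zero_add 0) snd inr = one Z.sum)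
    (d_inl : d (neg_add_cancel 1) inl = 0) (d_inr : twistedD (zero_add 1) inr = 0)
    (hq : ∀ φ, opr Z.q (opr inl φ) = opr inr (opr f φ) -
      opr inl (opr X.q φ)) : @DGCone k _ (TwistedComplex k C) _ X Y f where
  obj := Z
  inl := inl
  inr := inr
  fst := fst
  snd := snd
  inl_fst := inl_fst
  inr_snd := inr_snd
  inl_snd := inl_snd
  inr_fst := inr_fst
  total := total
  d_inl := by
    have h : twistedD (neg_add_cancel 1) inl = comp (zero_add 0) f inr := by
      rw [twistedD_apply]
      exact opr_injective fun φ => by simp [d_inl, hq]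
    exact h
  d_inr := d_inr

/-- The cone of twisted complexes is a cone in the DG category of twisted complexes. -/
noncomputable def dgCone {X Y : TwistedComplex k C} (f : Hom k X Y 0)
    (hf : d (zero_add 1) f = 0) : DGCone f :=
  dgConeOfSum (Z := cone f hf) f (FormalSum.dgCone X.sum Y.sum).inl (coneInclusion f hf)
    (FormalSum.dgCone X.sum Y.sum).fst (FormalSum.dgCone X.sum Y.sum).snd
    (FormalSum.dgCone X.sum Y.sum).inl_fst (FormalSum.dgCone X.sum Y.sum).inr_snd
    (FormalSum.dgCone X.sum Y.sum).inl_snd (FormalSum.dgCone X.sum Y.sum).inr_fst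
    (FormalSum.dgCone X.sum Y.sum).total
    ((FormalSum.dgCone X.sum Y.sum).d_inl.trans (DGCategory.zero_comp _ _))
    (d_coneInclusion f hf) (FormalSum.opr_blocks_inl Y.q f X.q)

lemma coneProjection_eq {X Y : TwistedComplex k C} (f : Hom k X Y 0)
    (hf : d (zero_add 1) f = 0) :
    comp (add_neg_cancel 1) (dgCone f hf).fst (dgShiftOne k X).hom = coneProjection f hf := by
  refine (DGCategory.assoc (k := k) (C := FormalSum C) _ (add_neg_cancel 1) _ (zero_add 0)
      _ _ _).trans ?_
  refine (congrArg (comp _ _) (FormalSum.ofShift_comp_toShift X.sum)).trans ?_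
  exact DGCategory.comp_one _ _

end TwistedComplex

/-! ### Existence of shifts and cones -/

namespace TwistedComplex

variable {k : Type w} [CommRing k] {C : Type u} [DGCategory.{w, v, u} k C]

instance : HasDGCones k (TwistedComplex k C) where
  exists_zero := ⟨⟨⟨Empty, Empty.elim, Empty.elim⟩, 0, ⟨Empty.elim, fun i => i.elim⟩, by simp⟩,
    funext fun i => i.elim⟩
  shift := nonempty_dgShift
  cone f hf := ⟨dgCone f hf⟩

lemma singleMap_bijective {x y : C} {n : ℤ} :
    Function.Bijective (singleMap : Hom k x y n →ₗ[k] Hom k (single k x) (single k y) n) := by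
  refine ⟨fun f g h => ?_, fun f => ?_⟩
  · have e : n = n + 0 - 0 := by omega
    have h1 : castDeg (k := k) e f = castDeg e g :=
      congrFun (congrFun h ()) ()
    have h2 := congrArg (castDeg (k := k) (x := x) (y := y) (show n + 0 - 0 = n by omega)) h1
    rwa [castDeg_castDeg, castDeg_castDeg] at h2
  · refine ⟨castDeg (show n + 0 - 0 = n by simp) (f () ()), ?_⟩
    funext i j
    exact castDeg_castDeg (x := x) (y := y) _ _ (f () ())

end TwistedComplex

namespace DGFunctor

section

variable {k : Type w} [CommRing k] {C : Type u} [DGCategory.{w, v, u} k C]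
  {D : Type u'} [DGCategory.{w, v', u'} k D] (F : DGFunctor k C D) {x y : C} {f : Hom k x y 0}
  (c : DGCone f)

@[simp] lemma opr_map_inl_fst (φ : Elements k (F.obj x)) :
    opr (F.map c.fst) (opr (F.map c.inl) φ) = φ := (F.mapCone c).opr_inl_fst φ

@[simp] lemma opr_map_inl_snd (φ : Elements k (F.obj x)) :
    opr (F.map c.snd) (opr (F.map c.inl) φ) = 0 := (F.mapCone c).opr_inl_snd φ

@[simp] lemma opr_map_inr_fst (φ : Elements k (F.obj y)) :
    opr (F.map c.fst) (opr (F.map c.inr) φ) = 0 := (F.mapCone c).opr_inr_fst φ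

@[simp] lemma opr_map_inr_snd (φ : Elements k (F.obj y)) :
    opr (F.map c.snd) (opr (F.map c.inr) φ) = φ := (F.mapCone c).opr_inr_snd φ

lemma opr_map_map {x' y' : C} {f' : Hom k x' y' 0} (c' : DGCone f') (a : Hom k x x' 0)
    (b : Hom k y y' 0) (h : Hom k x y' (-1)) (φ : Elements k (F.obj c.obj)) :
    opr (F.map (c.map c' a b h)) φ = opr (F.map c'.inl) (opr (F.map a) (opr (F.map c.fst) φ)) +
      opr (F.map c'.inr) (opr (F.map b) (opr (F.map c.snd) φ)) +
      opr (F.map c'.inr) (opr (F.map h) (opr (F.map c.fst) φ)) := by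
  simp [DGCone.map, F.map_comp]

end

variable {k : Type w} [CommRing k] {C : Type u} [DGCategory.{w, v, u} k C]
  {D : Type u'} [DGCategory.{w, v', u'} k D] (F : DGFunctor k C D)

/-- Fully faithful DG functors reflect shifts. -/
lemma nonempty_dgShift
    (hF : ∀ {x y : C} {n : ℤ}, Function.Bijective (F.map : Hom k x y n →ₗ[k] _))
    {x : C} {n : ℤ} (s : DGShift k (F.obj x) n) {z : C}
    (hz : Isomorphic k (F.obj z) s.obj) : Nonempty (DGShift k x n) := by
  obtain ⟨e, e', he, he', ee', e'e⟩ := hz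
  obtain ⟨hom, hhom⟩ := hF.2 (comp (add_zero (-n)) s.hom e')
  obtain ⟨inv, hinv⟩ := hF.2 (comp (zero_add n) e s.inv)
  have h1 := opr_opr_of_comp_eq ee'
  have h2 := opr_opr_of_comp_eq e'e
  refine ⟨⟨z, hom, inv, hF.1 ?_, hF.1 ?_, hF.1 ?_⟩⟩
  · rw [F.map_d, hhom, map_zero]
    exact opr_injective fun φ => by simp [dOp_opr_closed₀ he']
  · rw [F.map_comp, hhom, hinv, F.map_one]
    exact opr_injective fun φ => by simp [h2]
  · rw [F.map_comp, hhom, hinv, F.map_one]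
    exact opr_injective fun φ => by simp [h1]

/-- Fully faithful DG functors reflect cones. -/
lemma nonempty_dgCone
    (hF : ∀ {x y : C} {n : ℤ}, Function.Bijective (F.map : Hom k x y n →ₗ[k] _))
    {x y : C} {f : Hom k x y 0} (c : DGCone (F.map f)) {z : C}
    (hz : Isomorphic k (F.obj z) c.obj) : Nonempty (DGCone f) := by
  obtain ⟨e, e', he, he', ee', e'e⟩ := hz
  obtain ⟨inl, hinl⟩ := hF.2 (comp (add_zero _) c.inl e')
  obtain ⟨inr, hinr⟩ := hF.2 (comp (add_zero _) c.inr e')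
  obtain ⟨fst, hfst⟩ := hF.2 (comp (zero_add _) e c.fst)
  obtain ⟨snd, hsnd⟩ := hF.2 (comp (zero_add _) e c.snd)
  have h1 := opr_opr_of_comp_eq ee'
  have h2 := opr_opr_of_comp_eq e'e
  refine ⟨⟨z, inl, inr, fst, snd, hF.1 ?_, hF.1 ?_, hF.1 ?_, hF.1 ?_, hF.1 ?_, hF.1 ?_, hF.1 ?_⟩⟩
  · rw [F.map_comp, hinl, hfst, F.map_one]
    exact opr_injective fun φ => by simp [h2]
  · rw [F.map_comp, hinr, hsnd, F.map_one]
    exact opr_injective fun φ => by simp [h2]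
  · rw [F.map_comp, hinl, hsnd, map_zero]
    exact opr_injective fun φ => by simp [h2]
  · rw [F.map_comp, hinr, hfst, map_zero]
    exact opr_injective fun φ => by simp [h2]
  · rw [map_add, F.map_comp, F.map_comp, hinl, hinr, hfst, hsnd, F.map_one]
    exact opr_injective fun φ => by simp [← map_add, c.opr_total, h1]
  · rw [F.map_d, F.map_comp, hinl, hinr]
    exact opr_injective fun φ => by simp [dOp_opr_closed₀ he']
  · rw [F.map_d, hinr, map_zero]
    exact opr_injective fun φ => by simp [dOp_opr_closed₀ he']

end DGFunctor

/-- In a strongly pretriangulated DG category, shifts and cones of twisted complexes are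
represented by objects. -/
lemma IsStronglyPretriangulatedDG.hasDGCones {k : Type w} [CommRing k] {C : Type u}
    [DGCategory.{w, v, u} k C] (hC : IsStronglyPretriangulatedDG k C) : HasDGCones k C where
  exists_zero := by
    obtain ⟨Z, hZ⟩ := HasDGCones.exists_zero (k := k) (C := TwistedComplex k C)
    obtain ⟨z, e, e', -, -, ee', -⟩ := hC Z
    refine ⟨z, TwistedComplex.singleMap_bijective.1 ?_⟩
    refine ((TwistedComplex.embedding k C).map_one z).trans (ee'.symm.trans ?_)
    rw [← DGCategory.comp_one (add_zero 0) e, hZ, map_zero, map_zero, LinearMap.zero_apply]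
    exact (map_zero _).symm
  shift x n := by
    obtain ⟨s⟩ := HasDGCones.shift (k := k) ((TwistedComplex.embedding k C).obj x) n
    exact (TwistedComplex.embedding k C).nonempty_dgShift TwistedComplex.singleMap_bijective s
      (hC s.obj).choose_spec
  cone f hf := by
    obtain ⟨c⟩ := HasDGCones.cone ((TwistedComplex.embedding k C).map f)
      (by rw [← DGFunctor.map_d, hf, map_zero])
    exact (TwistedComplex.embedding k C).nonempty_dgCone TwistedComplex.singleMap_bijective c
      (hC c.obj).choose_spec

namespace DGMonad

variable {k : Type w} [CommRing k] {C : Type u} [DGCategory.{w, v, u} k C] (N : DGMonad k C)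

/-- The unit `x ⟶ N x`. -/
def unit (x : C) : Hom k x (N.functor.obj x) 0 := N.η.app x

/-- The multiplication `N (N x) ⟶ N x`. -/
def mult (x : C) : Hom k (N.functor.obj (N.functor.obj x)) (N.functor.obj x) 0 := N.μ.app x

lemma opr_unit {x y : C} {n : ℤ} (f : Hom k x y n) (φ : Elements k x) :
    opr (N.unit y) (opr f φ) = opr (N.functor.map f) (opr (N.unit x) φ) :=
  (opr_opr_of_comp_eq (f := f) (N.η.naturality f) φ).trans (opr_comp _ _ _ _)

lemma opr_mult {x y : C} {n : ℤ} (f : Hom k x y n)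
    (φ : Elements k (N.functor.obj (N.functor.obj x))) :
    opr (N.mult y) (opr (N.functor.map (N.functor.map f)) φ) =
      opr (N.functor.map f) (opr (N.mult x) φ) :=
  (opr_opr_of_comp_eq (f := N.functor.map (N.functor.map f)) (N.μ.naturality f) φ).trans
    (opr_comp _ _ _ _)

end DGMonad

namespace EilenbergMoore

variable {k : Type w} [CommRing k] {C : Type u} [DGCategory.{w, v, u} k C] {N : DGMonad k C}

lemma opr_act_map_act (X : EilenbergMoore N) (φ) :
    opr X.act (opr (N.functor.map X.act) φ) = opr X.act (opr (N.mult X.obj) φ) :=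
  (opr_opr_of_comp_eq X.assoc φ).trans (opr_comp _ _ _ _)

lemma opr_act_unit (X : EilenbergMoore N) (φ) : opr X.act (opr (N.unit X.obj) φ) = φ :=
  (opr_opr_of_comp_eq X.unit φ).trans (opr_one _)

/-- The shift of a module. -/
@[reducible] def shiftObj (X : EilenbergMoore N) {n : ℤ} (s : DGShift k X.obj n) :
    EilenbergMoore N where
  obj := s.obj
  act := (N.functor.mapShift s).conj s X.act
  d_act := d_eq_zero fun φ => by
    have h := (N.functor.mapShift s).dOp_inv φ
    rw [DGShift.opr_conj (N.functor.mapShift s), DGShift.opr_conj (N.functor.mapShift s),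
      s.dOp_hom, Int.negOnePow_zero, one_smul, dOp_opr_closed₀ X.d_act, h,
      map_zsmul_unit, map_zsmul_unit, smul_smul, Int.units_mul_self, one_smul]
  assoc := opr_injective fun φ => by
    refine (opr_comp _ _ _ _).trans (Eq.trans ?_ (opr_comp _ (N.mult s.obj) _ _).symm)
    simp [DGShift.opr_conj (N.functor.mapShift s), N.functor.opr_map_conj (N.functor.mapShift s) s,
      opr_act_map_act, ← N.opr_mult]
  unit := opr_injective (x := s.obj) fun φ => by
    refine (opr_comp _ (N.unit s.obj) _ _).trans ?_
    simp [DGShift.opr_conj (N.functor.mapShift s), ← N.opr_unit, opr_act_unit]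

/-- The cone of a morphism of modules. -/
@[reducible] def coneObj {X Y : EilenbergMoore N} (f : hom X Y 0) (c : DGCone f.1) :
    EilenbergMoore N where
  obj := c.obj
  act := (N.functor.mapCone c).map c X.act Y.act 0
  d_act := (N.functor.mapCone c).d_map c X.d_act Y.d_act (by
    rw [map_zero]
    exact (sub_eq_zero.2 f.2).symm)
  assoc := opr_injective fun φ => by
    refine (opr_comp _ _ _ _).trans (Eq.trans ?_ (opr_comp _ (N.mult c.obj) _ _).symm)
    obtain ⟨α, β, rfl⟩ := (N.functor.mapCone (N.functor.mapCone c)).elements_cases φ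
    simp [DGCone.opr_map (N.functor.mapCone c), N.functor.opr_map_map (N.functor.mapCone c),
      opr_act_map_act, N.opr_mult]
  unit := opr_injective (x := c.obj) fun φ => by
    refine (opr_comp _ (N.unit c.obj) _ _).trans ?_
    obtain ⟨α, β, rfl⟩ := c.elements_cases φ
    simp [DGCone.opr_map (N.functor.mapCone c), N.opr_unit, opr_act_unit]

/-- The shift of a module is a shift in the DG category of modules. -/
@[reducible] def dgShift (X : EilenbergMoore N) {n : ℤ} (s : DGShift k X.obj n) :
    DGShift k X n where
  obj := X.shiftObj s
  hom := ⟨s.hom, opr_injective fun φ => by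
    refine (opr_comp _ _ _ _).trans (Eq.trans ?_ (opr_comp _ _ _ _).symm)
    simp [DGShift.opr_conj (N.functor.mapShift s)]⟩
  inv := ⟨s.inv, opr_injective fun φ => by
    refine (opr_comp _ _ _ _).trans (Eq.trans ?_ (opr_comp _ _ _ _).symm)
    simp [DGShift.opr_conj (N.functor.mapShift s)]⟩
  d_hom := Subtype.ext s.d_hom
  hom_inv := Subtype.ext s.hom_inv
  inv_hom := Subtype.ext s.inv_hom

/-- The cone of a morphism of modules is a cone in the DG category of modules. -/
@[reducible] def dgCone {X Y : EilenbergMoore N} (f : Hom k X Y 0) (c : DGCone f.1) :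
    DGCone f where
  obj := coneObj f c
  inl := ⟨c.inl, opr_injective fun φ => by
    refine (opr_comp _ _ _ _).trans (Eq.trans ?_ (opr_comp _ _ _ _).symm)
    simp [DGCone.opr_map (N.functor.mapCone c)]⟩
  inr := ⟨c.inr, opr_injective fun φ => by
    refine (opr_comp _ _ _ _).trans (Eq.trans ?_ (opr_comp _ _ _ _).symm)
    simp [DGCone.opr_map (N.functor.mapCone c)]⟩
  fst := ⟨c.fst, opr_injective fun φ => by
    refine (opr_comp _ _ _ _).trans (Eq.trans ?_ (opr_comp _ _ _ _).symm)
    simp [DGCone.opr_map (N.functor.mapCone c)]⟩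
  snd := ⟨c.snd, opr_injective fun φ => by
    refine (opr_comp _ _ _ _).trans (Eq.trans ?_ (opr_comp _ _ _ _).symm)
    simp [DGCone.opr_map (N.functor.mapCone c)]⟩
  inl_fst := Subtype.ext c.inl_fst
  inr_snd := Subtype.ext c.inr_snd
  inl_snd := Subtype.ext c.inl_snd
  inr_fst := Subtype.ext c.inr_fst
  total := Subtype.ext c.total
  d_inl := Subtype.ext c.d_inl
  d_inr := Subtype.ext c.d_inr

instance [HasDGCones k C] : HasDGCones k (EilenbergMoore N) where
  exists_zero := by
    obtain ⟨z, hz⟩ := HasDGCones.exists_zero (k := k) (C := C)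
    have h {x : C} (f g : Hom k x z 0) : f = g := by
      rw [← DGCategory.comp_one (add_zero 0) f, ← DGCategory.comp_one (add_zero 0) g, hz,
        map_zero, map_zero]
    exact ⟨⟨z, 0, map_zero _, h _ _, h _ _⟩, Subtype.ext hz⟩
  shift X n := by
    obtain ⟨s⟩ := HasDGCones.shift (k := k) X.obj n
    exact ⟨X.dgShift s⟩
  cone {X Y} f hf := by
    obtain ⟨c⟩ := HasDGCones.cone (k := k) f.1 (congrArg Subtype.val hf)
    exact ⟨dgCone f c⟩

end EilenbergMoore

/-! ### DG categories with cones are strongly pretriangulated -/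

namespace DGCone

variable {k : Type w} [CommRing k] {C : Type u} [DGCategory.{w, v, u} k C] {x y : C}

/-- A cone of `f` is a cone of the composite of `f` with a closed isomorphism. -/
@[reducible] def compIso {f : Hom k x y 0} (c : DGCone f) {y' : C} (e : Hom k y y' 0)
    (e' : Hom k y' y 0) (he' : d (zero_add 1) e' = 0) (h : comp (zero_add 0) e e' = one y)
    (h' : comp (zero_add 0) e' e = one y') : DGCone (comp (zero_add 0) f e) where
  obj := c.obj
  inl := c.inl
  inr := comp (zero_add 0) e' c.inr
  fst := c.fst
  snd := comp (zero_add 0) c.snd e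
  inl_fst := c.inl_fst
  inr_snd := opr_injective fun φ => by simp [opr_opr_of_comp_eq h']
  inl_snd := opr_injective fun φ => by simp
  inr_fst := opr_injective fun φ => by simp
  total := opr_injective fun φ => by simp [opr_opr_of_comp_eq h, c.opr_total]
  d_inl := opr_injective fun φ => by simp [opr_opr_of_comp_eq h]
  d_inr := opr_injective fun φ => by simp [dOp_opr_closed₀ he']

/-- Two cones of the same morphism are isomorphic. -/
lemma isomorphic {f : Hom k x y 0} (c c' : DGCone f) : Isomorphic k c.obj c'.obj := by
  have h (c c' : DGCone f) : d (zero_add 1) (c.map c' (one x) (one y) 0) = 0 :=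
    c.d_map c' (d_one _ _) (d_one _ _) (opr_injective fun φ => by simp)
  have h' (c c' : DGCone f) : comp (zero_add 0) (c.map c' (one x) (one y) 0)
      (c'.map c (one x) (one y) 0) = one c.obj :=
    opr_injective fun φ => by simp [c.opr_total]
  exact ⟨_, _, h c c', h c' c, h' c c', h' c' c⟩

/-- An object `z` that is the direct sum of `y` and `w` for the graded structure, with `d` of the
inclusion of `w` given by `g : w ⟶ y`, is a cone of the morphism `w[-1] ⟶ y` defined by `g`. -/
@[reducible] def ofExtension {y z w : C} (s : DGShift k w (-1)) (g : Hom k w y 1)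
    (inl : Hom k w z 0) (inr : Hom k y z 0) (fst : Hom k z w 0) (snd : Hom k z y 0)
    (inl_fst : comp (zero_add 0) inl fst = one w) (inr_snd : comp (zero_add 0) inr snd = one y)
    (inl_snd : comp (zero_add 0) inl snd = 0) (inr_fst : comp (zero_add 0) inr fst = 0)
    (total : comp (zero_add 0) fst inl + comp (zero_add 0) snd inr = one z)
    (d_inl : d (zero_add 1) inl = comp (add_zero 1) g inr) (d_inr : d (zero_add 1) inr = 0) :
    DGCone (comp (neg_add_cancel 1) s.inv g) where
  obj := z
  inl := comp (add_zero (-1)) s.inv inl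
  inr := inr
  fst := comp (zero_add 1) fst s.hom
  snd := snd
  inl_fst := opr_injective fun φ => by simp [opr_opr_of_comp_eq inl_fst]
  inr_snd := inr_snd
  inl_snd := opr_injective fun φ => by simp [opr_opr_of_comp_eq inl_snd]
  inr_fst := opr_injective fun φ => by simp [opr_opr_of_comp_eq inr_fst]
  total := by
    rw [← total]
    exact opr_injective fun φ => by simp
  d_inl := opr_injective fun φ => by
    have h (ψ : Elements k w) : dOp (opr inl ψ) = opr inr (opr g ψ) + opr inl (dOp ψ) := by
      rw [dOp_opr (zero_add 1), d_inl, opr_comp, Int.negOnePow_zero, one_smul]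
    simp [h]
  d_inr := d_inr

end DGCone

namespace FormalSum

variable {k : Type w} [CommRing k] {C : Type u} [DGCategory.{w, v, u} k C] (X : FormalSum C)
  {κ : Type} [Fintype κ] (u : κ → X.ι)

/-- The formal sum of the summands with indices in a family. -/
@[reducible] def sub : FormalSum C := ⟨κ, fun i => X.obj (u i), fun i => X.deg (u i)⟩

variable (k) in
/-- The inclusion of the summands with indices in a family. -/
noncomputable def subInl : Hom k (X.sub u) X 0 :=
  (fun i j => oneMatrix k X i (u j) : hom k (X.sub u) X 0)

variable (k) in
/-- The projection to the summands with indices in a family. -/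
noncomputable def subProj : Hom k X (X.sub u) 0 :=
  (fun i j => oneMatrix k X (u i) j : hom k X (X.sub u) 0)

lemma subInl_comp {Y : FormalSum C} {n : ℤ} (f : Hom k X Y n) :
    comp (zero_add n) (subInl k X u) f =
      (fun i j => (f : hom k X Y n) i (u j) : hom k (X.sub u) Y n) :=
  funext fun i => funext fun j => one_matComp (zero_add n) (f : hom k X Y n) i (u j)

lemma comp_subProj {Y : FormalSum C} {n : ℤ} (f : Hom k Y X n) :
    comp (add_zero n) f (subProj k X u) =
      (fun i j => (f : hom k Y X n) (u i) j : hom k Y (X.sub u) n) :=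
  funext fun i => funext fun j => matComp_one (add_zero n) (f : hom k Y X n) (u i) j

lemma d_subInl : d (zero_add 1) (subInl k X u) = 0 :=
  funext fun i => funext fun j => congrFun (congrFun (matD_one (k := k) X) i) (u j)

lemma d_subProj : d (zero_add 1) (subProj k X u) = 0 :=
  funext fun i => funext fun j => congrFun (congrFun (matD_one (k := k) X) (u i)) j

variable {u}

lemma subInl_comp_subProj (hu : Function.Injective u) :
    comp (zero_add 0) (subInl k X u) (subProj k X u) = one (X.sub u) := by
  refine (subInl_comp X u _).trans (funext fun i => funext fun j => ?_)
  by_cases h : i = j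
  · subst h
    exact (oneMatrix_self X (u i)).trans (oneMatrix_self (X.sub u) i).symm
  · exact (oneMatrix_of_ne X (hu.ne h)).trans (oneMatrix_of_ne (X.sub u) h).symm

variable {κ' : Type} [Fintype κ'] {v : κ' → X.ι}

lemma subInl_comp_subProj_of_disjoint (h : ∀ i j, u i ≠ v j) :
    comp (zero_add 0) (subInl k X u) (subProj k X v) = 0 :=
  (subInl_comp X u _).trans
    (funext fun i => funext fun j => oneMatrix_of_ne X (h j i).symm)

lemma subProj_comp_subInl_add (h : Function.Bijective (Sum.elim u v)) :
    comp (zero_add 0) (subProj k X u) (subInl k X u) +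
      comp (zero_add 0) (subProj k X v) (subInl k X v) = one X := by
  refine Eq.trans ?_ (DGCategory.one_comp (zero_add 0) (one X))
  funext i j
  refine Eq.trans ?_ (Fintype.sum_bijective _ h _ _ fun _ => rfl)
  exact (Fintype.sum_sum_type fun l => comp (k := k) (y := X.obj (Sum.elim u v l))
    (by omega : 0 + X.deg (Sum.elim u v l) - X.deg j + (0 + X.deg i - X.deg (Sum.elim u v l)) =
      0 + X.deg i - X.deg j)
    (oneMatrix k X (Sum.elim u v l) j) (oneMatrix k X i (Sum.elim u v l))).symm

/-- The formal sum `x[r]` with a single summand. -/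
@[reducible] def ofObj (x : C) (r : ℤ) : FormalSum C := ⟨Unit, fun _ => x, fun _ => r⟩

/-- A morphism of `C` as a morphism `x[r] ⟶ y[r']` of formal sums. -/
def ofHom {x y : C} {r r' a b : ℤ} (h : b = a + r' - r) (f : Hom k x y b) :
    Hom k (ofObj x r) (ofObj y r') a :=
  (fun _ _ => castDeg h f : hom k (ofObj x r) (ofObj y r') a)

lemma ofHom_comp_ofHom {x y z : C} {r r' r'' a b c a' b' c' : ℤ} (h : a = a' + r' - r)
    (h' : b = b' + r'' - r') (h'' : c = c' + r'' - r) (e : a + b = c) (e' : a' + b' = c')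
    (f : Hom k x y a) (g : Hom k y z b) :
    comp e' (ofHom h f) (ofHom h' g) = ofHom h'' (comp e f g) := by
  subst h h' h''
  funext i j
  exact Fintype.sum_unique (ι := Unit) fun _ =>
    comp (k := k) (x := x) (y := y) (z := z) e f g

lemma ofHom_one {x : C} {r : ℤ} (h : 0 = 0 + r - r) :
    ofHom h (one (k := k) x) = one (ofObj x r) := by
  funext i j
  exact (oneMatrix_self (ofObj x r) ()).symm

lemma d_ofHom {x y : C} {r r' a b a' b' : ℤ} (h : b = a + r' - r) (e : b + 1 = b')
    (e' : a + 1 = a') {f : Hom k x y b} (hf : d e f = 0) :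
    d e' (ofHom h f : Hom k (ofObj x r) (ofObj y r') a) = 0 := by
  subst h e'
  funext i j
  refine (congrArg (r'.negOnePow • ·) ?_).trans (smul_zero _)
  refine Eq.trans ?_ ((congrArg (castDeg (x := x) (y := y)
    (by omega : b' = a + 1 + r' - r)) hf).trans (map_zero _))
  exact (castDeg_d _ _ _).symm

end FormalSum

namespace TwistedComplex

variable {k : Type w} [CommRing k] {C : Type u} [DGCategory.{w, v, u} k C]

open FormalSum in
/-- The twisted complex of the summands of `X` with indices in the family `u`, when the
differential vanishes on the remaining summands. -/
noncomputable def sub (X : TwistedComplex k C) {κ κ' : Type} [Fintype κ] [Fintype κ']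
    (u : κ → X.sum.ι) (v : κ' → X.sum.ι) (h : Function.Bijective (Sum.elim u v))
    (hv : ∀ i j, (X.q : hom k X.sum X.sum 1) (v i) j = 0) : TwistedComplex k C where
  sum := X.sum.sub u
  q := comp (add_zero 1) (comp (zero_add 1) (subInl k X.sum u) X.q) (subProj k X.sum u)
  triangular := by
    obtain ⟨rank, hrank⟩ := X.triangular
    refine ⟨fun i => rank (u i), fun i j hij => ?_⟩
    rw [subInl_comp, comp_subProj]
    exact hrank _ _ hij
  maurerCartan := opr_injective fun φ => by
    have h1 (φ) : opr (subProj k X.sum v) (opr X.q φ) = 0 := by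
      rw [opr_opr_of_comp_eq (comp_subProj X.sum v X.q), ← opr_zero (n := 1) φ]
      exact congrArg (fun g => opr g φ) (funext fun i => funext fun j => hv i j)
    have h2 (φ) := congrArg (fun g => opr g φ) (subProj_comp_subInl_add (k := k) X.sum h)
    simp only [opr_add, opr_comp, opr_one] at h2
    have h3 (φ) : opr (subInl k X.sum u) (opr (subProj k X.sum u) (opr X.q φ)) = opr X.q φ := by
      simpa [h1] using h2 (opr X.q φ)
    simp [h3, dOp_opr_closed₀ (d_subInl X.sum u), dOp_opr_closed₀ (d_subProj X.sum u), opr_q_q]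

/-- The differential of a morphism that is closed between the underlying formal sums. -/
lemma twistedD_eq {X Y : TwistedComplex k C} {n m : ℤ} {h : n + 1 = m} {f : Hom k X.sum Y.sum n}
    {g : Hom k X.sum Y.sum m} (hf : d h f = 0)
    (H : ∀ φ, opr Y.q (opr f φ) - n.negOnePow • opr f (opr X.q φ) = opr g φ) :
    twistedD h f = g := by
  rw [twistedD_apply, hf, zero_add]
  exact opr_injective fun φ => by simp [H]

variable (k) in
/-- The twisted complex `x[r]`. -/
noncomputable def summand (x : C) (r : ℤ) : TwistedComplex k C where
  sum := FormalSum.ofObj x r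
  q := 0
  triangular := ⟨fun _ => 0, fun _ _ _ => rfl⟩
  maurerCartan := by rw [map_zero, DGCategory.comp_zero, add_zero]

/-- The object `x[r - 1]` of `C`, if it exists, is the shift of `x[r]` by `-1`. -/
noncomputable def dgShiftSummand {x : C} {r : ℤ} (s : DGShift k x (r - 1)) :
    DGShift k (summand k x r) (-1) :=
  dgShiftOfSum (summand k x r) ((embedding k C).obj s.obj)
    (FormalSum.ofHom (by ring : -(r - 1) = - -1 + 0 - r) s.hom)
    (FormalSum.ofHom (by ring : r - 1 = -1 + r - 0) s.inv)
    (FormalSum.d_ofHom _ rfl _ s.d_hom)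
    ((FormalSum.ofHom_comp_ofHom _ _ (by ring) _ _ _ _).trans
      ((congrArg _ s.hom_inv).trans (FormalSum.ofHom_one _)))
    ((FormalSum.ofHom_comp_ofHom _ _ (by ring) _ _ _ _).trans
      ((congrArg _ s.inv_hom).trans (FormalSum.ofHom_one _)))
    fun φ => by
      have h1 : (summand k x r).q = 0 := rfl
      have h2 : ((embedding k C).obj s.obj).q = 0 := rfl
      rw [h1, h2, opr_zero, opr_zero, map_zero, smul_zero]

open FormalSum in
/-- The one step of the induction: a summand of `X` that receives nothing exhibits `X` as the cone
of a morphism from a shift of this summand to the twisted complex of the other summands. -/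
lemma exists_dgCone (X : TwistedComplex k C) {κ : Type} [Fintype κ] (u : κ → X.sum.ι) (i : X.sum.ι)
    (h : Function.Bijective (Sum.elim u fun _ : Unit => i))
    (hi : ∀ j, (X.q : hom k X.sum X.sum 1) i j = 0)
    (s : DGShift k (X.sum.obj i) (X.sum.deg i - 1)) :
    ∃ (f : Hom k ((embedding k C).obj s.obj) (X.sub u (fun _ : Unit => i) h fun _ => hi) 0)
      (c : DGCone f), c.obj = X := by
  have hu : Function.Injective u := fun a b e => Sum.inl.inj (h.1 (a₁ := .inl a) (a₂ := .inl b) e)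
  have hui (a) : u a ≠ i := fun e => Sum.inl_ne_inr (h.1 (a₁ := .inl a) (a₂ := .inr ()) e)
  have hv : Function.Injective fun _ : Unit => i := fun _ _ _ => rfl
  have h1 (φ) : opr (subProj k X.sum fun _ : Unit => i) (opr X.q φ) = 0 := by
    rw [opr_opr_of_comp_eq (comp_subProj X.sum (fun _ : Unit => i) X.q), ← opr_zero (n := 1) φ]
    exact congrArg (fun g => opr g φ) (funext fun i => funext fun j => hi j)
  have h2 (φ) := congrArg (fun g => opr g φ) (subProj_comp_subInl_add (k := k) X.sum h)
  simp only [opr_add, opr_comp, opr_one] at h2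
  have h3 (φ) : opr (subInl k X.sum u) (opr (subProj k X.sum u) (opr X.q φ)) = opr X.q φ := by
    simpa [h1] using h2 (opr X.q φ)
  refine ⟨_, DGCone.ofExtension (y := X.sub u (fun _ : Unit => i) h fun _ => hi) (z := X)
    (w := summand k (X.sum.obj i) (X.sum.deg i)) (dgShiftSummand s)
    (comp (x := X.sum.sub fun _ : Unit => i) (z := X.sum.sub u) (add_zero 1)
      (comp (zero_add 1) (subInl k X.sum _) X.q) (subProj k X.sum u))
    (subInl k X.sum fun _ : Unit => i) (subInl k X.sum u) (subProj k X.sum fun _ : Unit => i)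
    (subProj k X.sum u) (subInl_comp_subProj X.sum hv) (subInl_comp_subProj X.sum hu)
    (subInl_comp_subProj_of_disjoint X.sum fun _ a e => hui a e.symm)
    (subInl_comp_subProj_of_disjoint X.sum fun b _ => hui b)
    ((add_comm _ _).trans (subProj_comp_subInl_add X.sum h)) ?_ ?_, rfl⟩
  · have key (φ : Elements k (X.sum.sub fun _ : Unit => i)) :
        opr X.q (opr (subInl k X.sum fun _ : Unit => i) φ) - (0 : ℤ).negOnePow •
          opr (subInl k X.sum fun _ : Unit => i) (opr (0 : Hom k (X.sum.sub fun _ : Unit => i)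
            (X.sum.sub fun _ : Unit => i) 1) φ) =
          opr (comp (add_zero 1) (comp (add_zero 1) (comp (zero_add 1) (subInl k X.sum _) X.q)
            (subProj k X.sum u)) (subInl k X.sum u)) φ := by simp [h3]
    exact twistedD_eq (X := summand k (X.sum.obj i) (X.sum.deg i)) (d_subInl _ _) key
  · have key (φ : Elements k (X.sum.sub u)) :
        opr X.q (opr (subInl k X.sum u) φ) - (0 : ℤ).negOnePow •
          opr (subInl k X.sum u) (opr (comp (add_zero 1) (comp (zero_add 1)
            (subInl k X.sum u) X.q) (subProj k X.sum u)) φ) =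
          opr (0 : Hom k (X.sum.sub u) X.sum 1) φ := by simp [h3]
    exact twistedD_eq (X := X.sub u (fun _ : Unit => i) h fun _ => hi) (d_subInl _ _) key

end TwistedComplex

/-- If `C` has shifts and cones, then the summands of a twisted complex can be absorbed one by
one. -/
theorem HasDGCones.isStronglyPretriangulatedDG {k : Type w} [CommRing k] {C : Type u}
    [DGCategory.{w, v, u} k C] [HasDGCones k C] : IsStronglyPretriangulatedDG k C := by
  classical
  intro X
  induction h : Fintype.card X.sum.ι generalizing X with
  | zero =>
    have := Fintype.card_eq_zero_iff.1 h
    obtain ⟨z, hz⟩ := HasDGCones.exists_zero (k := k) (C := C)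
    refine ⟨z, 0, 0, map_zero _, map_zero _, ?_, funext fun i => isEmptyElim i⟩
    rw [map_zero, ← (TwistedComplex.embedding k C).map_one, hz, map_zero]
  | succ n ih =>
    have : Nonempty X.sum.ι := Fintype.card_pos_iff.1 (by omega)
    obtain ⟨rank, hrank⟩ := X.triangular
    -- Nothing maps into a summand of maximal rank.
    obtain ⟨i, hi⟩ := Finite.exists_max rank
    have hb : Function.Bijective (Sum.elim (Subtype.val : {j // j ≠ i} → X.sum.ι)
        fun _ : Unit => i) := by
      refine ⟨?_, fun j => ?_⟩
      · rintro (⟨a, ha⟩ | a) (⟨b, hb⟩ | b) hab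
        · exact congrArg Sum.inl (Subtype.ext hab)
        · exact (ha hab).elim
        · exact (hb hab.symm).elim
        · rfl
      · by_cases hj : j = i
        · exact ⟨.inr (), hj.symm⟩
        · exact ⟨.inl ⟨j, hj⟩, rfl⟩
    have hi' (j) := hrank i j (hi j)
    obtain ⟨s⟩ := HasDGCones.shift (k := k) (X.sum.obj i) (X.sum.deg i - 1)
    obtain ⟨f, c, hc⟩ := X.exists_dgCone _ i hb hi' s
    obtain ⟨y, e, e', he, he', hee', he'e⟩ := ih (X.sub _ _ hb fun _ => hi') (by
      have := Fintype.card_congr (Equiv.ofBijective _ hb)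
      rw [Fintype.card_sum, Fintype.card_unit, h] at this
      exact Nat.succ_injective this)
    let c' := c.compIso e' e he he'e hee'
    obtain ⟨g, hg⟩ := TwistedComplex.singleMap_bijective.2 (comp (zero_add 0) f e')
    obtain ⟨b⟩ := HasDGCones.cone g (TwistedComplex.singleMap_bijective.1 (by
      refine ((TwistedComplex.embedding k C).map_d _ _).trans ?_
      refine (congrArg (d _) hg).trans (c'.closed.trans (map_zero _).symm)))
    refine ⟨b.obj, ?_⟩
    have hg' : comp (zero_add 0) f e' = (TwistedComplex.embedding k C).map g := hg.symm
    have key {f' : Hom k ((TwistedComplex.embedding k C).obj s.obj)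
        ((TwistedComplex.embedding k C).obj y) 0} (t : DGCone f')
        (hf : f' = (TwistedComplex.embedding k C).map g) :
        Isomorphic k ((TwistedComplex.embedding k C).obj b.obj) t.obj := by
      subst hf
      exact ((TwistedComplex.embedding k C).mapCone b).isomorphic t
    exact (congrArg (Isomorphic k _) hc).mp (key c' hg')

namespace TwistedComplex

variable (k : Type w) [CommRing k] (C : Type u) [DGCategory.{w, v, u} k C]

instance : (embedding k C).hZero.Full where
  map_surjective {X Y} f := by
    obtain ⟨g, hg, rfl⟩ := HZero.exists_homMk f
    obtain ⟨g', rfl⟩ := singleMap_bijective.2 g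
    refine ⟨HZero.homMk k g' (singleMap_bijective.1 ?_), rfl⟩
    exact ((embedding k C).map_d _ _).trans (hg.trans (map_zero _).symm)

instance : (embedding k C).hZero.Faithful where
  map_injective {X Y f f'} h := by
    obtain ⟨g, hg, rfl⟩ := HZero.exists_homMk f
    obtain ⟨g', hg', rfl⟩ := HZero.exists_homMk f'
    obtain ⟨s, hs⟩ := (HZero.homMk_eq_iff _ _).1 h
    obtain ⟨s', rfl⟩ := singleMap_bijective.2 s
    refine HZero.homMk_eq _ _ s' (singleMap_bijective.1 ?_)
    exact ((embedding k C).map_d _ _).trans (hs.trans (map_sub singleMap _ _).symm)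

end TwistedComplex

lemma IsStronglyPretriangulatedDG.isPretriangulatedDG {k : Type w} [CommRing k] {C : Type u}
    [DGCategory.{w, v, u} k C] (hC : IsStronglyPretriangulatedDG k C) :
    IsPretriangulatedDG k C :=
  { essSurj := ⟨fun X => by
      obtain ⟨x, e, e', he, he', h, h'⟩ := hC X.as
      exact ⟨⟨x⟩, ⟨HZero.isoMk e e' he he' h h'⟩⟩⟩ }

/-! ### The canonical triangulated structure and enhancements -/

namespace DGShift

variable {k : Type w} [CommRing k] {C : Type u} [DGCategory.{w, v, u} k C]

lemma eq_conj {x y : C} {n m : ℤ} (s : DGShift k x n) (t : DGShift k y n) {f : Hom k x y 0}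
    {g : Hom k s.obj t.obj 0} (h : -n + 0 = m) (h' : 0 + -n = m)
    (e : comp h s.hom g = comp h' f t.hom) : g = s.conj t f :=
  opr_injective fun φ => by
    rw [opr_conj, ← opr_comp h', ← e, opr_comp, opr_inv_hom]

lemma comp_hom_comp_uniqueIso {x z : C} {n p : ℤ} (s t : DGShift k x n) (g : Hom k z x p)
    (h : p + -n = 0) : comp h g t.hom =
      comp (zero_add 0) (comp h g s.hom) (s.conj t (one x)) :=
  opr_injective fun φ => by simp

end DGShift

namespace CategoryTheory.Functor

variable {C : Type*} [Category* C] [HasZeroObject C] [HasShift C ℤ] [Preadditive C]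
  [∀ n : ℤ, (CategoryTheory.shiftFunctor C n).Additive] [Pretriangulated C]
  {D : Type*} [Category* D] [HasZeroObject D] [HasShift D ℤ] [Preadditive D]
  [∀ n : ℤ, (CategoryTheory.shiftFunctor D n).Additive] [Pretriangulated D]

/-- The inverse of a triangulated equivalence is triangulated. -/
lemma exists_commShift_inv (F : C ⥤ D) [F.IsEquivalence] [F.CommShift ℤ] [F.IsTriangulated] :
    ∃ _ : F.inv.CommShift ℤ, F.inv.IsTriangulated := by
  let : F.asEquivalence.functor.CommShift ℤ := inferInstanceAs (F.CommShift ℤ)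
  let := F.asEquivalence.commShiftInverse ℤ
  have := F.asEquivalence.commShift_of_functor ℤ
  have : F.asEquivalence.functor.IsTriangulated := inferInstanceAs F.IsTriangulated
  have := Equivalence.IsTriangulated.mk' (E := F.asEquivalence) inferInstance
  exact ⟨F.asEquivalence.commShiftInverse ℤ,
    inferInstanceAs F.asEquivalence.inverse.IsTriangulated⟩

/-- A functor isomorphic to a triangulated functor is triangulated. -/
lemma exists_commShift_of_iso {F G : C ⥤ D} (e : F ≅ G) [F.CommShift ℤ] [F.IsTriangulated] :
    ∃ _ : G.CommShift ℤ, G.IsTriangulated := by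
  let := CommShift.ofIso e ℤ
  have := CommShift.ofIso_compatibility e ℤ
  exact ⟨_, isTriangulated_of_iso e⟩

end CategoryTheory.Functor

namespace TwistedComplex

variable (k : Type w) [CommRing k] (C : Type u) [DGCategory.{w, v, u} k C]

/-- The shift of twisted complexes is the shift functor of `H⁰`. -/
noncomputable def shiftFunctorIso :
    shiftFunctor k C ≅ CategoryTheory.shiftFunctor (HZero k (TwistedComplex k C)) (1 : ℤ) :=
  NatIso.ofComponents (fun X => (dgShiftOne k X.as).uniqueIso (HZero.sh k X.as 1))
    (fun {X Y} f => by
      obtain ⟨f, hf, rfl⟩ := HZero.exists_homMk f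
      have h : shiftMap f = (dgShiftOne k X.as).conj (dgShiftOne k Y.as) f :=
        (dgShiftOne k X.as).eq_conj (dgShiftOne k Y.as) (add_zero (-1)) (zero_add (-1))
          (FormalSum.toShift_comp_shiftMap (X := X.as.sum) (Y := Y.as.sum) (add_zero (-1)) f)
      refine HZero.homMk_congr (f := comp (zero_add 0) (shiftMap f) _) ?_ _ _
      rw [h]
      exact (dgShiftOne k X.as).comp_uniqueIso _ _ _ f)

variable {k C}

lemma coneTriangle_mor₃ {X Y : TwistedComplex k C} (f : Hom k X Y 0) (hf : d (zero_add 1) f = 0) :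
    (HZero.coneTriangle (dgCone f hf)).mor₃ =
      HZero.homMk k (coneProjection f hf) (d_coneProjection f hf) ≫
        (shiftFunctorIso k C).hom.app ⟨X⟩ :=
  HZero.homMk_congr (g := comp (zero_add 0) (coneProjection f hf)
      ((dgShiftOne k X).conj (HZero.sh k X 1) (one X))) (by
    rw [← coneProjection_eq]
    exact (dgShiftOne k X).comp_hom_comp_uniqueIso (HZero.sh k X 1) _ _) _ _

variable {T : Type u'} [Category.{v'} T] [Preadditive T] [HasZeroObject T] [HasShift T ℤ]
  [∀ n : ℤ, (CategoryTheory.shiftFunctor T n).Additive] [Pretriangulated T]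

lemma map_cone_distinguished (Φ : HZero k (TwistedComplex k C) ⥤ T) [Φ.CommShift ℤ]
    [Φ.IsTriangulated] {X Y : TwistedComplex k C} (f : Hom k X Y 0) (hf : d (zero_add 1) f = 0) :
    Triangle.mk (Φ.map (HZero.homMk k f hf))
      (Φ.map (HZero.homMk k (coneInclusion f hf) (d_coneInclusion f hf)))
      (Φ.map (HZero.homMk k (coneProjection f hf) (d_coneProjection f hf)) ≫
        (Functor.isoWhiskerRight (shiftFunctorIso k C) Φ ≪≫ Φ.commShiftIso 1).hom.app ⟨X⟩) ∈
      distTriang T := by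
  have h := Φ.map_distinguished _ (HZero.coneTriangle_distinguished (dgCone f hf))
  have h3 := congrArg (fun g => Φ.map g ≫ (Φ.commShiftIso (1 : ℤ)).hom.app ⟨X⟩)
    (coneTriangle_mor₃ f hf)
  refine (congrArg (· ∈ distTriang T) ?_).mp h
  refine congrArg (Triangle.mk _ _) (h3.trans ?_)
  exact (congrArg (· ≫ _) (Φ.map_comp _ _)).trans (Category.assoc _ _ _)

/-- A functor on `H⁰` of the category of twisted complexes that preserves the shift by `1` and the
cone triangles is triangulated. -/
lemma exists_commShift (Φ : HZero k (TwistedComplex k C) ⥤ T)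
    (e : shiftFunctor k C ⋙ Φ ≅ Φ ⋙ CategoryTheory.shiftFunctor T (1 : ℤ))
    (H : ∀ {X Y : TwistedComplex k C} (f : Hom k X Y 0) (hf : d (zero_add 1) f = 0),
      Triangle.mk (Φ.map (HZero.homMk k f hf))
        (Φ.map (HZero.homMk k (coneInclusion f hf) (d_coneInclusion f hf)))
        (Φ.map (HZero.homMk k (coneProjection f hf) (d_coneProjection f hf)) ≫ e.hom.app ⟨X⟩) ∈
        distTriang T) : ∃ _ : Φ.CommShift ℤ, Φ.IsTriangulated := by
  obtain ⟨h, h1⟩ := Φ.exists_commShift (Functor.isoWhiskerRight (shiftFunctorIso k C).symm Φ ≪≫ e)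
  refine ⟨h, ⟨fun S hS => ?_⟩⟩
  obtain ⟨X, Y, f, c, ⟨i⟩⟩ := hS
  have hf := c.closed
  have hc : HZero.coneTriangle (dgCone f hf) ∈ distTriang _ := HZero.coneTriangle_distinguished _
  have j : HZero.coneTriangle (dgCone f hf) ≅ HZero.coneTriangle c :=
    isoTriangleOfIso₁₂ _ _ hc (HZero.coneTriangle_distinguished _) (Iso.refl _) (Iso.refl _)
      ((Category.comp_id _).trans (Category.id_comp _).symm)
  refine isomorphic_distinguished _ (H f hf) _ (Φ.mapTriangle.mapIso (i ≪≫ j.symm) ≪≫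
    eqToIso ?_)
  have h3 := congrArg (fun g => Φ.map g ≫ (Φ.commShiftIso (1 : ℤ)).hom.app ⟨X⟩)
    (coneTriangle_mor₃ f hf)
  refine congrArg (Triangle.mk _ _) (h3.trans ?_)
  refine (congrArg₂ (· ≫ ·) (Φ.map_comp _ _)
    (congrArg (fun i => i.hom.app ⟨X⟩) h1)).trans ((Category.assoc _ _ _).trans ?_)
  refine congrArg (Φ.map (HZero.homMk k (coneProjection f hf) (d_coneProjection f hf)) ≫ ·) ?_
  refine (Category.assoc _ _ _).symm.trans ?_
  refine (congrArg (· ≫ e.hom.app ⟨X⟩) ((Φ.map_comp _ _).symm.trans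
    (congrArg Φ.map ((shiftFunctorIso k C).hom_inv_id_app ⟨X⟩)))).trans ?_
  exact (congrArg (· ≫ e.hom.app ⟨X⟩) (Φ.map_id _)).trans (Category.id_comp _)

end TwistedComplex

section

variable {k : Type w} [CommRing k] {C : Type u} [DGCategory.{w, v, u} k C]

/-- The homotopy category of a DG category with shifts and cones is enhanced by this DG
category. -/
lemma HZero.exists_enhancement [HasDGCones k C] :
    ∃ S : Enhancement k C (HZero k C), S.ε = 𝟭 (HZero k C) := by
  have hC : IsPretriangulatedDG k C :=
    (HasDGCones.isStronglyPretriangulatedDG (k := k) (C := C)).isPretriangulatedDG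
  have : (TwistedComplex.embedding k C).hZero.IsEquivalence := hC
  obtain ⟨_, _⟩ := (TwistedComplex.embedding k C).hZero.exists_commShift_inv
  obtain ⟨_, _⟩ := Functor.exists_commShift_of_iso (G := hC.extend (𝟭 (HZero k C)))
    (TwistedComplex.embedding k C).hZero.inv.rightUnitor.symm
  exact ⟨⟨hC, 𝟭 _, inferInstance, _, TwistedComplex.map_cone_distinguished _⟩, rfl⟩

variable {T : Type u'} [Category.{v'} T] [Preadditive T] [HasZeroObject T] [HasShift T ℤ]
  [∀ n : ℤ, (CategoryTheory.shiftFunctor T n).Additive] [Pretriangulated T]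

namespace Enhancement

lemma exists_commShift_extend (E : Enhancement k C T) :
    ∃ _ : (E.pretriangulated.extend E.ε).CommShift ℤ,
      (E.pretriangulated.extend E.ε).IsTriangulated :=
  TwistedComplex.exists_commShift _ E.shiftIso E.distinguished

/-- The restriction of the extension of `ε` to twisted complexes is `ε`. -/
noncomputable def embeddingExtendIso (E : Enhancement k C T) :
    (TwistedComplex.embedding k C).hZero ⋙ E.pretriangulated.extend E.ε ≅ E.ε :=
  have : (TwistedComplex.embedding k C).hZero.IsEquivalence := E.pretriangulated
  (Functor.associator _ _ _).symm ≪≫ Functor.isoWhiskerRight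
    (TwistedComplex.embedding k C).hZero.asEquivalence.unitIso.symm E.ε ≪≫ E.ε.leftUnitor

lemma exists_commShift [HasDGCones k C] (E : Enhancement k C T) :
    ∃ _ : E.ε.CommShift ℤ, E.ε.IsTriangulated := by
  obtain ⟨_, _⟩ := E.exists_commShift_extend
  exact Functor.exists_commShift_of_iso E.embeddingExtendIso

end Enhancement

end

/-! ### Monads and equivalences of categories -/

namespace CategoryTheory.Monad

universe v₁ v₂ u₁ u₂

variable {H : Type u₁} [Category.{v₁} H] {T : Type u₂} [Category.{v₂} T]

/-- The natural isomorphism `N ⋙ Φ ≅ Φ ⋙ M` is compatible with the units and multiplications of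
the monads `N` and `M`. -/
structure IsLift (N : Monad H) (M : Monad T) (Φ : H ⥤ T)
    (i : N.toFunctor ⋙ Φ ≅ Φ ⋙ M.toFunctor) : Prop where
  unit (X : H) : Φ.map (N.η.app X) ≫ i.hom.app X = M.η.app (Φ.obj X)
  mul (X : H) : Φ.map (N.μ.app X) ≫ i.hom.app X =
    i.hom.app (N.obj X) ≫ M.map (i.hom.app X) ≫ M.μ.app (Φ.obj X)

variable {N N' : Monad H} {M M' : Monad T} {Φ : H ⥤ T}

lemma IsLift.precomp {i : N.toFunctor ⋙ Φ ≅ Φ ⋙ M.toFunctor} (h : IsLift N M Φ i) (e : N' ≅ N) :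
    IsLift N' M Φ (Functor.isoWhiskerRight (MonadIso.toNatIso e) Φ ≪≫ i) where
  unit X := by
    change Φ.map (N'.η.app X) ≫ Φ.map (e.hom.app X) ≫ i.hom.app X = M.η.app _
    rw [← Φ.map_comp_assoc, e.hom.app_η, h.unit]
    rfl
  mul X := by
    have h1 := congrArg (Φ.map ·) (e.hom.app_μ X)
    have h2 := i.hom.naturality (e.hom.app X)
    have h3 := e.hom.naturality (e.hom.app X)
    simp only [Functor.comp_map, Functor.map_comp, Category.assoc] at h1 h2
    change Φ.map (N'.μ.app X) ≫ Φ.map (e.hom.app X) ≫ i.hom.app X =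
      (Φ.map (e.hom.app (N'.obj X)) ≫ i.hom.app (N'.obj X)) ≫
        M.map (Φ.map (e.hom.app X) ≫ i.hom.app X) ≫ M.μ.app (Φ.obj X)
    rw [reassoc_of% h1, h.mul, Functor.map_comp, Category.assoc, Category.assoc, ← reassoc_of% h2,
      ← Φ.map_comp_assoc, ← Φ.map_comp_assoc, h3]

lemma IsLift.postcomp {i : N.toFunctor ⋙ Φ ≅ Φ ⋙ M.toFunctor} (h : IsLift N M Φ i) (e : M ≅ M') :
    IsLift N M' Φ (i ≪≫ Functor.isoWhiskerLeft Φ (MonadIso.toNatIso e)) where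
  unit X := by
    have := e.hom.app_η (Φ.obj X)
    simp [← this, ← h.unit]
  mul X := by
    have h1 := e.hom.app_μ (Φ.obj X)
    simp [h1, reassoc_of% h.mul]

section

variable {D : Type*} [Category* D]

/-- If the monad of `F ⊣ G` corresponds to `M` under the equivalence `E : H ≌ T`, then the
transported adjunction between `T` and `D` has monad `M`. -/
lemma IsLift.nonempty_iso_of_inv {E : H ≌ T} {F : H ⥤ D} {G : D ⥤ H} {adj : F ⊣ G}
    {i : adj.toMonad.toFunctor ⋙ E.functor ≅ E.functor ⋙ M.toFunctor}
    (h : IsLift adj.toMonad M E.functor i) :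
    Nonempty ((E.symm.toAdjunction.comp adj).toMonad ≅ M) := by
  -- The components are named with the types in which the composites below are formed.
  let a (X : H) : E.functor.obj (G.obj (F.obj X)) ⟶ M.obj (E.functor.obj X) := i.hom.app X
  let c (Y : T) : E.functor.obj (E.inverse.obj Y) ⟶ Y := E.counit.app Y
  let c' (Y : T) : Y ⟶ E.functor.obj (E.inverse.obj Y) := E.counitInv.app Y
  let u (X : H) : E.inverse.obj (E.functor.obj X) ⟶ X := E.unitInv.app X
  let p (X : H) : X ⟶ G.obj (F.obj X) := adj.unit.app X
  let q (Z : D) : F.obj (G.obj Z) ⟶ Z := adj.counit.app Z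
  let m (Y : T) : M.obj (M.obj Y) ⟶ M.obj Y := M.μ.app Y
  let n (Y : T) : Y ⟶ M.obj Y := M.η.app Y
  have hc (Y : T) : c' Y ≫ c Y = 𝟙 Y := E.counitIso.inv_hom_id_app Y
  have hp (X : H) : E.functor.map (p X) ≫ a X = n (E.functor.obj X) := h.unit X
  have hq (X : H) : E.functor.map (G.map (q (F.obj X))) ≫ a X =
    a (G.obj (F.obj X)) ≫ M.map (a X) ≫ m (E.functor.obj X) := h.mul X
  have hn {Y Y' : T} (f : Y ⟶ Y') : f ≫ n Y' = n Y ≫ M.map f := M.η.naturality f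
  have hm {Y Y' : T} (f : Y ⟶ Y') : M.map (M.map f) ≫ m Y' = m Y ≫ M.map f := M.μ.naturality f
  have ha {X X' : H} (f : X ⟶ X') : E.functor.map (G.map (F.map f)) ≫ a X' =
    a X ≫ M.map (E.functor.map f) := i.hom.naturality f
  have hc' {Z Z' : T} (f : Z ⟶ Z') : E.functor.map (E.inverse.map f) ≫ c Z' = c Z ≫ f :=
    E.counit.naturality f
  have hu (Z : H) : c (E.functor.obj Z) = E.functor.map (u Z) := E.counit_app_functor Z
  refine ⟨MonadIso.mk (Functor.isoWhiskerLeft E.inverse i ≪≫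
    Functor.isoWhiskerRight E.counitIso M.toFunctor) (fun Y => ?_) fun Y => ?_⟩
  · let X := E.inverse.obj Y
    refine (congrArg (· ≫ (a X ≫ M.map (c Y)))
      (Adjunction.comp_unit_app E.symm.toAdjunction adj Y)).trans ?_
    change (c' Y ≫ E.functor.map (p X)) ≫ a X ≫ M.map (c Y) = n Y
    rw [Category.assoc, reassoc_of% hp, ← hn, reassoc_of% hc]
  · let X := E.inverse.obj Y
    let f := a X ≫ M.map (c Y)
    have hf : E.functor.map (u (G.obj (F.obj X))) ≫ f = E.functor.map (E.inverse.map f) ≫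
      c (M.obj Y) := by rw [hc', hu]
    refine (congrArg (fun g => E.functor.map (G.map g) ≫ f)
      (Adjunction.comp_counit_app E.symm.toAdjunction adj (F.obj X))).trans ?_
    change E.functor.map (G.map (F.map (u (G.obj (F.obj X))) ≫ q (F.obj X))) ≫ f =
      (E.functor.map (G.map (F.map (E.inverse.map f))) ≫ a (E.inverse.obj (M.obj Y)) ≫
        M.map (c (M.obj Y))) ≫ m Y
    rw [Category.assoc, Category.assoc, reassoc_of% ha, ← M.map_comp_assoc, hc', hu,
      G.map_comp, E.functor.map_comp, Category.assoc]
    dsimp only [f]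
    rw [M.map_comp, M.map_comp, Category.assoc, Category.assoc, hm, reassoc_of% hq,
      reassoc_of% ha]

/-- If the monad of `F ⊣ G` corresponds to `N` under the equivalence `E : H ≌ T`, then the
transported adjunction between `H` and `D` has monad `N`. -/
lemma IsLift.nonempty_iso {E : H ≌ T} {F : T ⥤ D} {G : D ⥤ T} {adj : F ⊣ G}
    {i : N.toFunctor ⋙ E.functor ≅ E.functor ⋙ adj.toMonad.toFunctor}
    (h : IsLift N adj.toMonad E.functor i) :
    Nonempty ((E.toAdjunction.comp adj).toMonad ≅ N) := by
  -- The components are named with the types in which the composites below are formed.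
  let a (Z : H) : E.functor.obj (N.obj Z) ⟶ G.obj (F.obj (E.functor.obj Z)) := i.hom.app Z
  let b (Z : H) : G.obj (F.obj (E.functor.obj Z)) ⟶ E.functor.obj (N.obj Z) := i.inv.app Z
  let c (Y : T) : E.functor.obj (E.inverse.obj Y) ⟶ Y := E.counit.app Y
  let u (X : H) : E.inverse.obj (E.functor.obj X) ⟶ X := E.unitInv.app X
  let u' (X : H) : X ⟶ E.inverse.obj (E.functor.obj X) := E.unit.app X
  let p (X : T) : X ⟶ G.obj (F.obj X) := adj.unit.app X
  let q (Z : D) : F.obj (G.obj Z) ⟶ Z := adj.counit.app Z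
  let m (Y : H) : N.obj (N.obj Y) ⟶ N.obj Y := N.μ.app Y
  let n (Y : H) : Y ⟶ N.obj Y := N.η.app Y
  have hab (Z : H) : a Z ≫ b Z = 𝟙 _ := i.hom_inv_id_app Z
  have hba (Z : H) : b Z ≫ a Z = 𝟙 _ := i.inv_hom_id_app Z
  have huu (X : H) : u' X ≫ u X = 𝟙 X := E.unitIso.hom_inv_id_app X
  have hn (Y : H) : E.functor.map (n Y) ≫ a Y = p (E.functor.obj Y) := h.unit Y
  have hp (Y : H) : p (E.functor.obj Y) ≫ b Y = E.functor.map (n Y) := by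
    rw [← hn, Category.assoc, hab, Category.comp_id]
  have hm (Y : H) : E.functor.map (m Y) ≫ a Y = a (N.obj Y) ≫
    G.map (F.map (a Y)) ≫ G.map (q (F.obj (E.functor.obj Y))) := h.mul Y
  have hq (Y : H) : G.map (q (F.obj (E.functor.obj Y))) ≫ b Y = G.map (F.map (b Y)) ≫
      b (N.obj Y) ≫ E.functor.map (m Y) := by
    have h0 : G.map (F.map (b Y)) ≫ b (N.obj Y) ≫ E.functor.map (m Y) ≫ a Y =
        G.map (q (F.obj (E.functor.obj Y))) := by
      rw [hm, reassoc_of% hba, ← G.map_comp_assoc, ← F.map_comp, hba]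
      simp
    rw [← h0]
    simp only [Category.assoc, hab, Category.comp_id]
  have hc {Z Z' : T} (f : Z ⟶ Z') : E.functor.map (E.inverse.map f) ≫ c Z' = c Z ≫ f :=
    E.counit.naturality f
  have hcu (Z : H) : c (E.functor.obj Z) = E.functor.map (u Z) := E.counit_app_functor Z
  have hu {Z Z' : H} (f : Z ⟶ Z') : E.inverse.map (E.functor.map f) ≫ u Z' = u Z ≫ f :=
    E.unitInv.naturality f
  have hb {X X' : H} (f : X ⟶ X') : b X ≫ E.functor.map (N.map f) =
    G.map (F.map (E.functor.map f)) ≫ b X' := (i.inv.naturality f).symm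
  refine ⟨MonadIso.mk (Functor.isoWhiskerRight i.symm E.inverse ≪≫
    Functor.isoWhiskerLeft N.toFunctor E.unitIso.symm) (fun Y => ?_) fun Y => ?_⟩
  · refine (congrArg (· ≫ (E.inverse.map (b Y) ≫ u (N.obj Y)))
      (Adjunction.comp_unit_app E.toAdjunction adj Y)).trans ?_
    change (u' Y ≫ E.inverse.map (p (E.functor.obj Y))) ≫
      E.inverse.map (b Y) ≫ u (N.obj Y) = n Y
    rw [Category.assoc, ← E.inverse.map_comp_assoc, hp, hu, reassoc_of% huu]
  · let X := E.functor.obj Y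
    let f : E.inverse.obj (G.obj (F.obj X)) ⟶ N.obj Y := E.inverse.map (b Y) ≫ u (N.obj Y)
    have hf : E.functor.map f = c (G.obj (F.obj X)) ≫ b Y := by
      rw [← hc, E.functor.map_comp, ← hcu]
    refine (congrArg (fun g => E.inverse.map (G.map g) ≫ f)
      (Adjunction.comp_counit_app E.toAdjunction adj (F.obj X))).trans ?_
    change E.inverse.map (G.map (F.map (c (G.obj (F.obj X))) ≫ q (F.obj X))) ≫ f =
      (E.inverse.map (G.map (F.map (E.functor.map f))) ≫ E.inverse.map (b (N.obj Y)) ≫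
        u (N.obj (N.obj Y))) ≫ m Y
    rw [Category.assoc, Category.assoc, ← hu, hf]
    simp only [f, ← E.inverse.map_comp_assoc]
    refine congrArg (fun g => E.inverse.map g ≫ _) ?_
    rw [G.map_comp, Category.assoc, hq, F.map_comp, G.map_comp, Category.assoc]

end

end CategoryTheory.Monad

/-! ### The free-forgetful adjunction of a DG monad -/

namespace DGMonad

variable {k : Type w} [CommRing k] {C : Type u} [DGCategory.{w, v, u} k C] (N : DGMonad k C)

lemma d_unit (x : C) : d (zero_add 1) (N.unit x) = 0 := N.η.d_app x

lemma d_mult (x : C) : d (zero_add 1) (N.mult x) = 0 := N.μ.d_app x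

lemma unit_naturality {x y : C} {n : ℤ} (f : Hom k x y n) :
    comp (add_zero n) f (N.unit y) = comp (zero_add n) (N.unit x) (N.functor.map f) :=
  N.η.naturality f

lemma mult_naturality {x y : C} {n : ℤ} (f : Hom k x y n) :
    comp (add_zero n) (N.functor.map (N.functor.map f)) (N.mult y) =
      comp (zero_add n) (N.mult x) (N.functor.map f) :=
  N.μ.naturality f

lemma mult_assoc (x : C) : comp (zero_add 0) (N.functor.map (N.mult x)) (N.mult x) =
    comp (zero_add 0) (N.mult (N.functor.obj x)) (N.mult x) := N.assoc x

lemma unit_mult (x : C) :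
    comp (zero_add 0) (N.unit (N.functor.obj x)) (N.mult x) = one (N.functor.obj x) :=
  N.left_unit x

lemma map_unit_mult (x : C) :
    comp (zero_add 0) (N.functor.map (N.unit x)) (N.mult x) = one (N.functor.obj x) :=
  N.right_unit x

/-- The monad on `H⁰(C)` induced by a DG monad on `C`. -/
def hZero : Monad (HZero k C) where
  toFunctor := N.functor.hZero
  η :=
    { app := fun X => HZero.homMk k (N.unit X.as) (N.d_unit X.as)
      naturality := fun X Y f => by
        obtain ⟨f, hf, rfl⟩ := HZero.exists_homMk f
        exact HZero.homMk_congr (N.unit_naturality f) _ _ }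
  μ :=
    { app := fun X => HZero.homMk k (N.mult X.as) (N.d_mult X.as)
      naturality := fun X Y f => by
        obtain ⟨f, hf, rfl⟩ := HZero.exists_homMk f
        exact HZero.homMk_congr (N.mult_naturality f) _ _ }
  assoc X := HZero.homMk_congr (N.mult_assoc X.as) _ _
  left_unit X := HZero.homMk_congr (N.unit_mult X.as) _ _
  right_unit X := HZero.homMk_congr (N.map_unit_mult X.as) _ _

end DGMonad

namespace EilenbergMoore

variable {k : Type w} [CommRing k] {C : Type u} [DGCategory.{w, v, u} k C] (N : DGMonad k C)

/-- The DG functor that forgets the action. -/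
def forget : DGFunctor k (EilenbergMoore N) C where
  obj X := X.obj
  map {X Y n} := (hom X Y n).subtype
  map_one _ := rfl
  map_comp _ _ _ := rfl
  map_d _ _ := rfl

/-- The free module `N x`. -/
def freeObj (x : C) : EilenbergMoore N where
  obj := N.functor.obj x
  act := N.mult x
  d_act := N.d_mult x
  assoc := N.mult_assoc x
  unit := N.unit_mult x

/-- The DG functor of free modules. -/
def free : DGFunctor k C (EilenbergMoore N) where
  obj := freeObj N
  map {x y n} := N.functor.map.codRestrict (hom (freeObj N x) (freeObj N y) n) N.mult_naturality
  map_one x := Subtype.ext (N.functor.map_one x)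
  map_comp h f g := Subtype.ext (N.functor.map_comp h f g)
  map_d h f := Subtype.ext (N.functor.map_d h f)

/-- The action of a module as a morphism of modules from the free module. -/
def counit (X : EilenbergMoore N) : Hom k (freeObj N X.obj) X 0 := ⟨X.act, X.assoc⟩

/-- The free modules are left adjoint to the forgetful functor on the level of `H⁰`. -/
def adjunction : (free N).hZero ⊣ (forget N).hZero :=
  Adjunction.mkOfUnitCounit
    { unit :=
        { app := fun X => HZero.homMk k (N.unit X.as) (N.d_unit X.as)
          naturality := fun X Y f => by
            obtain ⟨f, hf, rfl⟩ := HZero.exists_homMk f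
            exact HZero.homMk_congr (N.unit_naturality f) _ _ }
      counit :=
        { app := fun X => HZero.homMk k (counit N X.as) (Subtype.ext X.as.d_act)
          naturality := fun X Y f => by
            obtain ⟨f, hf, rfl⟩ := HZero.exists_homMk f
            exact HZero.homMk_congr (f := comp (zero_add 0) ((free N).map f.1) (counit N Y.as))
              (g := comp (zero_add 0) (counit N X.as) f) (Subtype.ext f.2) _ _ }
      left_triangle := by
        ext X
        refine (congrArg ((free N).hZero.map (HZero.homMk k (N.unit X.as) (N.d_unit X.as)) ≫ ·)
          (Category.id_comp _)).trans ?_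
        exact HZero.homMk_congr (Subtype.ext (N.map_unit_mult X.as)) _ _
      right_triangle := by
        ext X
        refine (congrArg (HZero.homMk k (N.unit X.as.obj) (N.d_unit X.as.obj) ≫ ·)
          (Category.id_comp _)).trans ?_
        exact HZero.homMk_congr X.as.unit _ _ }

/-- The monad of the free-forgetful adjunction. -/
def toMonadIso : (adjunction N).toMonad ≅ N.hZero :=
  MonadIso.mk (NatIso.ofComponents (fun X => Iso.refl _) fun {X Y} f => by
      obtain ⟨f, hf, rfl⟩ := HZero.exists_homMk f
      exact (Category.comp_id _).trans (Category.id_comp _).symm)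
    (fun X => Category.comp_id _)
    (fun X => (Category.comp_id _).trans ((congrArg (· ≫ N.hZero.μ.app X)
      ((Category.comp_id _).trans ((adjunction N).toMonad.map_id _))).trans
        (Category.id_comp _)).symm)

end EilenbergMoore

/-! ### The monad induced on twisted complexes -/

namespace TwistedComplex

variable {k : Type w} [CommRing k] {C : Type u} [DGCategory.{w, v, u} k C]

/-- The identity matrix as a morphism from the single summand `F x` to the image under `F` of the
single summand `x`: these two twisted complexes coincide up to the form of their (zero) matrix
`q`. -/
noncomputable def toTwistedSingle (F : DGFunctor k C C) (x : C) :
    Hom k (single k (F.obj x)) (F.twisted.obj (single k x)) 0 :=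
  one (k := k) (single k (F.obj x)).sum

/-- The inverse of `toTwistedSingle`. -/
noncomputable def ofTwistedSingle (F : DGFunctor k C C) (x : C) :
    Hom k (F.twisted.obj (single k x)) (single k (F.obj x)) 0 :=
  one (k := k) (single k (F.obj x)).sum

lemma twistedD_one_eq_zero {X Y : TwistedComplex k C} (e : X.sum = Y.sum) (hX : X.q = 0)
    (hY : Y.q = 0) : twistedD (X := X) (Y := Y) (zero_add 1) (e ▸ one (k := k) X.sum) = 0 := by
  obtain ⟨S, q, _, _⟩ := X
  obtain ⟨S', q', _, _⟩ := Y
  obtain rfl : S = S' := e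
  obtain rfl : q = (0 : Hom k S S 1) := hX
  obtain rfl : q' = (0 : Hom k S S 1) := hY
  refine (twistedD_apply _ _).trans ?_
  simp

lemma d_toTwistedSingle (F : DGFunctor k C C) (x : C) :
    d (zero_add 1) (toTwistedSingle (k := k) F x) = 0 :=
  twistedD_one_eq_zero (X := single k (F.obj x)) (Y := F.twisted.obj (single k x)) rfl rfl
    (map_zero _)

lemma d_ofTwistedSingle (F : DGFunctor k C C) (x : C) :
    d (zero_add 1) (ofTwistedSingle (k := k) F x) = 0 :=
  twistedD_one_eq_zero (X := F.twisted.obj (single k x)) (Y := single k (F.obj x)) rfl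
    (map_zero _) rfl

lemma singleMap_comp_toTwistedSingle (F : DGFunctor k C C) {x y : C} {n : ℤ} (f : Hom k x y n) :
    comp (add_zero n) (singleMap (F.map f)) (toTwistedSingle F y) =
      comp (zero_add n) (toTwistedSingle F x) (F.twisted.map (singleMap f)) := by
  refine (DGCategory.comp_one (k := k) (C := FormalSum C) (x := (single k (F.obj x)).sum)
    (y := (single k (F.obj y)).sum)
    (add_zero n) (singleMap (F.map f))).trans ?_
  refine Eq.trans ?_ (DGCategory.one_comp (k := k) (C := FormalSum C)
    (x := (single k (F.obj x)).sum)
    (y := (single k (F.obj y)).sum) (zero_add n) (F.twisted.map (singleMap f))).symm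
  funext i j
  exact (F.map_castDeg _ f).symm

/-- On objects with a single summand, the embedding into twisted complexes commutes with the
extension of a DG functor. -/
noncomputable def singleIso (F : DGFunctor k C C) :
    F.hZero ⋙ (embedding k C).hZero ≅ (embedding k C).hZero ⋙ F.twisted.hZero :=
  NatIso.ofComponents (fun X => HZero.isoMk (toTwistedSingle F X.as) (ofTwistedSingle F X.as)
    (d_toTwistedSingle F X.as) (d_ofTwistedSingle F X.as)
    (DGCategory.comp_one (k := k) (C := FormalSum C) (x := (single k (F.obj X.as)).sum) _ _)
    (DGCategory.comp_one (k := k) (C := FormalSum C) (x := (single k (F.obj X.as)).sum) _ _))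
    fun {X Y} f => by
      obtain ⟨f, hf, rfl⟩ := HZero.exists_homMk f
      exact HZero.homMk_congr (singleMap_comp_toTwistedSingle F f) _ _

lemma diag_single {x y : C} (ν : Hom k x y 0) :
    FormalSum.diag (single k x).sum (fun _ => y) (fun _ => ν) =
      (singleMap ν : FormalSum.hom k (single k x).sum (single k y).sum 0) := by
  funext i j
  refine (congrArg (fun z => comp (x := x) (add_zero _) z ν)
    (FormalSum.oneMatrix_self (k := k) (single k x).sum ())).trans ?_
  exact (castDeg_comp _ _ _ _).trans (one_comp' _ _)

/-- The embedding into twisted complexes relates a DG monad to its extension. -/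
lemma isLift_singleIso (N : DGMonad k C) :
    Monad.IsLift N.hZero N.twisted.hZero (embedding k C).hZero (singleIso N.functor) where
  unit X := by
    refine HZero.homMk_congr (f := comp (add_zero 0) (singleMap (N.unit X.as))
      (toTwistedSingle N.functor X.as)) (g := N.twisted.unit (single k X.as)) ?_ _ _
    refine (DGCategory.comp_one (k := k) (C := FormalSum C) (x := (single k X.as).sum)
      (y := (single k (N.functor.obj X.as)).sum) (add_zero 0) (singleMap (N.unit X.as))).trans ?_
    exact (diag_single (N.unit X.as)).symm
  mul X := by
    let Y := single k X.as
    refine HZero.homMk_congr (f := comp (zero_add 0) (singleMap (N.mult X.as))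
      (toTwistedSingle N.functor X.as)) (g := comp (zero_add 0)
        (toTwistedSingle N.functor (N.functor.obj X.as)) (comp (zero_add 0)
          (N.twisted.functor.map (toTwistedSingle N.functor X.as)) (N.twisted.mult Y))) ?_ _ _
    refine (DGCategory.comp_one (k := k) (C := FormalSum C)
      (x := (single k (N.functor.obj (N.functor.obj X.as))).sum)
      (y := (single k (N.functor.obj X.as)).sum) (add_zero 0)
      (singleMap (N.mult X.as))).trans ?_
    have h1 : N.twisted.functor.map (toTwistedSingle N.functor X.as) =
        one (k := k) (single k (N.functor.obj (N.functor.obj X.as))).sum :=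
      N.functor.formalSum.map_one (single k (N.functor.obj X.as)).sum
    have h2 := DGCategory.one_comp (k := k) (C := FormalSum C)
      (x := (single k (N.functor.obj (N.functor.obj X.as))).sum)
      (y := (single k (N.functor.obj X.as)).sum) (zero_add 0) (N.twisted.mult Y)
    refine (diag_single (N.mult X.as)).symm.trans (h2.symm.trans ?_)
    refine Eq.trans ?_ (DGCategory.one_comp (k := k) (C := FormalSum C)
      (x := (single k (N.functor.obj (N.functor.obj X.as))).sum)
      (y := (single k (N.functor.obj X.as)).sum) (zero_add 0) _).symm
    exact congrArg (fun z => comp (C := TwistedComplex k C)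
      (x := N.twisted.functor.obj (single k (N.functor.obj X.as)))
      (y := N.twisted.functor.obj (N.twisted.functor.obj Y))
      (z := N.twisted.functor.obj Y) (zero_add 0) z (N.twisted.mult Y)) h1.symm

end TwistedComplex

/-! ### Lifting monads on triangulated categories -/

/-- A left adjoint of a triangulated functor is triangulated. -/
lemma CategoryTheory.Adjunction.exists_commShift {D T : Type*} [Category* D] [Category* T]
    [Preadditive D] [Preadditive T] [HasZeroObject D] [HasZeroObject T] [HasShift D ℤ]
    [HasShift T ℤ] [∀ n : ℤ, (CategoryTheory.shiftFunctor D n).Additive]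
    [∀ n : ℤ, (CategoryTheory.shiftFunctor T n).Additive] [Pretriangulated D] [Pretriangulated T]
    {F : T ⥤ D} {G : D ⥤ T} (adj : F ⊣ G) [G.CommShift ℤ] [G.IsTriangulated] :
    ∃ _ : F.CommShift ℤ, F.IsTriangulated := by
  let _ := adj.leftAdjointCommShift ℤ
  have := adj.commShift_of_rightAdjoint ℤ
  exact ⟨inferInstance, adj.isTriangulated_leftAdjoint⟩

namespace DGLift

variable {k : Type w} [CommRing k] {T : Type u'} [Category.{v'} T] {M : CategoryTheory.Monad T}
  {A : Type u} [DGCategory.{w, v, u} k A] {ε : HZero k A ⥤ T}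

lemma IsMonadLift.isLift {L : DGLift ε M} (hL : L.IsMonadLift) :
    Monad.IsLift L.monad.hZero M ε L.iso where
  unit X := hL.unit X.as
  mul X := hL.mul X.as

/-- An adjunction on `H⁰(A)` whose monad is `H⁰` of the lift of `M` becomes, when transported along
the equivalence `ε`, an adjunction with the underlying functor of `M`, and with the monad `M` if
the lift respects units and multiplications. -/
lemma nonempty_iso (L : DGLift ε M) [ε.IsEquivalence] {D : Type*} [Category* D]
    {F : HZero k A ⥤ D} {G : D ⥤ HZero k A} {adj : F ⊣ G} (e : adj.toMonad ≅ L.monad.hZero) :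
    Nonempty ((ε.asEquivalence.inverse ⋙ F) ⋙ (G ⋙ ε) ≅ M.toFunctor) ∧
      (L.IsMonadLift →
        Nonempty ((ε.asEquivalence.symm.toAdjunction.comp adj).toMonad ≅ M)) := by
  refine ⟨⟨?_⟩, fun hL => (hL.isLift.precomp e).nonempty_iso_of_inv (E := ε.asEquivalence)⟩
  exact Functor.isoWhiskerLeft ε.asEquivalence.inverse
      (Functor.isoWhiskerRight (MonadIso.toNatIso e) ε ≪≫ L.iso) ≪≫
    Functor.isoWhiskerRight ε.asEquivalence.counitIso M.toFunctor ≪≫ M.toFunctor.leftUnitor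

end DGLift

theorem mainTheorem2 {k : Type w} [CommRing k] {T : Type u'} [Category.{v'} T] [Preadditive T]
    [HasZeroObject T] [HasShift T ℤ] [∀ n : ℤ, (CategoryTheory.shiftFunctor T n).Additive]
    [Pretriangulated T] [IsTriangulated T]
    (M : CategoryTheory.Monad T) [M.toFunctor.CommShift ℤ] [M.toFunctor.IsTriangulated]
    {A : Type u} [DGCategory.{w, v, u} k A] (E : Enhancement k A T) (L : DGLift E.ε M) :
    (IsStronglyPretriangulatedDG k A →
      ∃ (_ : HasZeroObject (HZero k (EilenbergMoore L.monad)))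
        (_ : HasShift (HZero k (EilenbergMoore L.monad)) ℤ)
        (_ : ∀ n : ℤ, (CategoryTheory.shiftFunctor (HZero k (EilenbergMoore L.monad)) n).Additive)
        (_ : Pretriangulated (HZero k (EilenbergMoore L.monad))),
        IsTriangulated (HZero k (EilenbergMoore L.monad)) ∧
        (∃ S : Enhancement k (EilenbergMoore L.monad) (HZero k (EilenbergMoore L.monad)),
          S.ε = 𝟭 (HZero k (EilenbergMoore L.monad))) ∧
        ∃ (F : T ⥤ HZero k (EilenbergMoore L.monad)) (G : HZero k (EilenbergMoore L.monad) ⥤ T)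
          (_ : F.CommShift ℤ) (_ : G.CommShift ℤ) (adj : F ⊣ G),
          F.IsTriangulated ∧ G.IsTriangulated ∧ Nonempty (F ⋙ G ≅ M.toFunctor) ∧
          (L.IsMonadLift → Nonempty (adj.toMonad ≅ M))) ∧
    (∃ (_ : HasZeroObject (HZero k (EilenbergMoore L.monad.twisted)))
      (_ : HasShift (HZero k (EilenbergMoore L.monad.twisted)) ℤ)
      (_ : ∀ n : ℤ,
        (CategoryTheory.shiftFunctor (HZero k (EilenbergMoore L.monad.twisted)) n).Additive)
      (_ : Pretriangulated (HZero k (EilenbergMoore L.monad.twisted))),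
      IsTriangulated (HZero k (EilenbergMoore L.monad.twisted)) ∧
      (∃ S : Enhancement k (EilenbergMoore L.monad.twisted)
          (HZero k (EilenbergMoore L.monad.twisted)),
        S.ε = 𝟭 (HZero k (EilenbergMoore L.monad.twisted))) ∧
      ∃ (F : T ⥤ HZero k (EilenbergMoore L.monad.twisted))
        (G : HZero k (EilenbergMoore L.monad.twisted) ⥤ T)
        (_ : F.CommShift ℤ) (_ : G.CommShift ℤ) (adj : F ⊣ G),
        F.IsTriangulated ∧ G.IsTriangulated ∧ Nonempty (F ⋙ G ≅ M.toFunctor) ∧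
        (L.IsMonadLift → Nonempty (adj.toMonad ≅ M))) := by
  refine ⟨fun hA => ?_, ?_⟩
  · have := hA.hasDGCones
    have := E.isEquivalence
    obtain ⟨_, _⟩ := E.exists_commShift
    let adj : E.ε.asEquivalence.inverse ⋙ (EilenbergMoore.free L.monad).hZero ⊣
        (EilenbergMoore.forget L.monad).hZero ⋙ E.ε :=
      E.ε.asEquivalence.symm.toAdjunction.comp (EilenbergMoore.adjunction L.monad)
    obtain ⟨_, _⟩ := adj.exists_commShift
    obtain ⟨h1, h2⟩ := L.nonempty_iso (EilenbergMoore.toMonadIso L.monad)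
    exact ⟨inferInstance, inferInstance, inferInstance, inferInstance, inferInstance,
      HZero.exists_enhancement, _, _, _, _, adj,
      inferInstance, inferInstance, h1, h2⟩
  · have : (TwistedComplex.embedding k A).hZero.IsEquivalence := E.pretriangulated
    have := E.isEquivalence
    obtain ⟨_, _⟩ := E.exists_commShift_extend
    -- The adjunction is composed with the equivalence `I` of `H⁰(A)` and `H⁰(Tw A)`. Its right
    -- adjoint, followed by `ε`, is the forgetful functor followed by the extension of `ε`.
    let I := (TwistedComplex.embedding k A).hZero.asEquivalence
    let G := (EilenbergMoore.forget L.monad.twisted).hZero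
    obtain ⟨_, _⟩ := Functor.exists_commShift_of_iso (F := G ⋙ E.pretriangulated.extend E.ε)
      (G := (G ⋙ I.inverse) ⋙ E.ε) (Functor.associator _ _ _).symm
    let F := (EilenbergMoore.free L.monad.twisted).hZero
    let adj : E.ε.asEquivalence.inverse ⋙ (I.functor ⋙ F) ⊣ (G ⋙ I.inverse) ⋙ E.ε :=
      E.ε.asEquivalence.symm.toAdjunction.comp
        (I.toAdjunction.comp (EilenbergMoore.adjunction L.monad.twisted))
    obtain ⟨_, _⟩ := adj.exists_commShift
    obtain ⟨e⟩ := ((TwistedComplex.isLift_singleIso L.monad).postcomp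
      (EilenbergMoore.toMonadIso L.monad.twisted).symm).nonempty_iso (E := I)
    obtain ⟨h1, h2⟩ := L.nonempty_iso e
    exact ⟨inferInstance, inferInstance, inferInstance, inferInstance, inferInstance,
      HZero.exists_enhancement, _, _, _, _, adj,
      inferInstance, inferInstance, h1, h2⟩
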